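/- Let $\mathcal S$ be the category of $C^\infty$-manifolds and $C^\infty$-maps. Manifolds are finite dimensional and second countable, not assumed Hausdorff, and the dimension is only assumed locally constant. Equip $\mathcal S$ with the étale topology, whose covering families are the jointly surjective families of étale maps (local diffeomorphisms). A groupoid fibration is a category fibered in groupoids over $\mathcal S$; a manifold $X$ is identified with the groupoid fibration of smooth maps $U\to X$, and a family $x/X$ (an object of $\mathfrak X$ over $X$) with a morphism $x:X\to\mathfrak X$ of groupoid fibrations. Two groupoid fibrations are isomorphic if there are functors over $\mathcal S$ in both directions whose composites are isomorphic, over $\mathcal S$, to the identities. A morphism $F:\mathfrak X\to\mathfrak Y$ of groupoid fibrations is a representable submersion if for every morphism $U\to\mathfrak Y$ from a manifold the 2-fiber product $\mathfrak X\times_{\mathfrak Y}U$ is isomorphic to a manifold $V$ and the induced map $V\to U$ is a submersion; it is an epimorphism if every morphism $U\to\mathfrak Y$ from a manifold lifts to $\mathfrak X$, up to 2-isomorphism, after composition with some surjective submersion $V\to U$. A versal family for $\mathfrak X$ is a morphism $x:X\to\mathfrak X$ from a manifold that is a representable submersion and an epimorphism. A differentiable stack is a stack over $\mathcal S$ that admits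 a versal family. A Lie groupoid is a groupoid in $\mathcal S$ whose source and target maps $s,t$ are submersions. For a Lie groupoid $\Gamma\rightrightarrows M$, a $\Gamma$-torsor over a manifold $S$ is a manifold $P$ with a surjective submersion $\pi:P\to S$ and a smooth right action of $\Gamma$ along a smooth anchor map $a:P\to M$ ($p\cdot\gamma$ is defined when $a(p)=s(\gamma)$), satisfying $\pi(p\cdot\gamma)=\pi(p)$, such that for all $p,p'\in P$ with $\pi(p)=\pi(p')$ there is a unique $\gamma\in\Gamma$ such that $p\cdot\gamma$ is defined and $p\cdot\gamma=p'$. A morphism of torsors is a commutative square of smooth maps whose upper map is $\Gamma$-equivariant. $B\Gamma$ denotes the category of $\Gamma$-torsors over varying manifolds, with the functor to $\mathcal S$ that sends a torsor over $S$ to $S$. **Theorem.** Let $\mathfrak X$ be a differentiable stack and $x:X\to\mathfrak X$ a versal family. Then the fiber product $\underline{\mathrm{Isom}}(x,x)=X\times_{\mathfrak X}X$, with its two projections to $X$ and the composition $(y,\phi,y')\cdot(y',\psi,y'')=(y,\psi\circ\phi,y'')$, is represented by a Lie groupoid $\Gamma\rightrightarrows X$, and for every Lie groupoid $\Gamma\rightrightarrows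 X$ representing it there is an isomorphism of groupoid fibrations over $\mathcal S$ $$\mathfrak X\;\cong\;B\Gamma .$$ -/

import Mathlib

open CategoryTheory
open scoped ContDiff

universe u v₀ u₀ v₁ u₁ v₂ u₂ v₃ u₃

/-! ## The category of smooth manifolds -/

/-- A smooth manifold: second countable, not necessarily Hausdorff, without boundary, of finite
dimension at every point. The dimension is only locally constant (it may differ between connected
components), so the charts take values in `ℝⁿ` with varying `n`. -/
structure Mfd : Type (u + 1) where
  carrier : Type u
  [top : TopologicalSpace carrier]
  [secondCountable : SecondCountableTopology carrier]
  /-- The charts with values in `ℝⁿ`. -/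
  atlas : ∀ n : ℕ, Set (OpenPartialHomeomorph carrier (EuclideanSpace ℝ (Fin n)))
  exists_chart : ∀ x : carrier, ∃ n, ∃ c ∈ atlas n, x ∈ c.source
  compatible : ∀ ⦃m n : ℕ⦄ ⦃c : OpenPartialHomeomorph carrier (EuclideanSpace ℝ (Fin m))⦄
    ⦃d : OpenPartialHomeomorph carrier (EuclideanSpace ℝ (Fin n))⦄, c ∈ atlas m → d ∈ atlas n →
      ContDiffOn ℝ ∞ (d ∘ c.symm) (c.target ∩ c.symm ⁻¹' d.source)

namespace Mfd

instance : CoeSort Mfd.{u} (Type u) := ⟨Mfd.carrier⟩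

instance (M : Mfd.{u}) : TopologicalSpace M := M.top

instance (M : Mfd.{u}) : SecondCountableTopology M := M.secondCountable

/-- Smoothness: continuous, and `C^∞` in all charts. -/
structure IsSmooth {M N : Mfd.{u}} (f : M → N) : Prop where
  continuous : Continuous f
  contDiffOn : ∀ ⦃m n : ℕ⦄ ⦃c : OpenPartialHomeomorph M (EuclideanSpace ℝ (Fin m))⦄
    ⦃d : OpenPartialHomeomorph N (EuclideanSpace ℝ (Fin n))⦄, c ∈ M.atlas m → d ∈ N.atlas n →
      ContDiffOn ℝ ∞ (d ∘ f ∘ c.symm) (c.target ∩ c.symm ⁻¹' (f ⁻¹' d.source))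

theorem isSmooth_id (M : Mfd.{u}) : IsSmooth (id : M → M) :=
  ⟨continuous_id, fun _ _ _ _ hc hd => M.compatible hc hd⟩

theorem IsSmooth.comp {M N P : Mfd.{u}} {g : N → P} {f : M → N} (hg : IsSmooth g)
    (hf : IsSmooth f) : IsSmooth (g ∘ f) := by
  refine ⟨hg.continuous.comp hf.continuous, ?_⟩
  intro m n c d hc hd y hy
  obtain ⟨hy1, hy2⟩ := hy
  obtain ⟨k, e, he, hye⟩ := N.exists_chart (f (c.symm y))
  have h1 := hf.contDiffOn hc he
  have h2 := hg.contDiffOn he hd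
  have hmem : y ∈ c.target ∩ c.symm ⁻¹' (f ⁻¹' e.source) := ⟨hy1, hye⟩
  have hopen : IsOpen (c.target ∩ c.symm ⁻¹' (f ⁻¹' e.source)) :=
    c.isOpen_inter_preimage_symm (e.open_source.preimage hf.continuous)
  have key : ContDiffWithinAt ℝ ∞ ((d ∘ g ∘ e.symm) ∘ (e ∘ f ∘ c.symm))
      ((c.target ∩ c.symm ⁻¹' (f ⁻¹' e.source)) ∩
        (e ∘ f ∘ c.symm) ⁻¹' (e.target ∩ e.symm ⁻¹' (g ⁻¹' d.source))) y := by
    refine ContDiffWithinAt.comp y (h2 _ ?_) ((h1 y hmem).mono Set.inter_subset_left)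
      (fun z hz => hz.2)
    refine ⟨e.map_source hye, ?_⟩
    simpa [e.left_inv hye] using hy2
  have hsub : (c.target ∩ c.symm ⁻¹' ((g ∘ f) ⁻¹' d.source)) ∩
      (c.target ∩ c.symm ⁻¹' (f ⁻¹' e.source)) ⊆
      (c.target ∩ c.symm ⁻¹' (f ⁻¹' e.source)) ∩
        (e ∘ f ∘ c.symm) ⁻¹' (e.target ∩ e.symm ⁻¹' (g ⁻¹' d.source)) := by
    rintro z ⟨⟨_, hz2⟩, hz3, hz4⟩
    refine ⟨⟨hz3, hz4⟩, e.map_source hz4, ?_⟩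
    have := e.left_inv hz4
    simp only [Set.mem_preimage, Function.comp_apply] at hz2 ⊢
    rw [this]; exact hz2
  have key2 : ContDiffWithinAt ℝ ∞ (d ∘ (g ∘ f) ∘ c.symm)
      ((c.target ∩ c.symm ⁻¹' ((g ∘ f) ⁻¹' d.source)) ∩
      (c.target ∩ c.symm ⁻¹' (f ⁻¹' e.source))) y := by
    refine (key.mono hsub).congr ?_ ?_
    · rintro z ⟨_, _, hz4⟩
      simp only [Function.comp_apply]
      rw [e.left_inv hz4]
    · simp only [Function.comp_apply]
      rw [e.left_inv hye]
  exact (contDiffWithinAt_inter (hopen.mem_nhds hmem)).1 key2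

/-- Smooth maps between manifolds. -/
@[ext]
structure SmoothMap (M N : Mfd.{u}) where
  toFun : M → N
  smooth : IsSmooth toFun

instance (M N : Mfd.{u}) : FunLike (SmoothMap M N) M N where
  coe := SmoothMap.toFun
  coe_injective _ _ h := SmoothMap.ext h

instance : Category Mfd.{u} where
  Hom := SmoothMap
  id M := ⟨id, isSmooth_id M⟩
  comp f g := ⟨g.toFun ∘ f.toFun, g.smooth.comp f.smooth⟩

instance : ConcreteCategory Mfd.{u} SmoothMap where
  hom f := f
  ofHom f := f

/-- A submersion: the derivative, computed in charts, is surjective at every point. -/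
def IsSubmersion {M N : Mfd.{u}} (f : M ⟶ N) : Prop :=
  ∀ ⦃m n : ℕ⦄ ⦃c : OpenPartialHomeomorph M (EuclideanSpace ℝ (Fin m))⦄
    ⦃d : OpenPartialHomeomorph N (EuclideanSpace ℝ (Fin n))⦄, c ∈ M.atlas m → d ∈ N.atlas n →
      ∀ x : M, x ∈ c.source → f x ∈ d.source →
        Function.Surjective (fderiv ℝ (d ∘ f ∘ c.symm) (c x))

/-- An étale map: a submersion of relative dimension zero, i.e. the derivative, computed in
charts, is bijective at every point. -/
def IsEtale {M N : Mfd.{u}} (f : M ⟶ N) : Prop :=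
  ∀ ⦃m n : ℕ⦄ ⦃c : OpenPartialHomeomorph M (EuclideanSpace ℝ (Fin m))⦄
    ⦃d : OpenPartialHomeomorph N (EuclideanSpace ℝ (Fin n))⦄, c ∈ M.atlas m → d ∈ N.atlas n →
      ∀ x : M, x ∈ c.source → f x ∈ d.source →
        Function.Bijective (fderiv ℝ (d ∘ f ∘ c.symm) (c x))

/-- A covering family of `S`: étale maps `U i ⟶ S` that are jointly surjective. -/
structure IsCoveringFamily {S : Mfd.{u}} {ι : Type u} {U : ι → Mfd.{u}} (f : ∀ i, U i ⟶ S) :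
    Prop where
  etale : ∀ i, IsEtale (f i)
  surjective : ∀ s : S, ∃ (i : ι) (y : U i), f i y = s

end Mfd

/-! ## Groupoid fibrations -/

namespace CategoryTheory.BasedCategory

variable {𝒮 : Type u₀} [Category.{v₀} 𝒮]

/-- `𝒳` is a category fibered in groupoids over `𝒮`. -/
structure IsGroupoidFibration (𝒳 : BasedCategory.{v₂, u₂} 𝒮) : Prop where
  exists_pullback : ∀ {U V : 𝒮} (f : V ⟶ U) (x : 𝒳.obj), 𝒳.p.obj x = U →
    ∃ (y : 𝒳.obj) (φ : y ⟶ x), 𝒳.p.IsHomLift f φ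
  existsUnique_lift : ∀ {x y z : 𝒳.obj} (φ : y ⟶ x) (ψ : z ⟶ x) (g : 𝒳.p.obj z ⟶ 𝒳.p.obj y),
    g ≫ 𝒳.p.map φ = 𝒳.p.map ψ → ∃! χ : z ⟶ y, 𝒳.p.map χ = g ∧ χ ≫ φ = ψ

/-- A functor over `𝒮` that is an isomorphism of fibrations: it has an inverse up to
2-isomorphisms over `𝒮`. -/
def IsIsomorphism {𝒳 : BasedCategory.{v₂, u₂} 𝒮} {𝒴 : BasedCategory.{v₃, u₃} 𝒮}
    (f : BasedFunctor 𝒳 𝒴) : Prop :=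
  ∃ g : BasedFunctor 𝒴 𝒳,
    Nonempty (g.comp f ≅ BasedFunctor.id 𝒴) ∧ Nonempty (f.comp g ≅ BasedFunctor.id 𝒳)

/-- `𝒳` and `𝒴` are isomorphic as fibrations over `𝒮`. -/
def IsIsomorphic (𝒳 : BasedCategory.{v₂, u₂} 𝒮) (𝒴 : BasedCategory.{v₃, u₃} 𝒮) : Prop :=
  ∃ f : BasedFunctor 𝒳 𝒴, IsIsomorphism f

/-- The fibration over `𝒮` defined by an object `X` of `𝒮`: its objects are the arrows `U ⟶ X`,
its morphisms the commutative triangles. -/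
def ofObj (X : 𝒮) : BasedCategory.{v₀, max u₀ v₀} 𝒮 := ofFunctor (Over.forget X)

/-- The object `a : U ⟶ X` of the fibration defined by `X`. -/
def ofObj.mk {U X : 𝒮} (a : U ⟶ X) : (ofObj X).obj := Over.mk a

/-- The functor over `𝒮` defined by an arrow of `𝒮`. -/
def ofHom {X Y : 𝒮} (f : X ⟶ Y) : BasedFunctor (ofObj X) (ofObj Y) where
  toFunctor := Over.map f
  w := rfl

/-- The arrow of `𝒮` induced by a morphism of the associated fibrations: the image of `𝟙 V`. -/
def inducedHom {V U : 𝒮} (G : BasedFunctor (ofObj V) (ofObj U)) : V ⟶ U :=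
  eqToHom (G.w_obj (ofObj.mk (𝟙 V))).symm ≫
    Comma.hom (show Over U from G.obj (ofObj.mk (𝟙 V)))

variable {𝒳 : BasedCategory.{v₁, u₁} 𝒮} {𝒴 : BasedCategory.{v₂, u₂} 𝒮}
  {𝒵 : BasedCategory.{v₃, u₃} 𝒮}

/-- An object of the (2-categorical) fiber product of `F : 𝒳 ⟶ 𝒴` and `G : 𝒵 ⟶ 𝒴`: objects
`left` of `𝒳` and `right` of `𝒵` over the same object of `𝒮`, and an isomorphism between their
images, lying over the identity. -/
structure FiberProductObj (F : BasedFunctor 𝒳 𝒴) (G : BasedFunctor 𝒵 𝒴) where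
  left : 𝒳.obj
  right : 𝒵.obj
  base_eq : 𝒵.p.obj right = 𝒳.p.obj left
  iso : F.obj left ≅ G.obj right
  isHomLift : 𝒴.p.IsHomLift (𝟙 (𝒳.p.obj left)) iso.hom

/-- A morphism of the fiber product: a pair of morphisms over the same arrow of `𝒮`, compatible
with the isomorphisms. -/
@[ext]
structure FiberProductHom {F : BasedFunctor 𝒳 𝒴} {G : BasedFunctor 𝒵 𝒴}
    (A B : FiberProductObj F G) where
  left : A.left ⟶ B.left
  right : A.right ⟶ B.right
  isHomLift : 𝒵.p.IsHomLift (𝒳.p.map left) right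
  comm : F.map left ≫ B.iso.hom = A.iso.hom ≫ G.map right

instance (F : BasedFunctor 𝒳 𝒴) (G : BasedFunctor 𝒵 𝒴) : Category (FiberProductObj F G) where
  Hom := FiberProductHom
  id A :=
    { left := 𝟙 _
      right := 𝟙 _
      isHomLift := by rw [𝒳.p.map_id]; exact IsHomLift.id A.base_eq
      comm := by simp }
  comp f g :=
    { left := f.left ≫ g.left
      right := f.right ≫ g.right
      isHomLift := by
        have := f.isHomLift
        have := g.isHomLift
        rw [𝒳.p.map_comp]
        infer_instance
      comm := by
        rw [F.map_comp, G.map_comp, Category.assoc, g.comm, ← Category.assoc, f.comm,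
          Category.assoc] }
  id_comp f := FiberProductHom.ext (Category.id_comp _) (Category.id_comp _)
  comp_id f := FiberProductHom.ext (Category.comp_id _) (Category.comp_id _)
  assoc f g h := FiberProductHom.ext (Category.assoc _ _ _) (Category.assoc _ _ _)

/-- The projection of the fiber product to `𝒮`. -/
def fiberProductProj (F : BasedFunctor 𝒳 𝒴) (G : BasedFunctor 𝒵 𝒴) : FiberProductObj F G ⥤ 𝒮 where
  obj A := 𝒳.p.obj A.left
  map {A B} f := 𝒳.p.map (FiberProductHom.left (A := A) (B := B) f)
  map_id A := 𝒳.p.map_id A.left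
  map_comp {A B C} f g := 𝒳.p.map_comp (FiberProductHom.left (A := A) (B := B) f)
    (FiberProductHom.left (A := B) (B := C) g)

/-- The fiber product `𝒳 ×_𝒴 𝒵`, as a category over `𝒮`. -/
def fiberProduct (F : BasedFunctor 𝒳 𝒴) (G : BasedFunctor 𝒵 𝒴) :
    BasedCategory.{max v₁ v₃, max u₁ u₃ v₂} 𝒮 :=
  ofFunctor (fiberProductProj F G)

/-- The first projection `𝒳 ×_𝒴 𝒵 ⟶ 𝒳`. -/
def fiberProduct.fst (F : BasedFunctor 𝒳 𝒴) (G : BasedFunctor 𝒵 𝒴) :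
    BasedFunctor (fiberProduct F G) 𝒳 where
  obj A := FiberProductObj.left A
  map f := FiberProductHom.left f
  map_id _ := rfl
  map_comp _ _ := rfl
  w := rfl

/-- The second projection `𝒳 ×_𝒴 𝒵 ⟶ 𝒵`. -/
def fiberProduct.snd (F : BasedFunctor 𝒳 𝒴) (G : BasedFunctor 𝒵 𝒴) :
    BasedFunctor (fiberProduct F G) 𝒵 where
  obj A := FiberProductObj.right A
  map f := FiberProductHom.right f
  map_id _ := rfl
  map_comp _ _ := rfl
  w := by
    refine Functor.ext (fun A => FiberProductObj.base_eq A) (fun A B f => ?_)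
    have h := FiberProductHom.isHomLift f
    exact IsHomLift.fac' 𝒵.p (𝒳.p.map (FiberProductHom.left f)) (FiberProductHom.right f)

end CategoryTheory.BasedCategory

/-! ## Stacks over the site of manifolds -/

section Stacks

open CategoryTheory.BasedCategory CategoryTheory.Functor

/-- A pullback of the family `x` over `S` along `f : U ⟶ S`: an object over `U` with an arrow to
`x` over `f`. -/
structure FamilyPullback (𝔛 : BasedCategory.{v₁, u₁} Mfd.{u}) {U S : Mfd.{u}} (f : U ⟶ S)
    (x : Fiber 𝔛.p S) where
  obj : Fiber 𝔛.p U
  hom : obj.1 ⟶ x.1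
  isHomLift : 𝔛.p.IsHomLift f hom

/-- `φ'` is the restriction of the arrow `φ : x ⟶ y` of the fiber over `S` to the pullbacks
`x'` and `y'` along `f`. -/
def IsRestriction {𝔛 : BasedCategory.{v₁, u₁} Mfd.{u}} {U S : Mfd.{u}} {f : U ⟶ S}
    {x y : Fiber 𝔛.p S} (x' : FamilyPullback 𝔛 f x) (y' : FamilyPullback 𝔛 f y)
    (φ : x ⟶ y) (φ' : x'.obj ⟶ y'.obj) : Prop :=
  φ'.1 ≫ y'.hom = x'.hom ≫ φ.1

/-- Gluing data for objects along a family `f i : U i ⟶ S`: objects over the `U i` and arrows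
between their pullbacks to the fiber products `U i ×_S U j`, subject to the cocycle condition. -/
structure GluingData (𝔛 : BasedCategory.{v₁, u₁} Mfd.{u}) {S : Mfd.{u}} {ι : Type u}
    {U : ι → Mfd.{u}} (f : ∀ i, U i ⟶ S) where
  obj : ∀ i, Fiber 𝔛.p (U i)
  /-- The fiber product `U i ×_S U j`. -/
  overlap : ι → ι → Mfd.{u}
  fst : ∀ i j, overlap i j ⟶ U i
  snd : ∀ i j, overlap i j ⟶ U j
  isPullback : ∀ i j, IsPullback (fst i j) (snd i j) (f i) (f j)
  /-- The restriction of `obj i` to `U i ×_S U j`. -/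
  left : ∀ i j, FamilyPullback 𝔛 (fst i j) (obj i)
  /-- The restriction of `obj j` to `U i ×_S U j`. -/
  right : ∀ i j, FamilyPullback 𝔛 (snd i j) (obj j)
  /-- The transition morphism `φ i j : obj i | U i j ⟶ obj j | U i j`. -/
  trans : ∀ i j, (left i j).obj ⟶ (right i j).obj
  /-- The cocycle condition `φ j k ∘ φ i j = φ i k` on `U i ×_S U j ×_S U k`, tested on the objects
  `z` over manifolds mapping to the triple fiber product: `z` is a common pullback of `obj i`
  (via `α` and `γ`) and of `obj j` (via `α` followed by `φ i j`, and via `β`), and then the two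
  resulting arrows to `obj k`, which lie over the same map, agree. -/
  cocycle : ∀ (i j k : ι) (z : 𝔛.obj) (α : z ⟶ (left i j).obj.1) (β : z ⟶ (left j k).obj.1)
    (γ : z ⟶ (left i k).obj.1),
    α ≫ (left i j).hom = γ ≫ (left i k).hom →
    α ≫ (trans i j).1 ≫ (right i j).hom = β ≫ (left j k).hom →
    𝔛.p.map (β ≫ (trans j k).1 ≫ (right j k).hom) =
      𝔛.p.map (γ ≫ (trans i k).1 ≫ (right i k).hom) →
    β ≫ (trans j k).1 ≫ (right j k).hom = γ ≫ (trans i k).1 ≫ (right i k).hom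

/-- A stack over the site of manifolds with the étale topology. -/
structure IsStack (𝔛 : BasedCategory.{v₁, u₁} Mfd.{u}) : Prop where
  isGroupoidFibration : IsGroupoidFibration 𝔛
  /-- Two arrows of a fiber whose restrictions to a covering family agree are equal. -/
  hom_ext : ∀ {S : Mfd.{u}} {ι : Type u} {U : ι → Mfd.{u}} (f : ∀ i, U i ⟶ S),
    Mfd.IsCoveringFamily f → ∀ {x y : Fiber 𝔛.p S} (x' : ∀ i, FamilyPullback 𝔛 (f i) x)
      (y' : ∀ i, FamilyPullback 𝔛 (f i) y) (φ ψ : x ⟶ y) (φ' : ∀ i, (x' i).obj ⟶ (y' i).obj),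
      (∀ i, IsRestriction (x' i) (y' i) φ (φ' i)) → (∀ i, IsRestriction (x' i) (y' i) ψ (φ' i)) →
      φ = ψ
  /-- Local arrows `φ' i : x | U i ⟶ y | U i` whose restrictions to the fiber products
  `U i ×_S U j` agree come from an arrow `x ⟶ y`. Here `z` is `x | U i ×_S U j`, and the agreement
  in `y | U i ×_S U j` is tested after the arrow to `y`. -/
  exists_hom : ∀ {S : Mfd.{u}} {ι : Type u} {U : ι → Mfd.{u}} (f : ∀ i, U i ⟶ S),
    Mfd.IsCoveringFamily f → ∀ {x y : Fiber 𝔛.p S} (x' : ∀ i, FamilyPullback 𝔛 (f i) x)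
      (y' : ∀ i, FamilyPullback 𝔛 (f i) y) (φ' : ∀ i, (x' i).obj ⟶ (y' i).obj)
      (overlap : ι → ι → Mfd.{u}) (fst : ∀ i j, overlap i j ⟶ U i)
      (snd : ∀ i j, overlap i j ⟶ U j),
      (∀ i j, IsPullback (fst i j) (snd i j) (f i) (f j)) →
      (∀ (i j : ι) (z : 𝔛.obj) (α : z ⟶ (x' i).obj.1) (β : z ⟶ (x' j).obj.1),
        𝔛.p.IsHomLift (fst i j) α → 𝔛.p.IsHomLift (snd i j) β →
        α ≫ (x' i).hom = β ≫ (x' j).hom →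
        α ≫ (φ' i).1 ≫ (y' i).hom = β ≫ (φ' j).1 ≫ (y' j).hom) →
      ∃ φ : x ⟶ y, ∀ i, IsRestriction (x' i) (y' i) φ (φ' i)
  /-- Gluing data are effective: there is an object `x` over `S` with isomorphisms
  `x | U i ≅ obj i`, given here by arrows `θ i : obj i ⟶ x` over `f i`, compatible with the
  transition morphisms. -/
  exists_obj : ∀ {S : Mfd.{u}} {ι : Type u} {U : ι → Mfd.{u}} (f : ∀ i, U i ⟶ S),
    Mfd.IsCoveringFamily f → ∀ D : GluingData 𝔛 f,
      ∃ (x : Fiber 𝔛.p S) (θ : ∀ i, (D.obj i).1 ⟶ x.1),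
        (∀ i, 𝔛.p.IsHomLift (f i) (θ i)) ∧
        ∀ i j, (D.left i j).hom ≫ θ i = (D.trans i j).1 ≫ (D.right i j).hom ≫ θ j

/-! ## Differentiable stacks and versal families -/

/-- A representable submersion `𝔛 ⟶ 𝔜`: for every manifold `U` and every `y : U ⟶ 𝔜` the fiber
product `𝔛 ×_𝔜 U` is isomorphic to a manifold `V`, and the induced map `V ⟶ U` is a submersion. -/
def IsRepresentableSubmersion {𝔛 : BasedCategory.{v₁, u₁} Mfd.{u}}
    {𝔜 : BasedCategory.{v₂, u₂} Mfd.{u}} (F : BasedFunctor 𝔛 𝔜) : Prop :=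
  ∀ (U : Mfd.{u}) (y : BasedFunctor (ofObj U) 𝔜),
    ∃ (V : Mfd.{u}) (e : BasedFunctor (ofObj V) (fiberProduct F y)), IsIsomorphism e ∧
      Mfd.IsSubmersion (inducedHom (e.comp (fiberProduct.snd F y)))

/-- An epimorphism `𝔛 ⟶ 𝔜`: every `y : U ⟶ 𝔜` lifts to `𝔛`, up to 2-isomorphism, after pulling
back along a surjective submersion `V ⟶ U`. -/
def IsEpimorphism {𝔛 : BasedCategory.{v₁, u₁} Mfd.{u}}
    {𝔜 : BasedCategory.{v₂, u₂} Mfd.{u}} (F : BasedFunctor 𝔛 𝔜) : Prop :=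
  ∀ (U : Mfd.{u}) (y : BasedFunctor (ofObj U) 𝔜),
    ∃ (V : Mfd.{u}) (q : V ⟶ U) (z : BasedFunctor (ofObj V) 𝔛),
      Mfd.IsSubmersion q ∧ Function.Surjective q ∧ Nonempty (z.comp F ≅ (ofHom q).comp y)

/-- A versal family (a presentation, an atlas): a surjective representable submersion from a
manifold `X` to `𝔛`. -/
structure IsVersalFamily {𝔛 : BasedCategory.{v₁, u₁} Mfd.{u}} {X : Mfd.{u}}
    (x : BasedFunctor (ofObj X) 𝔛) : Prop where
  isRepresentableSubmersion : IsRepresentableSubmersion x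
  isEpimorphism : IsEpimorphism x

/-- A differentiable stack: a stack that admits a versal family. -/
structure IsDifferentiableStack (𝔛 : BasedCategory.{v₁, u₁} Mfd.{u}) : Prop where
  isStack : IsStack 𝔛
  exists_versalFamily : ∃ (X : Mfd.{u}) (x : BasedFunctor (ofObj X) 𝔛), IsVersalFamily x

end Stacks

/-! ## Lie groupoids and torsors -/

/-- A Lie groupoid over the manifold `M`. The product `γ · δ` is defined when the target of `γ` is
the source of `δ`. Its smoothness on the manifold of composable pairs is tested on all pairs of
smooth maps from a manifold to `arr` that are composable at every point, i.e. on all smooth maps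
to the fiber product of `tgt` and `src`. -/
structure LieGroupoid (M : Mfd.{u}) where
  arr : Mfd.{u}
  src : arr ⟶ M
  tgt : arr ⟶ M
  src_submersion : Mfd.IsSubmersion src
  tgt_submersion : Mfd.IsSubmersion tgt
  mul : ∀ γ δ : arr, tgt γ = src δ → arr
  src_mul : ∀ (γ δ : arr) (h : tgt γ = src δ), src (mul γ δ h) = src γ
  tgt_mul : ∀ (γ δ : arr) (h : tgt γ = src δ), tgt (mul γ δ h) = tgt δ
  mul_assoc : ∀ (γ δ ε : arr) (h₁ : tgt γ = src δ) (h₂ : tgt δ = src ε),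
    mul (mul γ δ h₁) ε ((tgt_mul γ δ h₁).trans h₂) =
      mul γ (mul δ ε h₂) (h₁.trans (src_mul δ ε h₂).symm)
  smooth_mul : ∀ (W : Mfd.{u}) (a b : W ⟶ arr) (h : ∀ w : W, tgt (a w) = src (b w)),
    Mfd.IsSmooth (fun w : W => mul (a w) (b w) (h w))
  one : M ⟶ arr
  src_one : ∀ m : M, src (one m) = m
  tgt_one : ∀ m : M, tgt (one m) = m
  one_mul : ∀ γ : arr, mul (one (src γ)) γ (tgt_one (src γ)) = γ
  mul_one : ∀ γ : arr, mul γ (one (tgt γ)) (src_one (tgt γ)).symm = γ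
  inv : arr ⟶ arr
  src_inv : ∀ γ : arr, src (inv γ) = tgt γ
  tgt_inv : ∀ γ : arr, tgt (inv γ) = src γ
  mul_inv : ∀ γ : arr, mul γ (inv γ) (src_inv γ).symm = one (src γ)
  inv_mul : ∀ γ : arr, mul (inv γ) γ (tgt_inv γ) = one (tgt γ)

namespace LieGroupoid

variable {M : Mfd.{u}}

/-- The product of two composable `W`-valued points. -/
def mulHom (Γ : LieGroupoid M) {W : Mfd.{u}} (a b : W ⟶ Γ.arr)
    (h : ∀ w : W, Γ.tgt (a w) = Γ.src (b w)) : W ⟶ Γ.arr :=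
  Mfd.SmoothMap.mk (fun w : W => Γ.mul (a w) (b w) (h w)) (Γ.smooth_mul W a b h)

/-- A `Γ`-torsor `total` over `base`, with anchor map `anchor` and right action `act`, where
`p · γ` is defined when the anchor of `p` is the source of `γ`. Smoothness of the action is tested
on all smooth maps to the fiber product of `anchor` and `Γ.src`. -/
structure Torsor (Γ : LieGroupoid M) where
  base : Mfd.{u}
  total : Mfd.{u}
  proj : total ⟶ base
  proj_submersion : Mfd.IsSubmersion proj
  proj_surjective : Function.Surjective proj
  anchor : total ⟶ M
  act : ∀ (p : total) (γ : Γ.arr), anchor p = Γ.src γ → total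
  anchor_act : ∀ (p : total) (γ : Γ.arr) (h : anchor p = Γ.src γ), anchor (act p γ h) = Γ.tgt γ
  act_one : ∀ p : total, act p (Γ.one (anchor p)) (Γ.src_one (anchor p)).symm = p
  act_mul : ∀ (p : total) (γ δ : Γ.arr) (h₁ : anchor p = Γ.src γ) (h₂ : Γ.tgt γ = Γ.src δ),
    act p (Γ.mul γ δ h₂) (h₁.trans (Γ.src_mul γ δ h₂).symm) =
      act (act p γ h₁) δ ((anchor_act p γ h₁).trans h₂)
  smooth_act : ∀ (W : Mfd.{u}) (a : W ⟶ total) (b : W ⟶ Γ.arr)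
    (h : ∀ w : W, anchor (a w) = Γ.src (b w)), Mfd.IsSmooth (fun w : W => act (a w) (b w) (h w))
  proj_act : ∀ (p : total) (γ : Γ.arr) (h : anchor p = Γ.src γ), proj (act p γ h) = proj p
  existsUnique_act : ∀ p p' : total, proj p = proj p' →
    ∃! γ : Γ.arr, ∃ h : anchor p = Γ.src γ, act p γ h = p'

variable {Γ : LieGroupoid M}

/-- A morphism of `Γ`-torsors: a commutative square of smooth maps whose upper map is
`Γ`-equivariant. -/
@[ext]
structure Torsor.Hom (Q P : Torsor Γ) where
  base : Q.base ⟶ P.base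
  total : Q.total ⟶ P.total
  proj_total : ∀ q : Q.total, P.proj (total q) = base (Q.proj q)
  anchor_total : ∀ q : Q.total, P.anchor (total q) = Q.anchor q
  total_act : ∀ (q : Q.total) (γ : Γ.arr) (h : Q.anchor q = Γ.src γ),
    total (Q.act q γ h) = P.act (total q) γ ((anchor_total q).trans h)

instance : Category (Torsor Γ) where
  Hom := Torsor.Hom
  id P :=
    { base := 𝟙 _
      total := 𝟙 _
      proj_total := fun _ => rfl
      anchor_total := fun _ => rfl
      total_act := fun _ _ _ => rfl }
  comp {R Q P} f g :=
    { base := f.base ≫ g.base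
      total := f.total ≫ g.total
      proj_total := fun r => (g.proj_total (f.total r)).trans (congrArg g.base (f.proj_total r))
      anchor_total := fun r => (g.anchor_total (f.total r)).trans (f.anchor_total r)
      total_act := fun r γ h =>
        (congrArg g.total (f.total_act r γ h)).trans
          (g.total_act (f.total r) γ ((f.anchor_total r).trans h)) }

/-- The stack `BΓ` of `Γ`-torsors, as a category over manifolds: a torsor is sent to its base. -/
def classifyingStack (Γ : LieGroupoid M) : BasedCategory.{u, u + 1} Mfd.{u} where
  obj := Torsor Γ
  p :=
    { obj := fun P => P.base
      map := fun {Q P} f => Torsor.Hom.base (Q := Q) (P := P) f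
      map_id := fun _ => rfl
      map_comp := fun _ _ => rfl }

end LieGroupoid

/-! ## The symmetry groupoid of a family -/

open CategoryTheory.BasedCategory in
/-- `IsSymmetryGroupoid x Γ`: the Lie groupoid `Γ` over `X` is the symmetry groupoid
`Isom(x, x) ⇉ X` of the family `x`. That is, there is an isomorphism `e` from the manifold of
arrows of `Γ` to the fibration `Isom(x, x) = X ×_𝔛 X`, under which source and target are the two
projections, and under which the product of `W`-valued points `g = (y, φ, y')` and
`h = (y', ψ, y'')` is `(y, ψ ∘ φ, y'')`. In the last condition `r₁`, `r₂`, `r₃` are the canonical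
arrows over `𝟙 W` (unique, and present since both sides are the same `W`-valued point of `X`). -/
def IsSymmetryGroupoid {𝔛 : BasedCategory.{v₁, u₁} Mfd.{u}} {X : Mfd.{u}}
    (x : BasedFunctor (ofObj X) 𝔛) (Γ : LieGroupoid X) : Prop :=
  ∃ e : BasedFunctor (ofObj Γ.arr) (fiberProduct x x),
    IsIsomorphism e ∧
    inducedHom (e.comp (fiberProduct.fst x x)) = Γ.src ∧
    inducedHom (e.comp (fiberProduct.snd x x)) = Γ.tgt ∧
    ∀ (W : Mfd.{u}) (g h : W ⟶ Γ.arr) (hgh : ∀ w : W, Γ.tgt (g w) = Γ.src (h w))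
      (A B C : FiberProductObj x x), A = e.obj (ofObj.mk g) → B = e.obj (ofObj.mk h) →
      C = e.obj (ofObj.mk (Γ.mulHom g h hgh)) →
      ∀ (r₁ : C.left ⟶ A.left) (r₂ : A.right ⟶ B.left) (r₃ : B.right ⟶ C.right),
        (ofObj X).p.IsHomLift (𝟙 W) r₁ → (ofObj X).p.IsHomLift (𝟙 W) r₂ →
        (ofObj X).p.IsHomLift (𝟙 W) r₃ →
        C.iso.hom = x.map r₁ ≫ A.iso.hom ≫ x.map r₂ ≫ B.iso.hom ≫ x.map r₃

/-! Let ξ be an object of 𝔛 over S. Versality of x makes the fiber product of X and S over 𝔛 a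
manifold Isom(x, ξ), whose W-valued points are the arrows to ξ from pullbacks of x along maps W → X.
Representability makes its projection to S a submersion and the epimorphism property makes it
surjective. Γ = Isom(x, x) acts by precomposition with inverses, and two points over the same point
of S differ by a unique element of Γ because every arrow of a groupoid fibration is cartesian. So
Isom(x, ξ) is a Γ-torsor, and postcomposition makes ξ ↦ Isom(x, ξ) a functor 𝔛 → BΓ over the base
(`IsomSpace.torsorFunctor`). Smoothness costs nothing here: a construction on isomorphisms that is
made for all W at once becomes a smooth map through the representing manifold.

That the functor is an isomorphism is a matter of descent. Submersions have local sections, so the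
étale topology already sees them: arrows and objects of a stack descend along surjective submersions
(`IsStack.exists_arrow_of_submersion`, `IsStack.exists_descent`). The universal arrow from a
pullback of x to ξ lies over the projection of Isom(x, ξ). Hence an arrow ξ → η amounts to an arrow
from that pullback to η satisfying a descent condition, and for the arrow coming from a map of
torsors this condition is equivariance; the functor is fully faithful. Conversely, a torsor Q pulls
x back along its anchor. The quotient of two points of a fiber of Q is an arrow of Γ, that is, an
isomorphism between pullbacks of x, and these isomorphisms are descent data. The descended object ξ
comes with a map of torsors Q → Isom(x, ξ) over an isomorphism of the bases, and such maps are
invertible (`LieGroupoid.Torsor.isIso_of_base`).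

The analytic point is that a torsor is only required to have a unique γ with p · γ = p'; that γ
depends smoothly on (p, p') has to be proved (`LieGroupoid.Torsor.smoothNear_divT`). The orbit map
of p, from a source fiber of Γ onto a fiber of Q, is a smooth bijection. If its derivative were
nowhere bijective, the fiber of Q would be a countable union of images of too small Hausdorff
dimension (`exists_bijective_fderiv_of_cover`). Where the derivative is bijective the inverse
function theorem gives smooth division, and translation by local sections spreads this to all pairs.
-/

namespace Mfd

/-! ### Pointwise smoothness and its independence of charts -/

open Topology Filter

variable {M N P : Mfd.{u}}

/-- Smoothness at a point: continuity, and infinite differentiability in all charts. -/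
structure SmoothAt (f : M → N) (x : M) : Prop where
  continuousAt : ContinuousAt f x
  contDiffAt : ∀ ⦃m n : ℕ⦄ ⦃c : OpenPartialHomeomorph M (EuclideanSpace ℝ (Fin m))⦄
    ⦃d : OpenPartialHomeomorph N (EuclideanSpace ℝ (Fin n))⦄, c ∈ M.atlas m → d ∈ N.atlas n →
      x ∈ c.source → f x ∈ d.source → ContDiffAt ℝ ∞ (d ∘ f ∘ c.symm) (c x)

theorem contDiffAt_transition {m n : ℕ}
    {c : OpenPartialHomeomorph M (EuclideanSpace ℝ (Fin m))}
    {d : OpenPartialHomeomorph M (EuclideanSpace ℝ (Fin n))} (hc : c ∈ M.atlas m)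
    (hd : d ∈ M.atlas n) {x : M} (hxc : x ∈ c.source) (hxd : x ∈ d.source) :
    ContDiffAt ℝ ∞ (d ∘ c.symm) (c x) := by
  refine (M.compatible hc hd).contDiffAt ?_
  refine (c.isOpen_inter_preimage_symm d.open_source).mem_nhds ⟨c.map_source hxc, ?_⟩
  simpa [c.left_inv hxc] using hxd

theorem IsSmooth.smoothAt {f : M → N} (hf : IsSmooth f) (x : M) : SmoothAt f x := by
  refine ⟨hf.continuous.continuousAt, fun m n c d hc hd hxc hxd => ?_⟩
  refine (hf.contDiffOn hc hd).contDiffAt ?_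
  refine (c.isOpen_inter_preimage_symm
    (d.open_source.preimage hf.continuous)).mem_nhds ⟨c.map_source hxc, ?_⟩
  simpa [c.left_inv hxc] using hxd

theorem isSmooth_iff {f : M → N} : IsSmooth f ↔ ∀ x, SmoothAt f x := by
  refine ⟨IsSmooth.smoothAt, fun h => ⟨continuous_iff_continuousAt.2 fun x => (h x).1, ?_⟩⟩
  rintro m n c d hc hd y ⟨hy1, hy2⟩
  have := (h (c.symm y)).contDiffAt hc hd (c.map_target hy1) hy2
  rw [c.right_inv hy1] at this
  exact this.contDiffWithinAt

theorem smoothAt_hom (f : M ⟶ N) (x : M) : SmoothAt f x := f.smooth.smoothAt x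

/-- Smoothness at a point can be checked in one pair of charts. -/
theorem SmoothAt.of_charts {f : M → N} {x : M} {m n : ℕ}
    {c : OpenPartialHomeomorph M (EuclideanSpace ℝ (Fin m))}
    {d : OpenPartialHomeomorph N (EuclideanSpace ℝ (Fin n))} (hc : c ∈ M.atlas m)
    (hd : d ∈ N.atlas n) (hxc : x ∈ c.source) (hxd : f x ∈ d.source) (hf : ContinuousAt f x)
    (h : ContDiffAt ℝ ∞ (d ∘ f ∘ c.symm) (c x)) : SmoothAt f x := by
  refine ⟨hf, fun m' n' c' d' hc' hd' hxc' hxd' => ?_⟩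
  have h1 := contDiffAt_transition hc' hc hxc' hxc
  have h2 := contDiffAt_transition hd hd' hxd hxd'
  have e1 : (c ∘ c'.symm) (c' x) = c x := by simp [c'.left_inv hxc']
  have e2 : (d ∘ f ∘ c.symm) (c x) = d (f x) := by simp [c.left_inv hxc]
  rw [← e1] at h
  have h3 := h.comp _ h1
  have e3 : ((d ∘ f ∘ c.symm) ∘ (c ∘ c'.symm)) (c' x) = d (f x) := by
    rw [Function.comp_apply, e1, e2]
  rw [← e3] at h2
  refine (h2.comp _ h3).congr_of_eventuallyEq ?_
  have hcont : ContinuousAt c'.symm (c' x) := c'.continuousAt_symm (c'.map_source hxc')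
  have ev1 : ∀ᶠ y in 𝓝 (c' x), c'.symm y ∈ c.source :=
    hcont.eventually (by rw [c'.left_inv hxc']; exact c.open_source.mem_nhds hxc)
  have ev2 : ∀ᶠ y in 𝓝 (c' x), f (c'.symm y) ∈ d.source := by
    have : ContinuousAt (f ∘ c'.symm) (c' x) :=
      ContinuousAt.comp (by rw [c'.left_inv hxc']; exact hf) hcont
    exact this.eventually (by
      rw [Function.comp_apply, c'.left_inv hxc']; exact d.open_source.mem_nhds hxd)
  filter_upwards [ev1, ev2] with y hy1 hy2
  simp [c.left_inv hy1, d.left_inv hy2]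

theorem smoothAt_id (x : M) : SmoothAt (id : M → M) x := (isSmooth_id M).smoothAt x

theorem SmoothAt.comp {g : N → P} {f : M → N} {x : M} (hg : SmoothAt g (f x))
    (hf : SmoothAt f x) : SmoothAt (g ∘ f) x := by
  obtain ⟨m, c, hc, hxc⟩ := M.exists_chart x
  obtain ⟨n, d, hd, hxd⟩ := N.exists_chart (f x)
  obtain ⟨k, e, he, hxe⟩ := P.exists_chart (g (f x))
  refine SmoothAt.of_charts hc he hxc hxe (hg.1.comp hf.1) ?_
  have h1 := hf.contDiffAt hc hd hxc hxd
  have h2 := hg.contDiffAt hd he hxd hxe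
  have e2 : (d ∘ f ∘ c.symm) (c x) = d (f x) := by simp [c.left_inv hxc]
  rw [← e2] at h2
  refine (h2.comp _ h1).congr_of_eventuallyEq ?_
  have hcont : ContinuousAt (f ∘ c.symm) (c x) :=
    ContinuousAt.comp (by rw [c.left_inv hxc]; exact hf.1)
      (c.continuousAt_symm (c.map_source hxc))
  have ev2 : ∀ᶠ y in 𝓝 (c x), f (c.symm y) ∈ d.source :=
    hcont.eventually (by
      rw [Function.comp_apply, c.left_inv hxc]; exact d.open_source.mem_nhds hxd)
  filter_upwards [ev2] with y hy2
  simp [d.left_inv hy2]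

theorem SmoothAt.congr {f g : M → N} {x : M} (hf : SmoothAt f x) (h : g =ᶠ[𝓝 x] f) :
    SmoothAt g x := by
  refine ⟨hf.1.congr h.symm, fun m n c d hc hd hxc hxd => ?_⟩
  refine (hf.contDiffAt hc hd hxc (h.eq_of_nhds ▸ hxd)).congr_of_eventuallyEq ?_
  have hcont : ContinuousAt c.symm (c x) := c.continuousAt_symm (c.map_source hxc)
  have ev : ∀ᶠ y in 𝓝 (c x), g (c.symm y) = f (c.symm y) :=
    hcont.eventually (by rw [c.left_inv hxc]; exact h)
  filter_upwards [ev] with y hy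
  simp [hy]

theorem smoothAt_const (y : N) (x : M) : SmoothAt (fun _ : M => y) x := by
  refine ⟨continuousAt_const, fun m n c d hc hd hxc hxd => ?_⟩
  exact contDiffAt_const (c := d y)

/-! ### Open submanifolds -/

/-- The open submanifold defined by an open subset. -/
def restrict (M : Mfd.{u}) (U : TopologicalSpace.Opens M) : Mfd.{u} where
  carrier := U
  atlas n := {c' | ∃ (h : Nonempty U) (c : _) (_ : c ∈ M.atlas n), c' = c.subtypeRestr h}
  exists_chart x := by
    obtain ⟨n, c, hc, hx⟩ := M.exists_chart x.1
    refine ⟨n, _, ⟨⟨x⟩, c, hc, rfl⟩, ?_⟩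
    rw [c.subtypeRestr_source]
    exact hx
  compatible := by
    rintro m n _ _ ⟨h, c, hc, rfl⟩ ⟨_, d, hd, rfl⟩
    refine ((M.compatible hc hd).mono ?_).congr ?_
    · rintro y ⟨hy1, hy2⟩
      refine ⟨c.subtypeRestr_target_subset h hy1, ?_⟩
      rw [Set.mem_preimage, d.subtypeRestr_source] at hy2
      have := c.subtypeRestr_symm_apply h hy1
      simp only [Function.comp_apply] at this
      rw [Set.mem_preimage, ← this]
      exact hy2
    · rintro y ⟨hy1, hy2⟩
      have := c.subtypeRestr_symm_apply h hy1
      simp only [Function.comp_apply] at this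
      simp only [Function.comp_apply, ← this, d.subtypeRestr_coe]
      rfl

-- Reduces smoothness near a point to smoothness of maps from an open submanifold, on which axioms
-- quantified over test manifolds can be evaluated.
variable (M) in
theorem smoothAt_restrict_iff {U : TopologicalSpace.Opens M} {f : M → N} (x : M.restrict U) :
    SmoothAt (fun y : M.restrict U => f y.1) x ↔ SmoothAt f x.1 := by
  obtain ⟨m, c, hc, hxc⟩ := M.exists_chart x.1
  obtain ⟨n, d, hd, hxd⟩ := N.exists_chart (f x.1)
  have hU : Nonempty U := ⟨x⟩
  have hc' : (c.subtypeRestr hU : OpenPartialHomeomorph (M.restrict U) _) ∈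
      (M.restrict U).atlas m := ⟨hU, c, hc, rfl⟩
  have hxc' : x ∈ (c.subtypeRestr hU).source := by rw [c.subtypeRestr_source]; exact hxc
  have hcx : c.subtypeRestr hU x = c x.1 := rfl
  have key : (d ∘ (fun y : M.restrict U => f y.1) ∘ (c.subtypeRestr hU).symm) =ᶠ[𝓝 (c x.1)]
      (d ∘ f ∘ c.symm) := by
    have : (c.subtypeRestr hU).target ∈ 𝓝 (c x.1) :=
      (c.subtypeRestr hU).open_target.mem_nhds ((c.subtypeRestr hU).map_source hxc')
    filter_upwards [this] with y hy
    have := c.subtypeRestr_symm_apply hU hy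
    simp only [Function.comp_apply] at this ⊢
    rw [← this]
    rfl
  have hcont : ContinuousAt (fun y : M.restrict U => f y.1) x ↔ ContinuousAt f x.1 :=
    U.isOpen.isOpenEmbedding_subtypeVal.continuousAt_iff (f := Subtype.val) (x := x) (g := f)
  constructor
  · intro h
    have h2 := h.contDiffAt hc' hd hxc' hxd
    exact SmoothAt.of_charts hc hd hxc hxd (hcont.1 h.1) (h2.congr_of_eventuallyEq key.symm)
  · intro h
    have h2 := h.contDiffAt hc hd hxc hxd
    exact SmoothAt.of_charts hc' hd hxc' hxd (hcont.2 h.1) (h2.congr_of_eventuallyEq key)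

/-- The inclusion of an open submanifold. -/
def incl (M : Mfd.{u}) (U : TopologicalSpace.Opens M) : M.restrict U ⟶ M :=
  SmoothMap.mk (fun y => y.1) (isSmooth_iff.2 fun x =>
    (smoothAt_restrict_iff M (f := id) x).2 (smoothAt_id _))

theorem smoothAt_restrict_codomain {U : TopologicalSpace.Opens N} {f : M → N.restrict U} {x : M}
    (h : SmoothAt (fun y => (f y).1) x) : SmoothAt f x := by
  obtain ⟨m, c, hc, hxc⟩ := M.exists_chart x
  obtain ⟨n, d, hd, hxd⟩ := N.exists_chart (f x).1
  have hU : Nonempty U := ⟨f x⟩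
  have hd' : (d.subtypeRestr hU : OpenPartialHomeomorph (N.restrict U) _) ∈
      (N.restrict U).atlas n := ⟨hU, d, hd, rfl⟩
  have hxd' : f x ∈ (d.subtypeRestr hU).source := by rw [d.subtypeRestr_source]; exact hxd
  refine SmoothAt.of_charts hc hd' hxc hxd' ?_ (h.contDiffAt hc hd hxc hxd)
  exact (Topology.IsInducing.subtypeVal (t := (U : Set N))).continuousAt_iff.2 h.1

/-- The corestriction of a smooth map to an open submanifold containing its image. -/
def liftOpen {U : TopologicalSpace.Opens N} (f : M ⟶ N) (h : ∀ x, f x ∈ U) : M ⟶ N.restrict U :=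
  SmoothMap.mk (fun x => ⟨f x, h x⟩) (isSmooth_iff.2 fun x =>
    smoothAt_restrict_codomain (f.smooth.smoothAt x))

@[simp]
theorem incl_apply {U : TopologicalSpace.Opens M} (x : M.restrict U) : M.incl U x = x.1 := rfl

theorem hom_ext {f g : M ⟶ N} (h : ∀ x, f x = g x) : f = g := SmoothMap.ext (funext h)

@[simp]
theorem comp_app (f : M ⟶ N) (g : N ⟶ P) (x : M) : (f ≫ g) x = g (f x) := rfl

@[simp]
theorem liftOpen_incl {U : TopologicalSpace.Opens N} (f : M ⟶ N) (h : ∀ x, f x ∈ U) :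
    liftOpen f h ≫ N.incl U = f := hom_ext fun _ => rfl

theorem incl_cancel {U : TopologicalSpace.Opens N} {f g : M ⟶ N.restrict U}
    (h : f ≫ N.incl U = g ≫ N.incl U) : f = g :=
  hom_ext fun x => Subtype.ext (congrArg (fun k : M ⟶ N => k x) h)

/-- The map defined by a function that is smooth at every point of an open subset. -/
def homOfSmoothOn (U : TopologicalSpace.Opens M) (f : M → N) (h : ∀ x ∈ U, SmoothAt f x) :
    M.restrict U ⟶ N :=
  SmoothMap.mk (fun y => f y.1) (isSmooth_iff.2 fun x =>
    (smoothAt_restrict_iff M x).2 (h x.1 x.2))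

/-- The intersection of two open submanifolds is their fiber product. -/
theorem isPullback_restrict_inf (U V : TopologicalSpace.Opens M) :
    IsPullback (liftOpen (U := U) (M.incl (U ⊓ V)) fun x => x.2.1)
      (liftOpen (U := V) (M.incl (U ⊓ V)) fun x => x.2.2) (M.incl U) (M.incl V) := by
  refine ⟨⟨hom_ext fun x => rfl⟩, ⟨Limits.PullbackCone.IsLimit.mk _
    (fun s => liftOpen (s.fst ≫ M.incl U) fun x => ⟨(s.fst x).2, ?_⟩) ?_ ?_ ?_⟩⟩
  · have := congrArg (fun k : s.pt ⟶ M => k x) s.condition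
    simp only [comp_app, incl_apply] at this ⊢
    rw [this]
    exact (s.snd x).2
  · exact fun s => incl_cancel (hom_ext fun x => rfl)
  · exact fun s => incl_cancel (hom_ext fun x =>
      congrArg (fun k : s.pt ⟶ M => k x) s.condition)
  · intro s m h1 h2
    exact incl_cancel (hom_ext fun x =>
      congrArg (fun k : s.pt ⟶ M.restrict U => (k x).1) h1)

/-! ### Derivatives in charts -/

theorem fderiv_comp_charts {f : M ⟶ N} {g : N ⟶ P} {m n k : ℕ}
    {c : OpenPartialHomeomorph M (EuclideanSpace ℝ (Fin m))}
    {d : OpenPartialHomeomorph N (EuclideanSpace ℝ (Fin n))}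
    {e : OpenPartialHomeomorph P (EuclideanSpace ℝ (Fin k))} (hc : c ∈ M.atlas m)
    (hd : d ∈ N.atlas n) (he : e ∈ P.atlas k) {x : M} (hxc : x ∈ c.source) (hxd : f x ∈ d.source)
    (hxe : g (f x) ∈ e.source) :
    fderiv ℝ (e ∘ (f ≫ g) ∘ c.symm) (c x) =
      (fderiv ℝ (e ∘ g ∘ d.symm) (d (f x))).comp (fderiv ℝ (d ∘ f ∘ c.symm) (c x)) := by
  have h1 := ((smoothAt_hom f x).contDiffAt hc hd hxc hxd).differentiableAt (by simp)
  have h2 := ((smoothAt_hom g (f x)).contDiffAt hd he hxd hxe).differentiableAt (by simp)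
  have e2 : (d ∘ f ∘ c.symm) (c x) = d (f x) := by simp [c.left_inv hxc]
  rw [← e2] at h2 ⊢
  rw [← fderiv_comp _ h2 h1]
  refine Filter.EventuallyEq.fderiv_eq ?_
  have hcont : ContinuousAt (f ∘ c.symm) (c x) :=
    ContinuousAt.comp (by rw [c.left_inv hxc]; exact (smoothAt_hom f x).1)
      (c.continuousAt_symm (c.map_source hxc))
  have ev2 : ∀ᶠ y in 𝓝 (c x), f (c.symm y) ∈ d.source :=
    hcont.eventually (by
      rw [Function.comp_apply, c.left_inv hxc]; exact d.open_source.mem_nhds hxd)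
  filter_upwards [ev2] with y hy2
  simp [d.left_inv hy2]

theorem IsSubmersion.comp {f : M ⟶ N} {g : N ⟶ P} (hf : IsSubmersion f) (hg : IsSubmersion g) :
    IsSubmersion (f ≫ g) := by
  intro m k c e hc he x hxc hxe
  obtain ⟨n, d, hd, hxd⟩ := N.exists_chart (f x)
  rw [fderiv_comp_charts hc hd he hxc hxd hxe]
  exact (hg hd he _ hxd hxe).comp (hf hc hd _ hxc hxd)

theorem fderiv_id_charts {m : ℕ} {c : OpenPartialHomeomorph M (EuclideanSpace ℝ (Fin m))} {x : M}
    (hxc : x ∈ c.source) :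
    fderiv ℝ (c ∘ (𝟙 M : M ⟶ M) ∘ c.symm) (c x) = ContinuousLinearMap.id ℝ _ := by
  rw [← fderiv_id (𝕜 := ℝ) (x := c x)]
  refine Filter.EventuallyEq.fderiv_eq ?_
  filter_upwards [c.open_target.mem_nhds (c.map_source hxc)] with y hy
  simp [c.right_inv hy]

/-- The chain rule for f followed by its inverse, in both orders, makes the two derivatives inverse
to each other. -/
theorem isEtale_of_isIso (f : M ⟶ N) [IsIso f] : IsEtale f := by
  intro m n c d hc hd x hxc hxd
  have hx : (inv f) (f x) = x := by rw [← comp_app, IsIso.hom_inv_id]; rfl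
  have h1 := fderiv_comp_charts (f := f) (g := inv f) hc hd hc hxc hxd (by rwa [hx])
  rw [IsIso.hom_inv_id, fderiv_id_charts hxc] at h1
  have h2 := fderiv_comp_charts (f := inv f) (g := f) (x := f x) hd hc hd hxd (by rwa [hx])
    (by rwa [hx])
  rw [IsIso.inv_hom_id, fderiv_id_charts hxd, hx] at h2
  refine ⟨Function.LeftInverse.injective (g := fderiv ℝ (c ∘ (inv f) ∘ d.symm) (d (f x)))
    fun v => ?_, Function.RightInverse.surjective
      (g := fderiv ℝ (c ∘ (inv f) ∘ d.symm) (d (f x))) fun v => ?_⟩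
  · exact (congrArg (fun L : _ →L[ℝ] _ => L v) h1).symm
  · exact (congrArg (fun L : _ →L[ℝ] _ => L v) h2).symm

theorem IsEtale.isSubmersion {f : M ⟶ N} (hf : IsEtale f) : IsSubmersion f :=
  fun _ _ _ _ hc hd x hxc hxd => (hf hc hd x hxc hxd).2

/-- In restricted charts the inclusion has the same expression as `𝟙 M`. Through this, open
coverings are covering families of the étale site. -/
theorem isEtale_incl (U : TopologicalSpace.Opens M) : IsEtale (M.incl U) := by
  rintro m n _ d ⟨hU, c, hc, rfl⟩ hd x hxc hxd
  have hxc' : x.1 ∈ c.source := by rw [c.subtypeRestr_source] at hxc; exact hxc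
  have key : (d ∘ (M.incl U) ∘ (c.subtypeRestr hU).symm) =ᶠ[𝓝 (c x.1)]
      (d ∘ (𝟙 M : M ⟶ M) ∘ c.symm) := by
    have : (c.subtypeRestr hU).target ∈ 𝓝 (c x.1) :=
      (c.subtypeRestr hU).open_target.mem_nhds ((c.subtypeRestr hU).map_source hxc)
    filter_upwards [this] with y hy
    have := c.subtypeRestr_symm_apply hU hy
    simp only [Function.comp_apply] at this ⊢
    rw [← this]
    rfl
  have h := isEtale_of_isIso (𝟙 M) hc hd x.1 hxc' hxd
  rw [← key.fderiv_eq] at h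
  exact h

end Mfd

/-! ### Inverse function theorem and a dimension argument -/

section Calculus

open Topology Module

variable {E F : Type*} [NormedAddCommGroup E] [NormedSpace ℝ E] [FiniteDimensional ℝ E]
  [NormedAddCommGroup F] [NormedSpace ℝ F] [FiniteDimensional ℝ F]

/-- The inverse function theorem: a smooth map with bijective derivative at `x` is a local
diffeomorphism at `x`. -/
theorem exists_openPartialHomeomorph_of_bijective_fderiv {G : E → F} {O : Set E} (hO : IsOpen O)
    (hG : ∀ y ∈ O, ContDiffAt ℝ ∞ G y) {x : E} (hx : x ∈ O)
    (h : Function.Bijective (fderiv ℝ G x)) :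
    ∃ Ψ : OpenPartialHomeomorph E F, x ∈ Ψ.source ∧ Ψ.source ⊆ O ∧ ⇑Ψ = G ∧
      (∀ y ∈ Ψ.source, Function.Bijective (fderiv ℝ G y)) ∧
      ∀ z ∈ Ψ.target, ContDiffAt ℝ ∞ Ψ.symm z := by
  have : CompleteSpace E := FiniteDimensional.complete ℝ E
  have : CompleteSpace F := FiniteDimensional.complete ℝ F
  let L : E ≃L[ℝ] F :=
    (LinearEquiv.ofBijective (fderiv ℝ G x).toLinearMap h).toContinuousLinearEquiv
  have hL : (L : E →L[ℝ] F) = fderiv ℝ G x := by ext; rfl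
  have hd : HasFDerivAt G (L : E →L[ℝ] F) x := by
    rw [hL]; exact ((hG x hx).differentiableAt (by simp)).hasFDerivAt
  let Ψ₀ := (hG x hx).toOpenPartialHomeomorph G hd (by simp)
  -- Invertibility of the derivative is an open condition. Shrinking to the points where it holds
  -- makes the local inverse smooth at every point of its domain, not only at the image of x.
  let O' : Set E := O ∩ (fderiv ℝ G) ⁻¹' Set.range ((↑) : (E ≃L[ℝ] F) → E →L[ℝ] F)
  have hO' : IsOpen O' := by
    refine ContinuousOn.isOpen_inter_preimage ?_ hO (ContinuousLinearEquiv.isOpen)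
    intro y hy
    exact ((hG y hy).fderiv_right (m := 0) (by simp)).continuousAt.continuousWithinAt
  have hbij : ∀ y ∈ O', Function.Bijective (fderiv ℝ G y) := by
    rintro y ⟨_, e, he⟩
    rw [← he]
    exact e.bijective
  refine ⟨Ψ₀.restrOpen O' hO', ?_, ?_, ?_, ?_, ?_⟩
  · rw [Ψ₀.restrOpen_source]
    exact ⟨(hG x hx).mem_toOpenPartialHomeomorph_source hd (by simp), hx, L, hL⟩
  · rw [Ψ₀.restrOpen_source]
    exact fun y hy => hy.2.1
  · rfl
  · rw [Ψ₀.restrOpen_source]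
    exact fun y hy => hbij y hy.2
  · intro z hz
    have hs := (Ψ₀.restrOpen O' hO').map_target hz
    rw [Ψ₀.restrOpen_source] at hs
    obtain ⟨-, hyO, e, he⟩ := hs
    have hd' : HasFDerivAt (Ψ₀.restrOpen O' hO') (e : E →L[ℝ] F)
        ((Ψ₀.restrOpen O' hO').symm z) := by
      rw [he]; exact ((hG _ hyO).differentiableAt (by simp)).hasFDerivAt
    exact (Ψ₀.restrOpen O' hO').contDiffAt_symm hz hd' (hG _ hyO)

/-- An injective smooth map on a nonempty open set has injective derivative somewhere. -/
theorem exists_injective_fderiv {f : E → F} {O : Set E} (hO : IsOpen O) (hne : O.Nonempty)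
    (hf : ∀ y ∈ O, ContDiffAt ℝ ∞ f y) (hinj : Set.InjOn f O) :
    ∃ v ∈ O, Function.Injective (fderiv ℝ f v) := by
  -- A point of maximal rank; near it the rank is constant, and the constant rank theorem can be
  -- imitated.
  obtain ⟨v, hv, hmin⟩ : ∃ v ∈ O, ∀ y ∈ O, finrank ℝ (LinearMap.ker (fderiv ℝ f v).toLinearMap) ≤
      finrank ℝ (LinearMap.ker (fderiv ℝ f y).toLinearMap) := by
    refine ⟨_, Function.argminOn_mem
      (fun y => finrank ℝ (LinearMap.ker (fderiv ℝ f y).toLinearMap)) O hne, fun y hy => ?_⟩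
    exact Function.argminOn_le
      (fun y => finrank ℝ (LinearMap.ker (fderiv ℝ f y).toLinearMap)) O hy
  refine ⟨v, hv, ?_⟩
  set K := LinearMap.ker (fderiv ℝ f v).toLinearMap with hK
  set R := LinearMap.range (fderiv ℝ f v).toLinearMap with hR
  obtain ⟨A₀, hA₀⟩ := R.subtype.exists_leftInverse_of_injective (Submodule.ker_subtype R)
  obtain ⟨B₀, hB₀⟩ := K.subtype.exists_leftInverse_of_injective (Submodule.ker_subtype K)
  let A : F →L[ℝ] R := A₀.toContinuousLinearMap
  let B : E →L[ℝ] K := B₀.toContinuousLinearMap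
  have hA : ∀ r : R, A r = r := fun r => LinearMap.congr_fun hA₀ r
  have hB : ∀ k : K, B k = k := fun k => LinearMap.congr_fun hB₀ k
  -- A and B project onto the range and the kernel of the derivative of f at v. Hence G has
  -- bijective derivative at v and supplies local coordinates in which A ∘ f is a coordinate
  -- projection.
  let G : E → R × K := fun y => (A (f y), B y)
  have hGs : ∀ y ∈ O, ContDiffAt ℝ ∞ G y := fun y hy =>
    (A.contDiff.contDiffAt.comp y (hf y hy)).prodMk B.contDiff.contDiffAt
  have hGd : ∀ y ∈ O, fderiv ℝ G y = (A.comp (fderiv ℝ f y)).prod B := by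
    intro y hy
    have h1 : HasFDerivAt f (fderiv ℝ f y) y :=
      ((hf y hy).differentiableAt (by simp)).hasFDerivAt
    exact ((A.hasFDerivAt.comp y h1).prodMk B.hasFDerivAt).fderiv
  have hrank : finrank ℝ R + finrank ℝ K = finrank ℝ E :=
    LinearMap.finrank_range_add_finrank_ker (fderiv ℝ f v).toLinearMap
  have hGv : Function.Bijective (fderiv ℝ G v) := by
    have hi : Function.Injective (fderiv ℝ G v) := by
      rw [injective_iff_map_eq_zero]
      intro w hw
      rw [hGd v hv] at hw
      have h1 : A (fderiv ℝ f v w) = 0 := congrArg Prod.fst hw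
      have h2 : B w = 0 := congrArg Prod.snd hw
      have h3 := hA ⟨fderiv ℝ f v w, ⟨w, rfl⟩⟩
      rw [h1] at h3
      have h4 : fderiv ℝ f v w = 0 := (congrArg Subtype.val h3).symm
      have h5 := hB ⟨w, h4⟩
      rw [h2] at h5
      exact (congrArg Subtype.val h5).symm
    refine ⟨hi, ?_⟩
    refine (LinearMap.injective_iff_surjective_of_finrank_eq_finrank
      (f := (fderiv ℝ G v).toLinearMap) ?_).1 hi
    rw [finrank_prod, hrank]
  obtain ⟨Ψ, hvs, hsO, hΨ, hbij, hsymm⟩ :=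
    exists_openPartialHomeomorph_of_bijective_fderiv hO hGs hv hGv
  -- On the source of Ψ the derivative of A ∘ f is onto R, so its kernel has dimension dim K. It
  -- contains the kernel of the derivative of f, whose dimension is at least dim K by minimality, so
  -- the two kernels coincide.
  have hker : ∀ y ∈ Ψ.source, ∀ w, A (fderiv ℝ f y w) = 0 → fderiv ℝ f y w = 0 := by
    intro y hy w hw
    have hle : LinearMap.ker (fderiv ℝ f y).toLinearMap ≤
        LinearMap.ker (A.comp (fderiv ℝ f y)).toLinearMap := by
      intro w hw
      simp only [LinearMap.mem_ker, ContinuousLinearMap.coe_coe,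
        ContinuousLinearMap.comp_apply] at hw ⊢
      rw [hw, map_zero]
    have hsurj : Function.Surjective (A.comp (fderiv ℝ f y)).toLinearMap := by
      intro r
      obtain ⟨w, hw⟩ := (hbij y hy).2 (r, 0)
      rw [hGd y (hsO hy)] at hw
      exact ⟨w, congrArg Prod.fst hw⟩
    have h1 := LinearMap.finrank_range_add_finrank_ker (A.comp (fderiv ℝ f y)).toLinearMap
    rw [LinearMap.range_eq_top.2 hsurj, finrank_top] at h1
    have h2 := hmin y (hsO hy)
    have h3 := Submodule.eq_of_le_of_finrank_le hle (by omega)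
    have : w ∈ LinearMap.ker (A.comp (fderiv ℝ f y)).toLinearMap := hw
    rw [← h3] at this
    exact this
  rw [injective_iff_map_eq_zero]
  intro κ hκ
  -- The curve through v with direction (0, κ) in the coordinates G. Along it A ∘ f is constant, so
  -- by `hker` the derivative of f ∘ γ vanishes; injectivity of f then forces κ = 0.
  let γ : ℝ → E := fun t => Ψ.symm (G v + t • ((0 : R), (⟨κ, hκ⟩ : K)))
  have hcont : Continuous fun t : ℝ => G v + t • ((0 : R), (⟨κ, hκ⟩ : K)) := by fun_prop
  have htgt : G v ∈ Ψ.target := by rw [← hΨ]; exact Ψ.map_source hvs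
  have h0 : ∀ᶠ t in 𝓝 (0 : ℝ), G v + t • ((0 : R), (⟨κ, hκ⟩ : K)) ∈ Ψ.target := by
    refine hcont.continuousAt.eventually (Ψ.open_target.mem_nhds ?_)
    simpa using htgt
  obtain ⟨ε, hε, hball⟩ := Metric.eventually_nhds_iff_ball.1 h0
  have hder : ∀ t ∈ Metric.ball (0 : ℝ) ε, HasDerivAt (f ∘ γ) 0 t := by
    intro t ht
    have hz := hball t ht
    have hs := Ψ.map_target hz
    have h1 : HasDerivAt (fun t : ℝ => G v + t • ((0 : R), (⟨κ, hκ⟩ : K)))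
        ((0 : R), (⟨κ, hκ⟩ : K)) t := by
      simpa using ((hasDerivAt_id t).smul_const ((0 : R), (⟨κ, hκ⟩ : K))).const_add (G v)
    have h2 : HasDerivAt γ (fderiv ℝ Ψ.symm _ ((0 : R), (⟨κ, hκ⟩ : K))) t :=
      (((hsymm _ hz).differentiableAt (by simp)).hasFDerivAt).comp_hasDerivAt t h1
    set w := fderiv ℝ Ψ.symm _ ((0 : R), (⟨κ, hκ⟩ : K)) with hw
    have h3 : HasDerivAt (f ∘ γ) (fderiv ℝ f (γ t) w) t :=
      (((hf _ (hsO hs)).differentiableAt (by simp)).hasFDerivAt).comp_hasDerivAt t h2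
    have h4 : HasDerivAt (G ∘ γ) (fderiv ℝ G (γ t) w) t :=
      (((hGs _ (hsO hs)).differentiableAt (by simp)).hasFDerivAt).comp_hasDerivAt t h2
    have h5 : HasDerivAt (G ∘ γ) ((0 : R), (⟨κ, hκ⟩ : K)) t := by
      refine h1.congr_of_eventuallyEq ?_
      filter_upwards [Metric.isOpen_ball.mem_nhds ht] with t' ht'
      have := Ψ.right_inv (hball t' ht')
      rw [hΨ] at this
      exact this
    have h6 := h4.unique h5
    rw [hGd _ (hsO hs)] at h6
    rwa [hker _ hs w (congrArg Prod.fst h6)] at h3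
  have hε2 : ε / 2 ∈ Metric.ball (0 : ℝ) ε := by
    rw [Metric.mem_ball, dist_zero_right, Real.norm_eq_abs, abs_of_pos (by positivity)]
    linarith
  have hconst := Metric.isOpen_ball.is_const_of_deriv_eq_zero
    (convex_ball (0 : ℝ) ε).isPreconnected
    (fun t ht => (hder t ht).differentiableAt.differentiableWithinAt)
    (fun t ht => (hder t ht).deriv) hε2 (Metric.mem_ball_self hε)
  have heq := hinj (hsO (Ψ.map_target (hball _ hε2)))
    (hsO (Ψ.map_target (hball _ (Metric.mem_ball_self hε)))) hconst
  have heq2 := Ψ.symm.injOn (hball _ hε2) (hball _ (Metric.mem_ball_self hε)) heq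
  have h7 := congrArg Prod.snd (add_left_cancel heq2)
  have h8 : (ε / 2) • κ = (0 : ℝ) • κ := congrArg Subtype.val h7
  rw [zero_smul, smul_eq_zero] at h8
  exact h8.resolve_left (by positivity)

/-- If countably many injective smooth maps on open sets cover a nonempty open set, one of them
has bijective derivative somewhere. -/
theorem exists_bijective_fderiv_of_cover {ι : Type*} [Countable ι] {K : ι → Type*}
    [∀ i, NormedAddCommGroup (K i)] [∀ i, NormedSpace ℝ (K i)] [∀ i, FiniteDimensional ℝ (K i)]
    {h : ∀ i, K i → F} {O : ∀ i, Set (K i)} (hO : ∀ i, IsOpen (O i))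
    (hh : ∀ i, ∀ y ∈ O i, ContDiffAt ℝ ∞ (h i) y) (hinj : ∀ i, Set.InjOn (h i) (O i))
    {V : Set F} (hV : IsOpen V) (hne : V.Nonempty) (hcov : V ⊆ ⋃ i, h i '' O i) :
    ∃ i, ∃ v ∈ O i, Function.Bijective (fderiv ℝ (h i) v) := by
  by_contra hcon
  push Not at hcon
  -- Some derivative of `h i` is injective; were the dimensions equal, it would be bijective.
  have hlt : ∀ i, (O i).Nonempty → finrank ℝ (K i) < finrank ℝ F := by
    intro i hi
    obtain ⟨v, hv, hvi⟩ := exists_injective_fderiv (hO i) hi (hh i) (hinj i)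
    refine lt_of_le_of_ne (LinearMap.finrank_le_finrank_of_injective
      (f := (fderiv ℝ (h i) v).toLinearMap) hvi) fun heq => hcon i v hv ⟨hvi, ?_⟩
    exact (LinearMap.injective_iff_surjective_of_finrank_eq_finrank
      (f := (fderiv ℝ (h i) v).toLinearMap) heq).1 hvi
  have hdim : ∀ i, dimH (h i '' O i) ≤ ((finrank ℝ F - 1 : ℕ) : ENNReal) := by
    intro i
    rcases (O i).eq_empty_or_nonempty with he | hi
    · simp [he]
    · refine (dimH_image_le_of_locally_lipschitzOn fun y hy => ?_).trans ?_
      · obtain ⟨C, t, ht, hL⟩ := ((hh i y hy).of_le (m := 1) (by simp)).exists_lipschitzOnWith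
        exact ⟨C, t, mem_nhdsWithin_of_mem_nhds ht, hL⟩
      · refine (dimH_mono (Set.subset_univ _)).trans ?_
        rw [Real.dimH_univ_eq_finrank]
        have := hlt i hi
        exact_mod_cast (by omega : finrank ℝ (K i) ≤ finrank ℝ F - 1)
  have h1 : dimH V ≤ ((finrank ℝ F - 1 : ℕ) : ENNReal) := by
    refine (dimH_mono hcov).trans ?_
    rw [dimH_iUnion]
    exact iSup_le hdim
  obtain ⟨z, hz⟩ := hne
  rw [Real.dimH_of_mem_nhds (hV.mem_nhds hz)] at h1
  have h2 : finrank ℝ F ≤ finrank ℝ F - 1 := by exact_mod_cast h1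
  -- The subtraction in `h2` is truncated, so `h2` leaves the case dim F = 0. It is excluded by
  -- `hlt` at an index whose image contains z.
  obtain ⟨i, hi⟩ := Set.mem_iUnion.1 (hcov hz)
  have := hlt i (hi.imp fun _ h => h.1)
  omega

end Calculus

/-! ### Vector spaces as manifolds and the normal form of submersions -/

namespace Mfd

open Topology Filter Module

/-- A finite dimensional normed space as a manifold. -/
abbrev ofVec (E : Type u) [NormedAddCommGroup E] [NormedSpace ℝ E] [FiniteDimensional ℝ E] :
    Mfd.{u} where
  carrier := E
  top := inferInstance
  secondCountable :=
    have : ProperSpace E := FiniteDimensional.proper ℝ E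
    inferInstance
  atlas n := Set.range fun L : E ≃L[ℝ] EuclideanSpace ℝ (Fin n) =>
    L.toHomeomorph.toOpenPartialHomeomorph
  exists_chart _ :=
    ⟨finrank ℝ E, _, ⟨ContinuousLinearEquiv.ofFinrankEq (by simp), rfl⟩, Set.mem_univ _⟩
  compatible := by
    rintro m n _ _ ⟨L, rfl⟩ ⟨L', rfl⟩
    exact (L'.contDiff.comp L.symm.contDiff).contDiffOn

variable {M N P : Mfd.{u}} {E F K : Type u} [NormedAddCommGroup E] [NormedSpace ℝ E]
  [FiniteDimensional ℝ E] [NormedAddCommGroup F] [NormedSpace ℝ F] [FiniteDimensional ℝ F]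
  [NormedAddCommGroup K] [NormedSpace ℝ K] [FiniteDimensional ℝ K]

theorem exists_chart_ofVec (E : Type u) [NormedAddCommGroup E] [NormedSpace ℝ E]
    [FiniteDimensional ℝ E] : ∃ (n : ℕ) (L : E ≃L[ℝ] EuclideanSpace ℝ (Fin n)),
      (L.toHomeomorph.toOpenPartialHomeomorph : OpenPartialHomeomorph (ofVec E) _) ∈
        (ofVec E).atlas n :=
  ⟨finrank ℝ E, ContinuousLinearEquiv.ofFinrankEq (by simp), _, rfl⟩

theorem smoothAt_to_vec_iff {f : M → ofVec E} {x : M} {m : ℕ}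
    {c : OpenPartialHomeomorph M (EuclideanSpace ℝ (Fin m))} (hc : c ∈ M.atlas m)
    (hx : x ∈ c.source) :
    SmoothAt f x ↔ ContDiffAt ℝ ∞ ((f : M → E) ∘ c.symm) (c x) := by
  obtain ⟨n, L, hL⟩ := exists_chart_ofVec E
  constructor
  · intro h
    have h1 := h.contDiffAt hc hL hx (Set.mem_univ _)
    have h2 := L.symm.contDiff.contDiffAt.comp _ h1
    refine h2.congr_of_eventuallyEq (Eventually.of_forall fun y => ?_)
    simp
  · intro h
    refine SmoothAt.of_charts hc hL hx (Set.mem_univ _) ?_ (L.contDiff.contDiffAt.comp _ h)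
    have h2 : ContinuousAt (((f : M → E) ∘ c.symm) ∘ c) x :=
      ContinuousAt.comp h.continuousAt (c.continuousAt hx)
    refine h2.congr ?_
    filter_upwards [c.open_source.mem_nhds hx] with y hy
    simp [c.left_inv hy]

theorem smoothAt_vec_iff {f : ofVec E → ofVec F} {x : E} :
    SmoothAt f x ↔ ContDiffAt ℝ ∞ (f : E → F) x := by
  obtain ⟨n, L, hL⟩ := exists_chart_ofVec E
  rw [smoothAt_to_vec_iff hL (Set.mem_univ _)]
  constructor
  · intro h
    have h2 := h.comp x (L.contDiff.contDiffAt)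
    refine h2.congr_of_eventuallyEq (Eventually.of_forall fun y => ?_)
    simp
  · intro h
    refine ContDiffAt.comp _ ?_ L.symm.contDiff.contDiffAt
    simpa using h

theorem SmoothAt.prodMk {f : M → ofVec E} {g : M → ofVec F} {x : M} (hf : SmoothAt f x)
    (hg : SmoothAt g x) :
    SmoothAt (N := ofVec (E × F)) (fun y => ((f y : E), (g y : F))) x := by
  obtain ⟨m, c, hc, hx⟩ := M.exists_chart x
  rw [smoothAt_to_vec_iff hc hx] at *
  exact hf.prodMk hg

theorem SmoothAt.vec_comp {f : M → ofVec E} {g : E → F} {x : M} (hg : ContDiffAt ℝ ∞ g (f x))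
    (hf : SmoothAt f x) : SmoothAt (N := ofVec F) (fun y => g (f y)) x :=
  SmoothAt.comp (N := ofVec E) (P := ofVec F) (g := g) (f := f) (smoothAt_vec_iff.2 hg) hf

/-- A diffeomorphism between open subsets of a manifold and of a vector space. -/
structure IsSmoothChart (Θ : OpenPartialHomeomorph M E) : Prop where
  smoothAt : ∀ y ∈ Θ.source, SmoothAt (N := ofVec E) Θ y
  smoothAt_symm : ∀ z ∈ Θ.target, SmoothAt (M := ofVec E) Θ.symm z

/-- The space `ℝⁿ` in the universe `u`. -/
def Vec (n : ℕ) : Type u := ULift.{u} (EuclideanSpace ℝ (Fin n))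

noncomputable instance (n : ℕ) : NormedAddCommGroup (Vec.{u} n) :=
  inferInstanceAs (NormedAddCommGroup (ULift.{u} (EuclideanSpace ℝ (Fin n))))

noncomputable instance (n : ℕ) : NormedSpace ℝ (Vec.{u} n) :=
  inferInstanceAs (NormedSpace ℝ (ULift.{u} (EuclideanSpace ℝ (Fin n))))

instance (n : ℕ) : FiniteDimensional ℝ (Vec.{u} n) :=
  inferInstanceAs (FiniteDimensional ℝ (ULift.{u} (EuclideanSpace ℝ (Fin n))))

/-- The identification of `ℝⁿ` with its lift. -/
def vecEquiv (n : ℕ) : EuclideanSpace ℝ (Fin n) ≃L[ℝ] Vec.{u} n :=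
  (ContinuousLinearEquiv.ulift (R₁ := ℝ) (M₁ := EuclideanSpace ℝ (Fin n))).symm

/-- A chart of the atlas followed by a diffeomorphism of vector spaces. -/
theorem isSmoothChart_trans {m : ℕ} {c : OpenPartialHomeomorph M (EuclideanSpace ℝ (Fin m))}
    (hc : c ∈ M.atlas m) {Ψ : OpenPartialHomeomorph (EuclideanSpace ℝ (Fin m)) E}
    (h1 : ∀ y ∈ Ψ.source, ContDiffAt ℝ ∞ Ψ y) (h2 : ∀ z ∈ Ψ.target, ContDiffAt ℝ ∞ Ψ.symm z) :
    IsSmoothChart (c.trans Ψ) := by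
  refine ⟨fun y hy => ?_, fun z hz => ?_⟩
  · rw [OpenPartialHomeomorph.trans_source] at hy
    rw [smoothAt_to_vec_iff hc hy.1]
    refine (h1 _ hy.2).congr_of_eventuallyEq ?_
    filter_upwards [c.open_target.mem_nhds (c.map_source hy.1)] with w hw
    simp [c.right_inv hw]
  · obtain ⟨n, L, hL⟩ := exists_chart_ofVec E
    rw [OpenPartialHomeomorph.trans_target] at hz
    have hcont : ContinuousAt (c.trans Ψ).symm z :=
      (c.trans Ψ).continuousAt_symm (by rw [OpenPartialHomeomorph.trans_target]; exact hz)
    have hsrc : (c.trans Ψ).symm z ∈ c.source := c.map_target hz.2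
    refine SmoothAt.of_charts hL hc (Set.mem_univ _) hsrc hcont ?_
    have h3 : ContDiffAt ℝ ∞ (Ψ.symm ∘ L.symm) (L z) :=
      ContDiffAt.comp _ (by simpa using h2 z hz.1) L.symm.contDiff.contDiffAt
    refine h3.congr_of_eventuallyEq ?_
    have h4 : ∀ᶠ w in 𝓝 (L z), (c.trans Ψ).symm (L.symm w) ∈ c.source := by
      have : ContinuousAt ((c.trans Ψ).symm ∘ L.symm) (L z) :=
        ContinuousAt.comp (by simpa using hcont) L.symm.continuous.continuousAt
      exact this.eventually (by simpa using c.open_source.mem_nhds hsrc)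
    have h5 : ∀ᶠ w in 𝓝 (L z), L.symm w ∈ (c.trans Ψ).target := by
      refine L.symm.continuous.continuousAt.eventually ?_
      rw [L.symm_apply_apply]
      exact (c.trans Ψ).open_target.mem_nhds
        (by rw [OpenPartialHomeomorph.trans_target]; exact hz)
    filter_upwards [h5] with w hw
    rw [OpenPartialHomeomorph.trans_target] at hw
    exact c.right_inv hw.2

theorem exists_smoothChart (x : M) : ∃ (n : ℕ) (e : OpenPartialHomeomorph M (Vec.{u} n)),
    x ∈ e.source ∧ IsSmoothChart e := by
  obtain ⟨n, c, hc, hx⟩ := M.exists_chart x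
  refine ⟨n, c.trans (vecEquiv n).toHomeomorph.toOpenPartialHomeomorph, ?_,
    isSmoothChart_trans hc (fun y _ => (vecEquiv n).contDiff.contDiffAt)
      (fun z _ => (vecEquiv n).symm.contDiff.contDiffAt)⟩
  simpa using hx

/-- B is a projection onto the kernel of L, identified with a `Vec`. It supplies the fiber
coordinates in the normal form of a submersion. -/
theorem exists_complement {m n : ℕ} {L : EuclideanSpace ℝ (Fin m) →L[ℝ] EuclideanSpace ℝ (Fin n)}
    (hL : Function.Surjective L) : ∃ (k : ℕ) (B : EuclideanSpace ℝ (Fin m) →L[ℝ] Vec.{u} k),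
      Function.Bijective (L.prod B) := by
  set Ker := LinearMap.ker L.toLinearMap with hKer
  obtain ⟨B₀, hB₀⟩ := Ker.subtype.exists_leftInverse_of_injective (Submodule.ker_subtype Ker)
  have hB : ∀ k : Ker, B₀ k = k := fun k => LinearMap.congr_fun hB₀ k
  let T : Ker ≃L[ℝ] Vec.{u} (finrank ℝ Ker) :=
    (ContinuousLinearEquiv.ofFinrankEq (by simp)).trans (vecEquiv (finrank ℝ Ker))
  refine ⟨finrank ℝ Ker, (T : Ker →L[ℝ] Vec.{u} (finrank ℝ Ker)).comp B₀.toContinuousLinearMap, ?_⟩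
  have hi : Function.Injective
      (L.prod ((T : Ker →L[ℝ] Vec.{u} (finrank ℝ Ker)).comp B₀.toContinuousLinearMap)) := by
    rw [injective_iff_map_eq_zero]
    intro w hw
    have h1 : L w = 0 := congrArg Prod.fst hw
    have h2 : T (B₀ w) = 0 := congrArg Prod.snd hw
    rw [T.map_eq_zero_iff] at h2
    have h5 := hB ⟨w, h1⟩
    rw [h2] at h5
    exact (congrArg Subtype.val h5).symm
  refine ⟨hi, (LinearMap.injective_iff_surjective_of_finrank_eq_finrank
      (f := (L.prod ((T : Ker →L[ℝ] Vec.{u} (finrank ℝ Ker)).comp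
        B₀.toContinuousLinearMap)).toLinearMap) ?_).1 hi⟩
  have h1 := LinearMap.finrank_range_add_finrank_ker L.toLinearMap
  rw [LinearMap.range_eq_top.2 hL, finrank_top] at h1
  have h2 : finrank ℝ (Vec.{u} (finrank ℝ Ker)) = finrank ℝ Ker := by
    rw [← T.toLinearEquiv.finrank_eq]
  rw [finrank_prod, h2, ← h1]

/-- The local normal form of a submersion: in suitable charts it is a linear projection. -/
theorem IsSubmersion.exists_smoothChart {f : M ⟶ N} (hf : IsSubmersion f) (p : M) :
    ∃ (n k : ℕ) (e : OpenPartialHomeomorph N (Vec.{u} n))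
      (Θ : OpenPartialHomeomorph M (Vec.{u} n × Vec.{u} k)),
      IsSmoothChart e ∧ IsSmoothChart Θ ∧ p ∈ Θ.source ∧
        ∀ y ∈ Θ.source, f y ∈ e.source ∧ (Θ y).1 = e (f y) := by
  obtain ⟨m, c, hc, hpc⟩ := M.exists_chart p
  obtain ⟨n, d, hd, hpd⟩ := N.exists_chart (f p)
  obtain ⟨k, B, hB⟩ := exists_complement.{u} (hf hc hd p hpc hpd)
  let g : EuclideanSpace ℝ (Fin m) → EuclideanSpace ℝ (Fin n) := d ∘ f ∘ c.symm
  -- The chart expression of f completed by the projection B onto the kernel of its derivative at `c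
  -- p`; the derivative of G there is bijective.
  let G : EuclideanSpace ℝ (Fin m) → Vec.{u} n × Vec.{u} k := fun y => (vecEquiv n (g y), B y)
  let O := c.target ∩ c.symm ⁻¹' (f ⁻¹' d.source)
  have hO : IsOpen O :=
    c.isOpen_inter_preimage_symm (d.open_source.preimage f.smooth.continuous)
  have hgs : ∀ y ∈ O, ContDiffAt ℝ ∞ g y := fun y hy =>
    (f.smooth.contDiffOn hc hd).contDiffAt (hO.mem_nhds hy)
  have hGs : ∀ y ∈ O, ContDiffAt ℝ ∞ G y := fun y hy =>
    ((vecEquiv n).contDiff.contDiffAt.comp y (hgs y hy)).prodMk B.contDiff.contDiffAt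
  have hpO : c p ∈ O := ⟨c.map_source hpc, by simpa [c.left_inv hpc] using hpd⟩
  have hGd : Function.Bijective (fderiv ℝ G (c p)) := by
    have h1 : HasFDerivAt g (fderiv ℝ g (c p)) (c p) :=
      ((hgs _ hpO).differentiableAt (by simp)).hasFDerivAt
    have h2 : fderiv ℝ G (c p) =
        (((vecEquiv n : _ →L[ℝ] Vec.{u} n)).comp (fderiv ℝ g (c p))).prod B :=
      (((vecEquiv n).hasFDerivAt.comp _ h1).prodMk B.hasFDerivAt).fderiv
    rw [h2]
    exact ((((vecEquiv n).toEquiv.prodCongr (Equiv.refl (Vec.{u} k))).bijective).comp hB)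
  obtain ⟨Ψ, hps, hsO, hΨ, -, hsymm⟩ :=
    exists_openPartialHomeomorph_of_bijective_fderiv hO hGs hpO hGd
  refine ⟨n, k, d.trans (vecEquiv n).toHomeomorph.toOpenPartialHomeomorph, c.trans Ψ,
    isSmoothChart_trans hd (fun y _ => (vecEquiv n).contDiff.contDiffAt)
      (fun z _ => (vecEquiv n).symm.contDiff.contDiffAt),
    isSmoothChart_trans hc (fun y hy => ?_) hsymm, ?_, fun y hy => ?_⟩
  · rw [hΨ]; exact hGs y (hsO hy)
  · rw [OpenPartialHomeomorph.trans_source]; exact ⟨hpc, hps⟩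
  · rw [OpenPartialHomeomorph.trans_source] at hy
    have h1 := hsO hy.2
    have h2 : f y ∈ d.source := by simpa [c.left_inv hy.1] using h1.2
    refine ⟨by simpa using h2, ?_⟩
    simp [hΨ, G, g, c.left_inv hy.1]

/-- A submersion has local sections. -/
theorem IsSubmersion.exists_section {f : M ⟶ N} (hf : IsSubmersion f) (p : M) :
    ∃ (U : TopologicalSpace.Opens N) (σ : N → M), f p ∈ U ∧ σ (f p) = p ∧
      (∀ y ∈ U, SmoothAt σ y) ∧ ∀ y ∈ U, f (σ y) = y := by
  obtain ⟨n, k, e, Θ, he, hΘ, hp, h⟩ := hf.exists_smoothChart p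
  -- Freezing the fiber coordinate at its value at p makes the section pass through p.
  let j : Vec.{u} n → Vec.{u} n × Vec.{u} k := fun v => (v, (Θ p).2)
  have hj : Continuous j := by fun_prop
  let U : Set N := e.source ∩ e ⁻¹' (j ⁻¹' Θ.target)
  have hU : IsOpen U := e.isOpen_inter_preimage (Θ.open_target.preimage hj)
  have hjp : j (e (f p)) = Θ p := by rw [← (h p hp).2]
  refine ⟨⟨U, hU⟩, fun y => Θ.symm (j (e y)), ⟨(h p hp).1, ?_⟩, ?_, ?_, ?_⟩
  · rw [Set.mem_preimage, Set.mem_preimage, hjp]; exact Θ.map_source hp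
  · simp only [hjp]; exact Θ.left_inv hp
  · rintro y ⟨hy1, hy2⟩
    have h1 : SmoothAt (N := ofVec (Vec.{u} n × Vec.{u} k)) (fun y => j (e y)) y :=
      SmoothAt.vec_comp (g := j) (contDiffAt_id.prodMk contDiffAt_const) (he.smoothAt y hy1)
    exact SmoothAt.comp (hΘ.smoothAt_symm _ hy2) h1
  · rintro y ⟨hy1, hy2⟩
    have hs := Θ.map_target hy2
    have h1 := h _ hs
    refine e.injOn h1.1 hy1 ?_
    rw [← h1.2, Θ.right_inv hy2]

end Mfd

/-! ### Smoothness near a point -/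

namespace Mfd

open Topology Filter Module

variable {M N P : Mfd.{u}} {E F : Type u} [NormedAddCommGroup E] [NormedSpace ℝ E]
  [FiniteDimensional ℝ E] [NormedAddCommGroup F] [NormedSpace ℝ F] [FiniteDimensional ℝ F]

/-- Smoothness on a neighborhood of a point. -/
def SmoothNear (f : M → N) (x : M) : Prop := ∀ᶠ y in 𝓝 x, SmoothAt f y

theorem SmoothNear.smoothAt {f : M → N} {x : M} (h : SmoothNear f x) : SmoothAt f x :=
  h.self_of_nhds

theorem SmoothNear.continuousAt {f : M → N} {x : M} (h : SmoothNear f x) : ContinuousAt f x :=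
  h.smoothAt.1

theorem isSmooth_of_smoothNear {f : M → N} (h : ∀ x, SmoothNear f x) : IsSmooth f :=
  isSmooth_iff.2 fun x => (h x).smoothAt

theorem smoothNear_hom (f : M ⟶ N) (x : M) : SmoothNear f x :=
  Eventually.of_forall fun y => smoothAt_hom f y

theorem smoothNear_id (x : M) : SmoothNear (fun y : M => y) x :=
  Eventually.of_forall fun y => smoothAt_id y

theorem smoothNear_const (y : N) (x : M) : SmoothNear (fun _ : M => y) x :=
  Eventually.of_forall fun x => smoothAt_const y x

theorem SmoothNear.comp {g : N → P} {f : M → N} {x : M} (hg : SmoothNear g (f x))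
    (hf : SmoothNear f x) : SmoothNear (fun y => g (f y)) x := by
  filter_upwards [hf, hf.continuousAt.eventually hg] with y hy1 hy2
  exact hy2.comp hy1

theorem SmoothNear.congr {f g : M → N} {x : M} (hf : SmoothNear f x) (h : g =ᶠ[𝓝 x] f) :
    SmoothNear g x := by
  filter_upwards [hf, h.eventuallyEq_nhds] with y hy1 hy2
  exact hy1.congr hy2

theorem SmoothNear.prodMk {f : M → ofVec E} {g : M → ofVec F} {x : M} (hf : SmoothNear f x)
    (hg : SmoothNear g x) :
    SmoothNear (N := ofVec (E × F)) (fun y => ((f y : E), (g y : F))) x := by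
  filter_upwards [hf, hg] with y hy1 hy2
  exact hy1.prodMk hy2

theorem SmoothNear.vec_comp {f : M → ofVec E} {g : E → F} {x : M} (hg : ContDiff ℝ ∞ g)
    (hf : SmoothNear f x) : SmoothNear (N := ofVec F) (fun y => g (f y)) x := by
  filter_upwards [hf] with y hy1
  exact SmoothAt.vec_comp hg.contDiffAt hy1

theorem IsSmoothChart.smoothNear {Θ : OpenPartialHomeomorph M E} (h : IsSmoothChart Θ) {y : M}
    (hy : y ∈ Θ.source) : SmoothNear (N := ofVec E) Θ y := by
  filter_upwards [Θ.open_source.mem_nhds hy] with z hz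
  exact h.smoothAt z hz

theorem IsSmoothChart.smoothNear_symm {Θ : OpenPartialHomeomorph M E} (h : IsSmoothChart Θ)
    {z : E} (hz : z ∈ Θ.target) : SmoothNear (M := ofVec E) Θ.symm z := by
  have : Θ.target ∈ 𝓝 z := Θ.open_target.mem_nhds hz
  filter_upwards [this] with w hw
  exact h.smoothAt_symm w hw

theorem IsSubmersion.exists_smoothNear_section {f : M ⟶ N} (hf : IsSubmersion f) (p : M) :
    ∃ σ : N → M, σ (f p) = p ∧ SmoothNear σ (f p) ∧ ∀ᶠ y in 𝓝 (f p), f (σ y) = y := by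
  obtain ⟨U, σ, hU, hσ, h1, h2⟩ := hf.exists_section p
  have := U.isOpen.mem_nhds hU
  exact ⟨σ, hσ, by filter_upwards [this] with y hy using h1 y hy,
    by filter_upwards [this] with y hy using h2 y hy⟩

/-- An operation on composable points that is smooth on all composable smooth maps is smooth near
every point near which its arguments are smooth and composable. -/
theorem smoothNear_of_test {A B C : Mfd.{u}} {R : A → B → Prop} {op : A → B → C}
    (hop : ∀ (W : Mfd.{u}) (a : W ⟶ A) (b : W ⟶ B), (∀ w : W, R (a w) (b w)) →
      IsSmooth (fun w : W => op (a w) (b w)))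
    {a : M → A} {b : M → B} {x : M} (ha : SmoothNear a x) (hb : SmoothNear b x)
    (h : ∀ᶠ y in 𝓝 x, R (a y) (b y)) : SmoothNear (fun y => op (a y) (b y)) x := by
  -- Order ∞ at a single point gives no common neighborhood of smoothness, hence the use of
  -- `SmoothNear`: it provides an open O that can serve as the test manifold W.
  obtain ⟨O, hO, hOo, hxO⟩ := eventually_nhds_iff.1 (ha.and (hb.and h))
  let U : TopologicalSpace.Opens M := ⟨O, hOo⟩
  have h1 := hop (M.restrict U) (homOfSmoothOn U a fun y hy => (hO y hy).1)
    (homOfSmoothOn U b fun y hy => (hO y hy).2.1) fun w => (hO w.1 w.2).2.2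
  filter_upwards [hOo.mem_nhds hxO] with y hy
  exact (smoothAt_restrict_iff M (U := U) (f := fun y => op (a y) (b y)) ⟨y, hy⟩).1
    (h1.smoothAt _)

end Mfd

/-! ### Total product, action and division; translation of smooth division -/

namespace LieGroupoid

open Topology Filter Module Mfd

variable {M : Mfd.{u}} {Γ : LieGroupoid M}

open Classical in
/-- The product, extended by a junk value to pairs that are not composable. -/
noncomputable def mulT (Γ : LieGroupoid M) (γ δ : Γ.arr) : Γ.arr :=
  if h : Γ.tgt γ = Γ.src δ then Γ.mul γ δ h else γ

theorem mulT_eq {γ δ : Γ.arr} (h : Γ.tgt γ = Γ.src δ) : Γ.mulT γ δ = Γ.mul γ δ h := dif_pos h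

theorem smoothNear_mulT {W : Mfd.{u}} {a b : W → Γ.arr} {w : W} (ha : SmoothNear a w)
    (hb : SmoothNear b w) (h : ∀ᶠ y in 𝓝 w, Γ.tgt (a y) = Γ.src (b y)) :
    SmoothNear (fun y => Γ.mulT (a y) (b y)) w := by
  refine smoothNear_of_test (R := fun γ δ => Γ.tgt γ = Γ.src δ) (fun W a b h => ?_) ha hb h
  have : (fun w => Γ.mulT (a w) (b w)) = fun w => Γ.mul (a w) (b w) (h w) :=
    funext fun w => mulT_eq (h w)
  rw [this]
  exact Γ.smooth_mul W a b h

namespace Torsor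

variable (Q : Torsor Γ)

open Classical in
/-- The action, extended by a junk value. -/
noncomputable def actT (p : Q.total) (γ : Γ.arr) : Q.total :=
  if h : Q.anchor p = Γ.src γ then Q.act p γ h else p

variable {Q}

theorem actT_eq {p : Q.total} {γ : Γ.arr} (h : Q.anchor p = Γ.src γ) :
    Q.actT p γ = Q.act p γ h := dif_pos h

theorem smoothNear_actT {W : Mfd.{u}} {a : W → Q.total} {b : W → Γ.arr} {w : W}
    (ha : SmoothNear a w) (hb : SmoothNear b w)
    (h : ∀ᶠ y in 𝓝 w, Q.anchor (a y) = Γ.src (b y)) :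
    SmoothNear (fun y => Q.actT (a y) (b y)) w := by
  refine smoothNear_of_test (R := fun p γ => Q.anchor p = Γ.src γ) (fun W a b h => ?_) ha hb h
  have : (fun w => Q.actT (a w) (b w)) = fun w => Q.act (a w) (b w) (h w) :=
    funext fun w => actT_eq (h w)
  rw [this]
  exact Q.smooth_act W a b h

theorem proj_actT (p : Q.total) (γ : Γ.arr) : Q.proj (Q.actT p γ) = Q.proj p := by
  unfold actT
  split_ifs with h
  · exact Q.proj_act p γ h
  · rfl

theorem anchor_actT {p : Q.total} {γ : Γ.arr} (h : Q.anchor p = Γ.src γ) :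
    Q.anchor (Q.actT p γ) = Γ.tgt γ := by
  rw [actT_eq h, Q.anchor_act]

theorem actT_mulT {p : Q.total} {γ δ : Γ.arr} (h : Q.anchor p = Γ.src γ)
    (h' : Γ.tgt γ = Γ.src δ) : Q.actT p (Γ.mulT γ δ) = Q.actT (Q.actT p γ) δ := by
  rw [mulT_eq h', actT_eq (h.trans (Γ.src_mul γ δ h').symm), actT_eq h,
    actT_eq ((Q.anchor_act p γ h).trans h'), Q.act_mul]

open Classical in
/-- The arrow `γ` with `p · γ = p'`, extended by a junk value. -/
noncomputable def divT (Q : Torsor Γ) (p p' : Q.total) : Γ.arr :=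
  if h : Q.proj p = Q.proj p' then (Q.existsUnique_act p p' h).choose else Γ.one (Q.anchor p)

theorem anchor_eq_src_divT {p p' : Q.total} (h : Q.proj p = Q.proj p') :
    Q.anchor p = Γ.src (Q.divT p p') := by
  unfold divT
  rw [dif_pos h]
  exact (Q.existsUnique_act p p' h).choose_spec.1.1

theorem actT_divT {p p' : Q.total} (h : Q.proj p = Q.proj p') : Q.actT p (Q.divT p p') = p' := by
  rw [actT_eq (anchor_eq_src_divT h)]
  have h2 := (Q.existsUnique_act p p' h).choose_spec.1.2
  unfold divT
  simp only [dif_pos h]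
  exact h2

/-- The uniqueness half of the torsor axiom. Identities between quotients are proved by letting the
candidate act. -/
theorem divT_eq {p p' : Q.total} {γ : Γ.arr} (h : Q.anchor p = Γ.src γ) (h' : Q.actT p γ = p') :
    Q.divT p p' = γ := by
  have hp : Q.proj p = Q.proj p' := by rw [← h', proj_actT]
  refine (Q.existsUnique_act p p' hp).unique ⟨anchor_eq_src_divT hp, ?_⟩ ⟨h, ?_⟩
  · rw [← actT_eq, actT_divT hp]
  · rw [← actT_eq, h']

theorem tgt_divT {p p' : Q.total} (h : Q.proj p = Q.proj p') :
    Γ.tgt (Q.divT p p') = Q.anchor p' := by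
  conv_rhs => rw [← actT_divT h]
  rw [anchor_actT (anchor_eq_src_divT h)]

theorem mulT_divT {p q r : Q.total} (h : Q.proj p = Q.proj q) (h' : Q.proj q = Q.proj r) :
    Γ.mulT (Q.divT p q) (Q.divT q r) = Q.divT p r := by
  have h1 : Γ.tgt (Q.divT p q) = Γ.src (Q.divT q r) :=
    (tgt_divT h).trans (anchor_eq_src_divT h')
  refine (divT_eq ?_ ?_).symm
  · rw [mulT_eq h1, Γ.src_mul]; exact anchor_eq_src_divT h
  · rw [actT_mulT (anchor_eq_src_divT h) h1, actT_divT h, actT_divT h']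

theorem act_inv {p p' : Q.total} {γ : Γ.arr} (h : Q.anchor p = Γ.src γ) (h' : Q.actT p γ = p') :
    Q.anchor p' = Γ.src (Γ.inv γ) ∧ Q.actT p' (Γ.inv γ) = p := by
  have ha : Q.anchor p' = Γ.src (Γ.inv γ) := by rw [← h', anchor_actT h, Γ.src_inv]
  refine ⟨ha, ?_⟩
  rw [← h', ← actT_mulT h (Γ.src_inv γ).symm, mulT_eq (Γ.src_inv γ).symm, Γ.mul_inv]
  rw [← h, actT_eq (Γ.src_one _).symm, Q.act_one]

theorem divT_symm {p q : Q.total} (h : Q.proj p = Q.proj q) :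
    Q.divT q p = Γ.inv (Q.divT p q) := by
  obtain ⟨h1, h2⟩ := act_inv (anchor_eq_src_divT h) (actT_divT h)
  exact divT_eq h1 h2

/-- Smoothness of the division of the torsor near a pair of points. -/
def DivSmooth (p p' : Q.total) : Prop :=
  ∀ ⦃W : Mfd.{u}⦄ ⦃a b : W → Q.total⦄ ⦃w : W⦄, a w = p → b w = p' → SmoothNear a w →
    SmoothNear b w → (∀ᶠ y in 𝓝 w, Q.proj (a y) = Q.proj (b y)) →
    SmoothNear (fun y => Q.divT (a y) (b y)) w

/-- Let τ be a local section of the source map through the arrow that carries q to p. Then a ·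
τ(anchor a) passes through p, and the quotient of (a, b) is τ(anchor a) times the quotient of (a ·
τ(anchor a), b). -/
theorem DivSmooth.left {p q p' : Q.total} (h : DivSmooth p p') (hq : Q.proj q = Q.proj p) :
    DivSmooth q p' := by
  intro W a b w hqa hpb ha hb hab
  have hγ := anchor_eq_src_divT hq
  obtain ⟨τ, hτ, hτs, hτe⟩ := Γ.src_submersion.exists_smoothNear_section (Q.divT q p)
  rw [← hγ, ← hqa] at hτ hτs hτe
  have hanch : SmoothNear (fun y => Q.anchor (a y)) w := (smoothNear_hom Q.anchor _).comp ha
  have hτa : SmoothNear (fun y => τ (Q.anchor (a y))) w :=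
    SmoothNear.comp (f := fun y => Q.anchor (a y)) hτs hanch
  have hsrc : ∀ᶠ y in 𝓝 w, Q.anchor (a y) = Γ.src (τ (Q.anchor (a y))) := by
    filter_upwards [hanch.continuousAt.eventually hτe] with y hy using hy.symm
  have hc := smoothNear_actT (Q := Q) ha hτa hsrc
  have hcw : Q.actT (a w) (τ (Q.anchor (a w))) = p := by
    rw [hτ, hqa]; exact actT_divT hq
  have hcb : ∀ᶠ y in 𝓝 w, Q.proj (Q.actT (a y) (τ (Q.anchor (a y)))) = Q.proj (b y) := by
    filter_upwards [hab] with y hy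
    rw [proj_actT, hy]
  have hd := h (a := fun y => Q.actT (a y) (τ (Q.anchor (a y)))) hcw hpb hc hb hcb
  have hcomp : ∀ᶠ y in 𝓝 w, Γ.tgt (τ (Q.anchor (a y))) =
      Γ.src (Q.divT (Q.actT (a y) (τ (Q.anchor (a y)))) (b y)) := by
    filter_upwards [hsrc, hcb] with y hy1 hy2
    rw [← anchor_eq_src_divT hy2, anchor_actT hy1]
  refine (smoothNear_mulT hτa hd hcomp).congr ?_
  filter_upwards [hsrc, hcb, hcomp] with y hy1 hy2 hy3
  refine divT_eq ?_ ?_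
  · rw [mulT_eq hy3, Γ.src_mul]; exact hy1
  · rw [actT_mulT hy1 hy3, actT_divT hy2]

/-- With s = σ ∘ proj ∘ a for a local section σ of the projection through p', the quotient of (a, b)
is the quotient of (a, s) times the inverse of the quotient of (b, s). Both factors are covered by
`h`. -/
theorem divSmooth_of_forall {p' : Q.total} (h : ∀ q, Q.proj q = Q.proj p' → DivSmooth q p')
    {q r : Q.total} (hq : Q.proj q = Q.proj p') : DivSmooth q r := by
  intro W a b w hqa hrb ha hb hab
  obtain ⟨σ, hσ, hσs, hσe⟩ := Q.proj_submersion.exists_smoothNear_section p'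
  rw [← hq, ← hqa] at hσ hσs hσe
  have hproj : SmoothNear (fun y => Q.proj (a y)) w := (smoothNear_hom Q.proj _).comp ha
  have hc : SmoothNear (fun y => σ (Q.proj (a y))) w :=
    SmoothNear.comp (f := fun y => Q.proj (a y)) hσs hproj
  have hca : ∀ᶠ y in 𝓝 w, Q.proj (a y) = Q.proj (σ (Q.proj (a y))) := by
    filter_upwards [hproj.continuousAt.eventually hσe] with y hy using hy.symm
  have hcb : ∀ᶠ y in 𝓝 w, Q.proj (b y) = Q.proj (σ (Q.proj (a y))) := by
    filter_upwards [hca, hab] with y hy1 hy2 using hy2.symm.trans hy1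
  have hr : Q.proj r = Q.proj p' := by rw [← hrb, ← hab.self_of_nhds, hqa, hq]
  have h1 := h q hq (b := fun y => σ (Q.proj (a y))) hqa hσ ha hc hca
  have h2 := h r hr (b := fun y => σ (Q.proj (a y))) hrb hσ hb hc hcb
  have h3 : SmoothNear (fun y => Γ.inv (Q.divT (b y) (σ (Q.proj (a y))))) w :=
    (smoothNear_hom Γ.inv _).comp h2
  have hcomp : ∀ᶠ y in 𝓝 w, Γ.tgt (Q.divT (a y) (σ (Q.proj (a y)))) =
      Γ.src (Γ.inv (Q.divT (b y) (σ (Q.proj (a y))))) := by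
    filter_upwards [hca, hcb] with y hy1 hy2
    rw [Γ.src_inv, tgt_divT hy1, tgt_divT hy2]
  refine (smoothNear_mulT h1 h3 hcomp).congr ?_
  filter_upwards [hca, hcb] with y hy1 hy2
  rw [← divT_symm hy2, mulT_divT hy1 hy2.symm]

end Torsor

end LieGroupoid

/-! ### Smoothness of the division of a torsor -/

namespace LieGroupoid

open Topology Filter Module Mfd

variable {M : Mfd.{u}} {Γ : LieGroupoid M}

namespace Torsor

variable {Q : Torsor Γ}

/-- If the derivative along the fiber of the orbit map of `p` is bijective at a point, then the
division is smooth near the corresponding pair. -/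
theorem divSmooth_of_bijective {p : Q.total} {n k n' k' : ℕ}
    {e : OpenPartialHomeomorph Q.base (Vec.{u} n)}
    {ψ : OpenPartialHomeomorph Q.total (Vec.{u} n × Vec.{u} k)} (hψ : IsSmoothChart ψ)
    (hψe : ∀ y ∈ ψ.source, Q.proj y ∈ e.source ∧ (ψ y).1 = e (Q.proj y))
    {d : OpenPartialHomeomorph M (Vec.{u} n')}
    {φ : OpenPartialHomeomorph Γ.arr (Vec.{u} n' × Vec.{u} k')} (hd : IsSmoothChart d)
    (hφ : IsSmoothChart φ) (hφd : ∀ y ∈ φ.source, Γ.src y ∈ d.source ∧ (φ y).1 = d (Γ.src y))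
    {v₀ : Vec.{u} k'} (hpd : Q.anchor p ∈ d.source) (hv₀ : (d (Q.anchor p), v₀) ∈ φ.target)
    (hact : Q.actT p (φ.symm (d (Q.anchor p), v₀)) ∈ ψ.source)
    (hbij : Function.Bijective (fderiv ℝ
      (fun v : Vec.{u} k' => (ψ (Q.actT p (φ.symm (d (Q.anchor p), v)))).2) v₀)) :
    DivSmooth p (Q.actT p (φ.symm (d (Q.anchor p), v₀))) := by
  obtain ⟨m, c, hpc, hc⟩ := Mfd.exists_smoothChart p
  have hsrc : ∀ z ∈ φ.target, ∀ x ∈ d.source, z.1 = d x → Γ.src (φ.symm z) = x := by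
    intro z hz x hx hzx
    have h1 := hφd _ (φ.map_target hz)
    rw [φ.right_inv hz, hzx] at h1
    exact d.injOn h1.1 hx h1.2.symm
  let E := Vec.{u} m × Vec.{u} k'
  let A : E → M := fun y => Q.anchor (c.symm y.1)
  let g : E → Γ.arr := fun y => φ.symm (d (A y), y.2)
  let T : E → Q.total := fun y => Q.actT (c.symm y.1) (g y)
  let H : E → Vec.{u} k := fun y => (ψ (T y)).2
  have hcp : c.symm (c p) = p := c.left_inv hpc
  have hc1 : SmoothNear (M := ofVec E) (fun y : E => c.symm y.1) (c p, v₀) :=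
    SmoothNear.comp (N := ofVec (Vec.{u} m)) (M := ofVec E) (g := c.symm) (f := fun y : E => y.1)
      (hc.smoothNear_symm (c.map_source hpc))
      (SmoothNear.vec_comp (E := E) (F := Vec.{u} m) contDiff_fst (smoothNear_id _))
  have hA : SmoothNear (M := ofVec E) A (c p, v₀) :=
    SmoothNear.comp (M := ofVec E) (f := fun y : E => c.symm y.1) (smoothNear_hom Q.anchor _) hc1
  have hA0 : A (c p, v₀) = Q.anchor p := by simp only [A, hcp]
  have hdA : SmoothNear (M := ofVec E) (N := ofVec (Vec.{u} n' × Vec.{u} k'))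
      (fun y : E => (d (A y), y.2)) (c p, v₀) :=
    SmoothNear.prodMk (M := ofVec E) (E := Vec.{u} n') (F := Vec.{u} k')
      (f := fun y : E => d (A y)) (g := fun y : E => y.2)
      (SmoothNear.comp (M := ofVec E) (P := ofVec (Vec.{u} n')) (g := d) (f := A)
        (hd.smoothNear (by rw [hA0]; exact hpd)) hA)
      (SmoothNear.vec_comp (E := E) (F := Vec.{u} k') contDiff_snd (smoothNear_id _))
  have hg : SmoothNear (M := ofVec E) g (c p, v₀) :=
    SmoothNear.comp (M := ofVec E) (N := ofVec (Vec.{u} n' × Vec.{u} k')) (g := φ.symm)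
      (f := fun y : E => (d (A y), y.2))
      (hφ.smoothNear_symm (by simp only [hA0]; exact hv₀)) hdA
  have ev1 : ∀ᶠ y in 𝓝 (c p, v₀), A y ∈ d.source :=
    hA.continuousAt.eventually (by rw [hA0]; exact d.open_source.mem_nhds hpd)
  have ev2 : ∀ᶠ y in 𝓝 (c p, v₀), (d (A y), y.2) ∈ φ.target :=
    hdA.continuousAt.eventually (by
      simp only [hA0]; exact φ.open_target.mem_nhds hv₀)
  have ev3 : ∀ᶠ y in 𝓝 (c p, v₀), Q.anchor (c.symm y.1) = Γ.src (g y) := by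
    filter_upwards [ev1, ev2] with y hy1 hy2
    exact (hsrc _ hy2 _ hy1 rfl).symm
  have hT : SmoothNear (M := ofVec E) T (c p, v₀) :=
    smoothNear_actT (W := ofVec E) hc1 hg ev3
  have hT0 : T (c p, v₀) = Q.actT p (φ.symm (d (Q.anchor p), v₀)) := by
    simp only [T, g, hA0, hcp]
  have ev4 : ∀ᶠ y in 𝓝 (c p, v₀), T y ∈ ψ.source :=
    hT.continuousAt.eventually (by rw [hT0]; exact ψ.open_source.mem_nhds hact)
  have hH : SmoothNear (M := ofVec E) (N := ofVec (Vec.{u} k)) H (c p, v₀) :=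
    SmoothNear.vec_comp (M := ofVec E) (E := Vec.{u} n × Vec.{u} k) (f := fun y => ψ (T y))
      contDiff_snd
      (SmoothNear.comp (M := ofVec E) (P := ofVec (Vec.{u} n × Vec.{u} k)) (g := ψ) (f := T)
        (hψ.smoothNear (by rw [hT0]; exact hact)) hT)
  have ev5 : ∀ᶠ y in 𝓝 ((c p, v₀) : E), ContDiffAt ℝ ∞ H y := by
    filter_upwards [hH] with y hy
    exact smoothAt_vec_iff.1 hy
  obtain ⟨O, hO, hOo, hxO⟩ := eventually_nhds_iff.1 (ev1.and (ev2.and (ev3.and (ev4.and ev5))))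
  -- From the coordinates of a point and the source-fiber coordinate of an arrow γ to the
  -- coordinates of the point and the fiber coordinate of its translate by γ. The derivative is
  -- block triangular, with an identity block and the bijective block of `hpart`; the local inverse
  -- recovers γ from the pair of points.
  let G : E → Vec.{u} m × Vec.{u} k := fun y => (y.1, H y)
  have hGs : ∀ y ∈ O, ContDiffAt ℝ ∞ G y := fun y hy =>
    contDiffAt_fst.prodMk (hO y hy).2.2.2.2
  have hHd : HasFDerivAt H (fderiv ℝ H (c p, v₀)) (c p, v₀) :=
    ((hO _ hxO).2.2.2.2.differentiableAt (by simp)).hasFDerivAt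
  have hGd : fderiv ℝ G (c p, v₀) =
      (ContinuousLinearMap.fst ℝ _ _).prod (fderiv ℝ H (c p, v₀)) :=
    (hasFDerivAt_fst.prodMk hHd).fderiv
  have hpart : fderiv ℝ (fun v : Vec.{u} k' => (ψ (Q.actT p (φ.symm (d (Q.anchor p), v)))).2) v₀ =
      (fderiv ℝ H (c p, v₀)).comp (ContinuousLinearMap.inr ℝ (Vec.{u} m) (Vec.{u} k')) := by
    have h1 : HasFDerivAt (fun v : Vec.{u} k' => ((c p, v) : E))
        (ContinuousLinearMap.inr ℝ (Vec.{u} m) (Vec.{u} k')) v₀ := hasFDerivAt_prodMk_right _ _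
    have h2 := hHd.comp v₀ h1
    rw [← h2.fderiv]
    congr 1
    funext v
    simp only [H, T, g, A, Function.comp_apply, hcp]
  have hGbij : Function.Bijective (fderiv ℝ G (c p, v₀)) := by
    rw [hpart] at hbij
    rw [hGd]
    constructor
    · rw [injective_iff_map_eq_zero]
      rintro ⟨a, b⟩ hab
      have h1 : a = 0 := congrArg Prod.fst hab
      have h2 : fderiv ℝ H (c p, v₀) (a, b) = 0 := congrArg Prod.snd hab
      subst h1
      have h3 : b = 0 := hbij.1 (by rw [map_zero]; exact h2)
      rw [h3]; rfl
    · rintro ⟨a, z⟩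
      obtain ⟨b, hb⟩ := hbij.2 (z - fderiv ℝ H (c p, v₀) (a, 0))
      refine ⟨(a, b), Prod.ext rfl ?_⟩
      have h1 : ((a, b) : E) = (a, 0) + (0, b) := by simp
      have h2 : fderiv ℝ H (c p, v₀) (0, b) = z - fderiv ℝ H (c p, v₀) (a, 0) := hb
      change fderiv ℝ H (c p, v₀) (a, b) = z
      rw [h1, map_add, h2]
      abel
  obtain ⟨Ψ, hxs, hsO, hΨ, -, hsymm⟩ :=
    exists_openPartialHomeomorph_of_bijective_fderiv hOo hGs hxO hGbij
  intro W a b w ha0 hb0 ha hb hab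
  have hbs : b w ∈ ψ.source := by rw [hb0]; exact hact
  have hac : a w ∈ c.source := by rw [ha0]; exact hpc
  have hyz : SmoothNear (N := ofVec (Vec.{u} m × Vec.{u} k))
      (fun y => (c (a y), (ψ (b y)).2)) w :=
    SmoothNear.prodMk (E := Vec.{u} m) (F := Vec.{u} k) (f := fun y => c (a y))
      (g := fun y => (ψ (b y)).2)
      (SmoothNear.comp (P := ofVec (Vec.{u} m)) (g := c) (hc.smoothNear hac) ha)
      (SmoothNear.vec_comp (E := Vec.{u} n × Vec.{u} k) (F := Vec.{u} k)
        (f := fun y => ψ (b y)) contDiff_snd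
        (SmoothNear.comp (P := ofVec (Vec.{u} n × Vec.{u} k)) (g := ψ) (hψ.smoothNear hbs) hb))
  have hyz0 : (c (a w), (ψ (b w)).2) = Ψ (c p, v₀) := by
    rw [hΨ]
    simp only [G, H, hT0, ha0, hb0]
  have htgt : (c (a w), (ψ (b w)).2) ∈ Ψ.target := by rw [hyz0]; exact Ψ.map_source hxs
  have hinv : SmoothNear (M := ofVec (Vec.{u} m × Vec.{u} k)) (N := ofVec E) Ψ.symm
      (c (a w), (ψ (b w)).2) := by
    have : Ψ.target ∈ 𝓝 (c (a w), (ψ (b w)).2) := Ψ.open_target.mem_nhds htgt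
    filter_upwards [this] with z hz
    exact smoothAt_vec_iff.2 (hsymm z hz)
  have hs : SmoothNear (N := ofVec E) (fun y => Ψ.symm (c (a y), (ψ (b y)).2)) w :=
    SmoothNear.comp (N := ofVec (Vec.{u} m × Vec.{u} k)) (P := ofVec E)
      (f := fun y => (c (a y), (ψ (b y)).2)) hinv hyz
  have hs0 : Ψ.symm (c (a w), (ψ (b w)).2) = (c p, v₀) := by
    rw [hyz0, Ψ.left_inv hxs]
  have hfin : SmoothNear (fun y => g (Ψ.symm (c (a y), (ψ (b y)).2))) w :=
    SmoothNear.comp (N := ofVec E) (g := g) (f := fun y => Ψ.symm (c (a y), (ψ (b y)).2))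
      (by rw [hs0]; exact hg) hs
  refine hfin.congr ?_
  have ev6 : ∀ᶠ y in 𝓝 w, (c (a y), (ψ (b y)).2) ∈ Ψ.target :=
    hyz.continuousAt.eventually (Ψ.open_target.mem_nhds htgt)
  filter_upwards [ev6, hab, ha.continuousAt.eventually (c.open_source.mem_nhds hac),
    hb.continuousAt.eventually (ψ.open_source.mem_nhds hbs)] with y hy1 hy2 hy3 hy4
  have h1 := Ψ.right_inv hy1
  have hmem := hO _ (hsO (Ψ.map_target hy1))
  generalize Ψ.symm (c (a y), (ψ (b y)).2) = q at h1 hmem ⊢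
  rw [hΨ] at h1
  have h2 : q.1 = c (a y) := congrArg Prod.fst h1
  have h3 : H q = (ψ (b y)).2 := (congrArg Prod.snd h1 : (G q).2 = _)
  obtain ⟨-, -, hm3, hm4, -⟩ := hmem
  have h4 : c.symm q.1 = a y := by rw [h2, c.left_inv hy3]
  rw [h4] at hm3
  refine divT_eq hm3 ?_
  have h5 : T q = Q.actT (a y) (g q) := by simp only [T, h4]
  rw [← h5]
  -- The base coordinates agree because both points have the same projection, the fiber coordinates
  -- by the choice of the arrow.
  refine ψ.injOn hm4 hy4 (Prod.ext ?_ h3)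
  rw [(hψe _ hm4).2, (hψe _ hy4).2, h5, proj_actT, hy2]

/-- Every point of a torsor has a partner in its fiber near which the division is smooth. -/
theorem exists_divSmooth (p : Q.total) : ∃ p', Q.proj p' = Q.proj p ∧ DivSmooth p p' := by
  obtain ⟨n, k, e, ψ, he, hψ, hp, hψe⟩ := Q.proj_submersion.exists_smoothChart p
  choose n' k' d φ hd hφ hγ hφd using fun γ : Γ.arr => Γ.src_submersion.exists_smoothChart γ
  let I := {γ : Γ.arr // Γ.src γ = Q.anchor p}
  -- Second countability of the manifold of arrows: countably many of the charts cover the source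
  -- fiber over the anchor of p.
  obtain ⟨S, hS, hScov⟩ := TopologicalSpace.isOpen_iUnion_countable
    (fun i : I => (φ i.1).source) fun i => (φ i.1).open_source
  have : Countable S := hS.to_subtype
  have hpd : ∀ i : I, Q.anchor p ∈ (d i.1).source := fun i =>
    (congrArg (· ∈ (d i.1).source) i.2).mp (hφd i.1 i.1 (hγ i.1)).1
  have hsrc : ∀ (i : I) (v : Vec.{u} (k' i.1)), (d i.1 (Q.anchor p), v) ∈ (φ i.1).target →
      Γ.src ((φ i.1).symm (d i.1 (Q.anchor p), v)) = Q.anchor p := by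
    intro i v hv
    have h1 := hφd i.1 _ ((φ i.1).map_target hv)
    rw [(φ i.1).right_inv hv] at h1
    exact (d i.1).injOn h1.1 (hpd i) h1.2.symm
  -- The orbit map of p in the fiber coordinates of the i-th chart of Γ.
  let T : ∀ i : I, Vec.{u} (k' i.1) → Q.total := fun i v =>
    Q.actT p ((φ i.1).symm (d i.1 (Q.anchor p), v))
  let D : ∀ i : I, Set (Vec.{u} (k' i.1)) := fun i =>
    {v | (d i.1 (Q.anchor p), v) ∈ (φ i.1).target}
  have hD : ∀ i, IsOpen (D i) := fun i =>
    (φ i.1).open_target.preimage (Continuous.prodMk_right _)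
  have hT : ∀ i, ∀ v ∈ D i, SmoothNear (M := ofVec (Vec.{u} (k' i.1))) (T i) v := by
    intro i v hv
    have h1 : SmoothNear (M := ofVec (Vec.{u} (k' i.1)))
        (fun v : Vec.{u} (k' i.1) => (φ i.1).symm (d i.1 (Q.anchor p), v)) v :=
      SmoothNear.comp (M := ofVec (Vec.{u} (k' i.1)))
        (N := ofVec (Vec.{u} (n' i.1) × Vec.{u} (k' i.1))) (g := (φ i.1).symm)
        (f := fun v : Vec.{u} (k' i.1) => (d i.1 (Q.anchor p), v))
        ((hφ i.1).smoothNear_symm hv)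
        (SmoothNear.vec_comp (E := Vec.{u} (k' i.1)) (F := Vec.{u} (n' i.1) × Vec.{u} (k' i.1))
          (contDiff_const.prodMk contDiff_id) (smoothNear_id _))
    refine smoothNear_actT (W := ofVec (Vec.{u} (k' i.1))) (smoothNear_const p _) h1 ?_
    have : D i ∈ 𝓝 v := (hD i).mem_nhds hv
    filter_upwards [this] with v hv
    exact (hsrc i v hv).symm
  let O : ∀ i : I, Set (Vec.{u} (k' i.1)) := fun i => D i ∩ (T i) ⁻¹' ψ.source
  have hO : ∀ i, IsOpen (O i) := fun i =>
    ContinuousOn.isOpen_inter_preimage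
      (fun v hv => (hT i v hv).continuousAt.continuousWithinAt) (hD i) ψ.open_source
  have hfst : ∀ i, ∀ v ∈ O i, (ψ (T i v)).1 = e (Q.proj p) := fun i v hv => by
    rw [(hψe _ hv.2).2, proj_actT]
  let V : Set (Vec.{u} k) := {v | (e (Q.proj p), v) ∈ ψ.target}
  have hV : IsOpen V := ψ.open_target.preimage (Continuous.prodMk_right _)
  have hVne : V.Nonempty := ⟨(ψ p).2, by
    change (e (Q.proj p), (ψ p).2) ∈ ψ.target
    rw [← (hψe p hp).2]
    exact ψ.map_source hp⟩
  have hsm : ∀ i : S, ∀ v ∈ O i.1, ContDiffAt ℝ ∞ (fun v => (ψ (T i.1 v)).2) v := by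
    intro i v hv
    refine smoothAt_vec_iff.1 (SmoothNear.smoothAt ?_)
    exact SmoothNear.vec_comp (M := ofVec (Vec.{u} (k' i.1.1))) (E := Vec.{u} n × Vec.{u} k)
      (f := fun v => ψ (T i.1 v)) contDiff_snd
      (SmoothNear.comp (M := ofVec (Vec.{u} (k' i.1.1))) (P := ofVec (Vec.{u} n × Vec.{u} k))
        (g := ψ) (f := T i.1) (hψ.smoothNear hv.2) (hT i.1 v hv.1))
  -- The orbit stays in one fiber, so its base coordinate is fixed and its fiber coordinate
  -- determines the point; freeness of the action then determines the arrow.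
  have hinj : ∀ i : S, Set.InjOn (fun v => (ψ (T i.1 v)).2) (O i.1) := by
    intro i v hv v' hv' heq
    have h1 : T i.1 v = T i.1 v' :=
      ψ.injOn hv.2 hv'.2 (Prod.ext ((hfst _ _ hv).trans (hfst _ _ hv').symm) heq)
    have h2 := divT_eq (hsrc i.1 v hv.1).symm (p' := T i.1 v) rfl
    have h3 := divT_eq (hsrc i.1 v' hv'.1).symm (p' := T i.1 v) h1.symm
    exact congrArg Prod.snd ((φ i.1.1).symm.injOn hv.1 hv'.1 (h2.symm.trans h3))
  -- Transitivity on the fiber: a point with fiber coordinate z is p · γ with γ the quotient, and γ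
  -- lies in one of the countably many charts.
  have hcov : V ⊆ ⋃ i : S, (fun v => (ψ (T i.1 v)).2) '' O i.1 := by
    intro z hz
    have hq := ψ.map_target hz
    have h1 := hψe _ hq
    rw [ψ.right_inv hz] at h1
    have h2 : Q.proj (ψ.symm (e (Q.proj p), z)) = Q.proj p :=
      e.injOn h1.1 (hψe p hp).1 h1.2.symm
    have h3 := anchor_eq_src_divT h2.symm
    have h4 : Q.divT p (ψ.symm (e (Q.proj p), z)) ∈ ⋃ i : I, (φ i.1).source :=
      Set.mem_iUnion.2 ⟨⟨_, h3.symm⟩, hγ _⟩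
    rw [← hScov] at h4
    obtain ⟨i, hi, h5⟩ := Set.mem_iUnion₂.1 h4
    have h6 := (hφd i.1 _ h5).2
    rw [← h3] at h6
    have h7 : (d i.1 (Q.anchor p), (φ i.1 (Q.divT p (ψ.symm (e (Q.proj p), z)))).2) =
        φ i.1 (Q.divT p (ψ.symm (e (Q.proj p), z))) := Prod.ext h6.symm rfl
    have h8 : T i (φ i.1 (Q.divT p (ψ.symm (e (Q.proj p), z)))).2 = ψ.symm (e (Q.proj p), z) := by
      simp only [T]
      rw [h7, (φ i.1).left_inv h5, actT_divT h2.symm]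
    refine Set.mem_iUnion.2 ⟨⟨i, hi⟩, (φ i.1 (Q.divT p (ψ.symm (e (Q.proj p), z)))).2,
      ⟨?_, ?_⟩, ?_⟩
    · have h9 := (φ i.1).map_source h5
      rw [← h7] at h9
      exact h9
    · rw [Set.mem_preimage, h8]; exact hq
    · simp only [h8, ψ.right_inv hz]
  obtain ⟨i, v, hv, hbij⟩ := exists_bijective_fderiv_of_cover (ι := S)
    (K := fun i => Vec.{u} (k' i.1.1)) (h := fun i v => (ψ (T i.1 v)).2) (O := fun i => O i.1)
    (fun i => hO i.1) hsm hinj hV hVne hcov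
  exact ⟨T i.1 v, proj_actT _ _, divSmooth_of_bijective hψ hψe (hd _) (hφ _) (hφd _) (hpd i.1)
    hv.1 hv.2 hbij⟩

/-- One good partner p' of q suffices: translation carries the first argument to any point of the
fiber, and `divSmooth_of_forall` then frees the second. -/
theorem divSmooth (q r : Q.total) : DivSmooth q r := by
  obtain ⟨p', hp', h⟩ := exists_divSmooth q
  exact divSmooth_of_forall (fun q' hq' => h.left (hq'.trans hp')) hp'.symm

/-- The division of a torsor is smooth. -/
theorem smoothNear_divT {W : Mfd.{u}} {a b : W → Q.total} {w : W} (ha : SmoothNear a w)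
    (hb : SmoothNear b w) (h : ∀ᶠ y in 𝓝 w, Q.proj (a y) = Q.proj (b y)) :
    SmoothNear (fun y => Q.divT (a y) (b y)) w :=
  divSmooth _ _ rfl rfl ha hb h

end Torsor

end LieGroupoid

/-! ### Lifting in groupoid fibrations and the fibration of an object -/

namespace CategoryTheory.BasedCategory

variable {𝒮 : Type u₀} [Category.{v₀} 𝒮]

section Fibration

variable {𝒳 : BasedCategory.{v₂, u₂} 𝒮}

theorem map_eq_of_isHomLift {R S : 𝒮} {a b : 𝒳.obj} {f : R ⟶ S} {φ ψ : a ⟶ b}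
    (h : 𝒳.p.IsHomLift f φ) (h' : 𝒳.p.IsHomLift f ψ) : 𝒳.p.map φ = 𝒳.p.map ψ := by
  rw [IsHomLift.fac' 𝒳.p f φ, IsHomLift.fac' 𝒳.p f ψ]

theorem eq_of_isHomLift {R S : 𝒮} {a b : 𝒳.obj} {f g : R ⟶ S} {φ : a ⟶ b}
    (h : 𝒳.p.IsHomLift f φ) (h' : 𝒳.p.IsHomLift g φ) : f = g := by
  rw [IsHomLift.fac 𝒳.p f φ, IsHomLift.fac 𝒳.p g φ]

theorem isHomLift_comp {R S T : 𝒮} {a b c : 𝒳.obj} {f : R ⟶ S} {g : S ⟶ T} {k : R ⟶ T} {φ : a ⟶ b}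
    {ψ : b ⟶ c} (h : 𝒳.p.IsHomLift f φ) (h' : 𝒳.p.IsHomLift g ψ) (hk : f ≫ g = k) :
    𝒳.p.IsHomLift k (φ ≫ ψ) := by
  subst hk; infer_instance

theorem isHomLift_of_map_eq {R S : 𝒮} {a b : 𝒳.obj} {f : R ⟶ S} {φ ψ : a ⟶ b}
    (h : 𝒳.p.IsHomLift f φ) (h' : 𝒳.p.map ψ = 𝒳.p.map φ) : 𝒳.p.IsHomLift f ψ := by
  obtain ⟨⟩ := h
  rw [← h']
  infer_instance

namespace IsGroupoidFibration

/-- The lifting axiom in terms of `IsHomLift`, so that base objects need only be propositionally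
equal to the given ones. -/
theorem exists_lift (h𝒳 : IsGroupoidFibration 𝒳) {R S T : 𝒮} {x y z : 𝒳.obj} {f : S ⟶ T}
    {g : R ⟶ S} {k : R ⟶ T} {φ : y ⟶ x} {ψ : z ⟶ x} (hφ : 𝒳.p.IsHomLift f φ)
    (hψ : 𝒳.p.IsHomLift k ψ) (hk : g ≫ f = k) :
    ∃ χ : z ⟶ y, 𝒳.p.IsHomLift g χ ∧ χ ≫ φ = ψ := by
  obtain ⟨⟩ := hφ
  have hz := IsHomLift.domain_eq 𝒳.p k ψ
  subst hz
  have := IsHomLift.eq_of_isHomLift 𝒳.p k ψ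
  obtain ⟨χ, ⟨h1, h2⟩, -⟩ := h𝒳.existsUnique_lift φ ψ g (hk.trans this)
  exact ⟨χ, h1 ▸ inferInstance, h2⟩

/-- Every arrow is cartesian, hence can be cancelled on the right among arrows with the same image
in the base. Nearly all equalities of arrows below rest on this. -/
theorem lift_ext (h𝒳 : IsGroupoidFibration 𝒳) {x y z : 𝒳.obj} {φ : y ⟶ x} {χ χ' : z ⟶ y}
    (h : χ ≫ φ = χ' ≫ φ) (hb : 𝒳.p.map χ = 𝒳.p.map χ') : χ = χ' :=
  (h𝒳.existsUnique_lift φ (χ ≫ φ) (𝒳.p.map χ) (𝒳.p.map_comp _ _).symm).unique ⟨rfl, rfl⟩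
    ⟨hb.symm, h.symm⟩

theorem lift_ext_of_isHomLift (h𝒳 : IsGroupoidFibration 𝒳) {R S : 𝒮} {f : R ⟶ S}
    {x y z : 𝒳.obj} {φ : y ⟶ x} {χ χ' : z ⟶ y} (h : χ ≫ φ = χ' ≫ φ)
    (h1 : 𝒳.p.IsHomLift f χ) (h2 : 𝒳.p.IsHomLift f χ') : χ = χ' :=
  h𝒳.lift_ext h (map_eq_of_isHomLift h1 h2)

/-- Lifting the identity through φ gives a one-sided inverse; cancelling φ shows that it is
two-sided. -/
theorem isIso_of_isHomLift_id (h𝒳 : IsGroupoidFibration 𝒳) {R : 𝒮} {x y : 𝒳.obj} {φ : y ⟶ x}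
    (h : 𝒳.p.IsHomLift (𝟙 R) φ) :
    IsIso φ := by
  have hx : 𝒳.p.IsHomLift (𝟙 R) (𝟙 x) := IsHomLift.id (IsHomLift.codomain_eq 𝒳.p (𝟙 R) φ)
  have hy : 𝒳.p.IsHomLift (𝟙 R) (𝟙 y) := IsHomLift.id (IsHomLift.domain_eq 𝒳.p (𝟙 R) φ)
  obtain ⟨χ, h1, h2⟩ := h𝒳.exists_lift h hx (Category.id_comp (𝟙 R))
  refine ⟨χ, h𝒳.lift_ext_of_isHomLift (φ := φ) (f := 𝟙 R) ?_ ?_ hy, h2⟩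
  · rw [Category.assoc, h2, Category.comp_id, Category.id_comp]
  · exact isHomLift_comp h h1 (Category.id_comp _)

end IsGroupoidFibration

/-- The functor over `𝒮` that an object of a groupoid fibration defines, by a choice of
pullbacks. -/
theorem IsGroupoidFibration.exists_functor (h𝒳 : IsGroupoidFibration 𝒳) (ξ : 𝒳.obj) :
    ∃ (y : BasedFunctor (ofObj (𝒳.p.obj ξ)) 𝒳) (κ : ∀ {W : 𝒮} (a : W ⟶ 𝒳.p.obj ξ),
      y.obj (ofObj.mk a) ⟶ ξ), (∀ {W : 𝒮} (a : W ⟶ 𝒳.p.obj ξ), 𝒳.p.IsHomLift a (κ a)) ∧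
      ∀ {W W' : 𝒮} (b : W ⟶ 𝒳.p.obj ξ) (a : W' ⟶ 𝒳.p.obj ξ) (m : ofObj.mk b ⟶ ofObj.mk a),
        y.map m ≫ κ a = κ b := by
  choose Y Φ hΦ using fun A : Over (𝒳.p.obj ξ) =>
    h𝒳.exists_pullback A.hom ξ rfl
  choose m hm1 hm2 using fun (A B : Over (𝒳.p.obj ξ)) (f : A ⟶ B) =>
    h𝒳.exists_lift (hΦ B) (hΦ A) (Over.w f)
  have hbase : ∀ A, 𝒳.p.obj (Y A) = A.left := fun A =>
    IsHomLift.domain_eq 𝒳.p A.hom (Φ A)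
  refine ⟨
    { obj := Y
      map := fun {A B} f => m A B f
      map_id := fun A => h𝒳.lift_ext_of_isHomLift (φ := Φ A) (f := 𝟙 A.left)
        ((hm2 A A (𝟙 A)).trans (Category.id_comp _).symm) (hm1 A A (𝟙 A))
        (IsHomLift.id (hbase A))
      map_comp := fun {A B C} f g => h𝒳.lift_ext_of_isHomLift (φ := Φ C)
        (f := (f : A ⟶ B).left ≫ (g : B ⟶ C).left) ?_ (hm1 A C (f ≫ g)) ?_
      w := Functor.ext (fun A => hbase A) fun A B f => ?_ },
    fun a => Φ (Over.mk a), fun a => hΦ (Over.mk a), fun b a m => hm2 (Over.mk b) (Over.mk a) m⟩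
  · refine (hm2 A C (f ≫ g)).trans ?_
    rw [Category.assoc, hm2 B C g, hm2 A B f]
  · exact isHomLift_comp (hm1 A B f) (hm1 B C g) rfl
  · have : 𝒳.p.IsHomLift ((ofObj (𝒳.p.obj ξ)).p.map f) (m A B f) := hm1 A B f
    exact IsHomLift.fac' 𝒳.p _ (m A B f)

end Fibration

section OfObj

variable {X : 𝒮}

/-- The morphism of the fibration defined by `X` given by a commutative triangle. -/
def ofObj.homMk {W W' : 𝒮} {b : W ⟶ X} {a : W' ⟶ X} (f : W ⟶ W') (h : f ≫ a = b) :
    ofObj.mk b ⟶ ofObj.mk a :=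
  show (Over.mk b ⟶ Over.mk a) from Over.homMk f h

theorem ofObj.hom_ext {A B : (ofObj X).obj} {f g : A ⟶ B}
    (h : (ofObj X).p.map f = (ofObj X).p.map g) : f = g :=
  Over.OverMorphism.ext (X := X) h

instance {W W' : 𝒮} {b : W ⟶ X} {a : W' ⟶ X} (f : W ⟶ W') (h : f ≫ a = b) :
    (ofObj X).p.IsHomLift f (ofObj.homMk f h) :=
  IsHomLift.map (ofObj X).p (ofObj.homMk f h)

theorem ofObj.hom_ext_of_isHomLift {R S : 𝒮} {k : R ⟶ S} {A B : (ofObj X).obj} {f g : A ⟶ B}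
    (hf : (ofObj X).p.IsHomLift k f) (hg : (ofObj X).p.IsHomLift k g) : f = g :=
  ofObj.hom_ext (map_eq_of_isHomLift hf hg)

theorem ofObj.exists_eq_mk {W : 𝒮} {A : (ofObj X).obj} (h : (ofObj X).p.obj A = W) :
    ∃ b : W ⟶ X, A = ofObj.mk b := by
  subst h
  exact ⟨Comma.hom (show Over X from A), rfl⟩

theorem ofObj.exists_eq_homMk {W W' : 𝒮} {b : W ⟶ X} {a : W' ⟶ X}
    (m : ofObj.mk b ⟶ ofObj.mk a) : ∃ (f : W ⟶ W') (h : f ≫ a = b), m = ofObj.homMk f h :=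
  ⟨(ofObj X).p.map m, Over.w (show Over.mk b ⟶ Over.mk a from m), rfl⟩

theorem ofObj.homMk_comp {W W' W'' : 𝒮} {b : W ⟶ X} {a : W' ⟶ X} {c : W'' ⟶ X} (f : W ⟶ W')
    (h : f ≫ a = b) (g : W' ⟶ W'') (h' : g ≫ c = a) :
    ofObj.homMk f h ≫ ofObj.homMk g h' =
      ofObj.homMk (f ≫ g) (by rw [Category.assoc, h', h]) := rfl

theorem ofObj.homMk_id {W : 𝒮} {b : W ⟶ X} (h : 𝟙 W ≫ b = b) :
    ofObj.homMk (𝟙 W) h = 𝟙 (ofObj.mk b) := rfl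

theorem inducedHom_eq {V U : 𝒮} {K : BasedFunctor (ofObj V) (ofObj U)} {k : V ⟶ U}
    (h : K.obj (ofObj.mk (𝟙 V)) = ofObj.mk k) : inducedHom K = k := by
  unfold inducedHom
  -- With a variable A in place of the image of `𝟙 V`, the equality can be substituted and the
  -- `eqToHom` disappears.
  have : ∀ (A : (ofObj U).obj) (h : A = ofObj.mk k) (h' : V = (ofObj U).p.obj A),
      eqToHom h' ≫ Comma.hom (show Over U from A) = k := by
    rintro A rfl h'
    exact Category.id_comp _
  exact this _ h _

end OfObj

end CategoryTheory.BasedCategory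

namespace CategoryTheory.BasedFunctor

open BasedCategory

variable {𝒮 : Type u₀} [Category.{v₀} 𝒮] {𝒳 : BasedCategory.{v₂, u₂} 𝒮} {X : 𝒮}
  (x : BasedFunctor (ofObj X) 𝒳)

/-- The object over `W` that a family `x` over `X` assigns to an arrow `a : W ⟶ X`. -/
abbrev fam {W : 𝒮} (a : W ⟶ X) : 𝒳.obj := x.obj (ofObj.mk a)

/-- The arrow between pullbacks of the family given by a commutative triangle. -/
abbrev restr {W W' : 𝒮} {b : W ⟶ X} {a : W' ⟶ X} (f : W ⟶ W') (h : f ≫ a = b) :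
    x.fam b ⟶ x.fam a := x.map (ofObj.homMk f h)

theorem isHomLift_restr {W W' : 𝒮} {b : W ⟶ X} {a : W' ⟶ X} (f : W ⟶ W') (h : f ≫ a = b) :
    𝒳.p.IsHomLift f (x.restr f h) := inferInstance

theorem restr_comp {W W' W'' : 𝒮} {b : W ⟶ X} {a : W' ⟶ X} {c : W'' ⟶ X} (f : W ⟶ W')
    (h : f ≫ a = b) (g : W' ⟶ W'') (h' : g ≫ c = a) :
    x.restr f h ≫ x.restr g h' = x.restr (f ≫ g) (by rw [Category.assoc, h', h]) := by
  rw [← x.map_comp, ofObj.homMk_comp]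

theorem restr_id {W : 𝒮} {b : W ⟶ X} (h : 𝟙 W ≫ b = b) : x.restr (𝟙 W) h = 𝟙 (x.fam b) := by
  rw [restr, ofObj.homMk_id, x.map_id]

theorem p_obj_fam {W : 𝒮} (a : W ⟶ X) : 𝒳.p.obj (x.fam a) = W := x.w_obj (ofObj.mk a)

end CategoryTheory.BasedFunctor

/-! ### Universal points of fiber products -/

namespace CategoryTheory.BasedCategory

variable {𝒮 : Type u₀} [Category.{v₀} 𝒮]

theorem IsIsomorphism.isEquivalence {𝒳 : BasedCategory.{v₂, u₂} 𝒮} {𝒴 : BasedCategory.{v₃, u₃} 𝒮}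
    {f : BasedFunctor 𝒳 𝒴} (h : IsIsomorphism f) : f.toFunctor.IsEquivalence := by
  obtain ⟨g, ⟨i⟩, ⟨j⟩⟩ := h
  have i' : g.toFunctor ⋙ f.toFunctor ≅ 𝟭 𝒴.obj := (BasedNatTrans.forgetful 𝒴 𝒴).mapIso i
  have j' : f.toFunctor ⋙ g.toFunctor ≅ 𝟭 𝒳.obj := (BasedNatTrans.forgetful 𝒳 𝒳).mapIso j
  exact (CategoryTheory.Equivalence.mk f.toFunctor g.toFunctor j'.symm i').isEquivalence_functor

/-- The universal point of a fibration isomorphic to an object of `𝒮` is terminal. -/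
theorem IsIsomorphism.isTerminal {V : 𝒮} {𝒴 : BasedCategory.{v₃, u₃} 𝒮}
    {e : BasedFunctor (ofObj V) 𝒴} (h : IsIsomorphism e) :
    Nonempty (Limits.IsTerminal (e.obj (ofObj.mk (𝟙 V)))) := by
  have := h.isEquivalence
  have ht : Limits.IsTerminal (ofObj.mk (𝟙 V)) := Over.mkIdTerminal (X := V)
  exact ⟨ht.isTerminalObj e.toFunctor _⟩

variable {𝒴 : BasedCategory.{v₂, u₂} 𝒮} {X S : 𝒮} {x : BasedFunctor (ofObj X) 𝒴}
  {y : BasedFunctor (ofObj S) 𝒴}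

/-- The object of the fiber product given by arrows `b : W ⟶ X`, `c : W ⟶ S` and an isomorphism
over the identity of `W`. -/
def FiberProductObj.ofArrows {W : 𝒮} (b : W ⟶ X) (c : W ⟶ S) (φ : x.fam b ≅ y.fam c)
    (hφ : 𝒴.p.IsHomLift (𝟙 W) φ.hom) : FiberProductObj x y where
  left := ofObj.mk b
  right := ofObj.mk c
  base_eq := rfl
  iso := φ
  isHomLift := hφ

/-- Eliminates the equalities between base objects once and for all: what remains of an object over
W is a pair of arrows out of W and an isomorphism. -/
theorem FiberProductObj.exists_eq_ofArrows {W : 𝒮} {A : FiberProductObj x y}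
    (h : (ofObj X).p.obj A.left = W) : ∃ (b : W ⟶ X) (c : W ⟶ S) (φ : x.fam b ≅ y.fam c)
      (hφ : 𝒴.p.IsHomLift (𝟙 W) φ.hom), A = .ofArrows b c φ hφ := by
  obtain ⟨l, r, h1, φ, hφ⟩ := A
  obtain ⟨b, rfl⟩ := ofObj.exists_eq_mk h
  obtain ⟨c, rfl⟩ := ofObj.exists_eq_mk h1
  exact ⟨b, c, φ, hφ, rfl⟩

/-- The compatibility satisfied by the arrow of `𝒮` under a morphism of the fiber product. -/
theorem FiberProductHom.compat {W V : 𝒮} {b : W ⟶ X} {c : W ⟶ S} {φ : x.fam b ≅ y.fam c}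
    {hφ : 𝒴.p.IsHomLift (𝟙 W) φ.hom} {b' : V ⟶ X} {c' : V ⟶ S} {φ' : x.fam b' ≅ y.fam c'}
    {hφ' : 𝒴.p.IsHomLift (𝟙 V) φ'.hom}
    (m : FiberProductObj.ofArrows b c φ hφ ⟶ FiberProductObj.ofArrows b' c' φ' hφ') {f : W ⟶ V}
    (hf : (ofObj X).p.map (FiberProductHom.left m) = f) :
    ∃ (h : f ≫ b' = b) (h' : f ≫ c' = c),
      x.restr f h ≫ φ'.hom = φ.hom ≫ y.restr f h' := by
  obtain ⟨l, r, h1, h2⟩ := m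
  change ofObj.mk b ⟶ ofObj.mk b' at l
  change ofObj.mk c ⟶ ofObj.mk c' at r
  obtain ⟨f, hl, rfl⟩ := ofObj.exists_eq_homMk l
  obtain ⟨g, hr, rfl⟩ := ofObj.exists_eq_homMk r
  subst hf
  obtain rfl : f = g := eq_of_isHomLift (φ := ofObj.homMk g hr) h1 inferInstance
  exact ⟨hl, hr, h2⟩

/-- The universal property of a terminal object of the fiber product, in terms of arrows. -/
theorem FiberProductObj.existsUnique_of_isTerminal {V : 𝒮} {a : V ⟶ X} {s : V ⟶ S}
    {Φ : x.fam a ≅ y.fam s} {hΦ : 𝒴.p.IsHomLift (𝟙 V) Φ.hom}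
    (ht : Limits.IsTerminal (FiberProductObj.ofArrows a s Φ hΦ)) {W : 𝒮} (b : W ⟶ X) (c : W ⟶ S)
    (φ : x.fam b ≅ y.fam c) (hφ : 𝒴.p.IsHomLift (𝟙 W) φ.hom) :
    ∃! f : W ⟶ V, ∃ (h : f ≫ a = b) (h' : f ≫ s = c),
      x.restr f h ≫ Φ.hom = φ.hom ≫ y.restr f h' := by
  refine ⟨_, FiberProductHom.compat (ht.from (FiberProductObj.ofArrows b c φ hφ)) rfl, ?_⟩
  rintro f ⟨h, h', hf⟩
  let m : FiberProductObj.ofArrows b c φ hφ ⟶ FiberProductObj.ofArrows a s Φ hΦ :=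
    { left := ofObj.homMk f h
      right := ofObj.homMk f h'
      isHomLift := IsHomLift.map (ofObj S).p (ofObj.homMk f h')
      comm := hf }
  have := ht.hom_ext m (ht.from _)
  rw [← this]
  rfl

/-- An object of `𝒮` representing a fiber product carries a universal pair of arrows. -/
theorem exists_universal_of_isIsomorphism {V : 𝒮} {e : BasedFunctor (ofObj V) (fiberProduct x y)}
    (he : IsIsomorphism e) : ∃ (Φ : x.fam (inducedHom (e.comp (fiberProduct.fst x y))) ≅
        y.fam (inducedHom (e.comp (fiberProduct.snd x y))))
      (hΦ : 𝒴.p.IsHomLift (𝟙 V) Φ.hom),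
      e.obj (ofObj.mk (𝟙 V)) = FiberProductObj.ofArrows _ _ Φ hΦ ∧
      ∀ {W : 𝒮} (b : W ⟶ X) (c : W ⟶ S)
        (φ : x.fam b ≅ y.fam c), 𝒴.p.IsHomLift (𝟙 W) φ.hom →
        ∃! f : W ⟶ V, ∃ (h : f ≫ inducedHom (e.comp (fiberProduct.fst x y)) = b)
          (h' : f ≫ inducedHom (e.comp (fiberProduct.snd x y)) = c),
          x.restr f h ≫ Φ.hom = φ.hom ≫ y.restr f h' := by
  obtain ⟨ht⟩ := he.isTerminal
  obtain ⟨a, s, Φ, hΦ, hA⟩ := FiberProductObj.exists_eq_ofArrows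
    (A := e.obj (ofObj.mk (𝟙 V))) (W := V) (e.w_obj (ofObj.mk (𝟙 V)))
  have h1 : inducedHom (e.comp (fiberProduct.fst x y)) = a :=
    inducedHom_eq (congrArg FiberProductObj.left hA)
  have h2 : inducedHom (e.comp (fiberProduct.snd x y)) = s :=
    inducedHom_eq (congrArg FiberProductObj.right hA)
  rw [h1, h2]
  refine ⟨Φ, hΦ, hA, fun b c φ hφ => ?_⟩
  rw [hA] at ht
  exact FiberProductObj.existsUnique_of_isTerminal ht b c φ hφ

end CategoryTheory.BasedCategory

/-! ### The groupoid Isom(x, x) through its W-valued points -/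

namespace CategoryTheory.BasedCategory

variable {𝒮 : Type u₀} [Category.{v₀} 𝒮] {𝒳 : BasedCategory.{v₂, u₂} 𝒮} {X G : 𝒮}

/-- A universal isomorphism between two pullbacks of the family `x`: it exhibits `G` as the object
of `𝒮` representing `Isom(x, x)`, with projections `src` and `tgt`. -/
structure UniversalIsom (x : BasedFunctor (ofObj X) 𝒳) (src tgt : G ⟶ X) where
  hom : x.fam src ⟶ x.fam tgt
  isHomLift : 𝒳.p.IsHomLift (𝟙 G) hom
  existsUnique : ∀ {W : 𝒮} (b c : W ⟶ X) (φ : x.fam b ⟶ x.fam c), 𝒳.p.IsHomLift (𝟙 W) φ →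
    ∃! g : W ⟶ G, ∃ (h : g ≫ src = b) (h' : g ≫ tgt = c),
      x.restr g h ≫ hom = φ ≫ x.restr g h'

/-- The pullback of an arrow over the identity. -/
theorem IsGroupoidFibration.exists_restrict (h𝒳 : IsGroupoidFibration 𝒳)
    {x : BasedFunctor (ofObj X) 𝒳} {W W' : 𝒮} {b c : W ⟶ X} {φ : x.fam b ⟶ x.fam c}
    (hφ : 𝒳.p.IsHomLift (𝟙 W) φ) (k : W' ⟶ W) {b' c' : W' ⟶ X} (hb : k ≫ b = b')
    (hc : k ≫ c = c') : ∃ φ' : x.fam b' ⟶ x.fam c', 𝒳.p.IsHomLift (𝟙 W') φ' ∧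
      φ' ≫ x.restr k hc = x.restr k hb ≫ φ :=
  h𝒳.exists_lift (x.isHomLift_restr k hc)
    (isHomLift_comp (x.isHomLift_restr k hb) hφ (Category.comp_id k)) (Category.id_comp k)

namespace UniversalIsom

variable {x : BasedFunctor (ofObj X) 𝒳} {src tgt : G ⟶ X} (D : UniversalIsom x src tgt)

/-- The `W`-valued point `g` of `G` represents the isomorphism `φ`. -/
def Rep {W : 𝒮} (g : W ⟶ G) {b c : W ⟶ X} (φ : x.fam b ⟶ x.fam c) : Prop :=
  𝒳.p.IsHomLift (𝟙 W) φ ∧ ∃ (h : g ≫ src = b) (h' : g ≫ tgt = c),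
    x.restr g h ≫ D.hom = φ ≫ x.restr g h'

variable {D}

theorem rep_id : D.Rep (𝟙 G) D.hom :=
  ⟨D.isHomLift, Category.id_comp _, Category.id_comp _, by
    rw [x.restr_id, x.restr_id, Category.id_comp, Category.comp_id]⟩

theorem Rep.src_eq {W : 𝒮} {g : W ⟶ G} {b c : W ⟶ X} {φ : x.fam b ⟶ x.fam c} (h : D.Rep g φ) :
    g ≫ src = b := h.2.1

theorem Rep.tgt_eq {W : 𝒮} {g : W ⟶ G} {b c : W ⟶ X} {φ : x.fam b ⟶ x.fam c} (h : D.Rep g φ) :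
    g ≫ tgt = c := h.2.2.1

theorem exists_rep {W : 𝒮} {b c : W ⟶ X} {φ : x.fam b ⟶ x.fam c}
    (hφ : 𝒳.p.IsHomLift (𝟙 W) φ) : ∃ g : W ⟶ G, D.Rep g φ :=
  (D.existsUnique b c φ hφ).exists.imp fun _ h => ⟨hφ, h⟩

theorem Rep.unique {W : 𝒮} {g g' : W ⟶ G} {b c : W ⟶ X} {φ : x.fam b ⟶ x.fam c} (h : D.Rep g φ)
    (h' : D.Rep g' φ) : g = g' :=
  (D.existsUnique b c φ h.1).unique h.2 h'.2

/-- The arrow is the factorization of a composite determined by g through a cartesian arrow, so it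
can be recovered from g. -/
theorem Rep.hom_unique (h𝒳 : IsGroupoidFibration 𝒳) {W : 𝒮} {g : W ⟶ G} {b c : W ⟶ X}
    {φ φ' : x.fam b ⟶ x.fam c} (h : D.Rep g φ) (h' : D.Rep g φ') : φ = φ' := by
  obtain ⟨h1, h2, h3, h4⟩ := h
  obtain ⟨h1', h2', h3', h4'⟩ := h'
  exact h𝒳.lift_ext_of_isHomLift (h4.symm.trans h4') h1 h1'

theorem Rep.restrict {W W' : 𝒮} {g : W ⟶ G} {b c : W ⟶ X} {φ : x.fam b ⟶ x.fam c}
    (h : D.Rep g φ) {k : W' ⟶ W} {b' c' : W' ⟶ X} {hb : k ≫ b = b'} {hc : k ≫ c = c'}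
    {φ' : x.fam b' ⟶ x.fam c'} (hφ' : 𝒳.p.IsHomLift (𝟙 W') φ')
    (hk : φ' ≫ x.restr k hc = x.restr k hb ≫ φ) : D.Rep (k ≫ g) φ' := by
  obtain ⟨h1, h2, h3, h4⟩ := h
  refine ⟨hφ', by rw [Category.assoc, h2, hb], by rw [Category.assoc, h3, hc], ?_⟩
  rw [← x.restr_comp k hb g h2, ← x.restr_comp k hc g h3, Category.assoc, h4, ← Category.assoc,
    ← hk, Category.assoc]

theorem exists_rep_of_arrow (h𝒳 : IsGroupoidFibration 𝒳) {W : 𝒮} (g : W ⟶ G) {b c : W ⟶ X}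
    (hb : g ≫ src = b) (hc : g ≫ tgt = c) : ∃ φ : x.fam b ⟶ x.fam c, D.Rep g φ := by
  obtain ⟨φ, h1, h2⟩ := h𝒳.exists_restrict D.isHomLift g hb hc
  refine ⟨φ, ?_⟩
  have := rep_id.restrict (D := D) h1 h2
  rwa [Category.comp_id] at this

variable (D) in
/-- `k` is the product of the composable points `g` and `h`. -/
def IsMul {W : 𝒮} (g h k : W ⟶ G) : Prop :=
  ∃ (b c d : W ⟶ X) (φ : x.fam b ⟶ x.fam c) (ψ : x.fam c ⟶ x.fam d),
    D.Rep g φ ∧ D.Rep h ψ ∧ D.Rep k (φ ≫ ψ)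

theorem IsMul.rep (h𝒳 : IsGroupoidFibration 𝒳) {W : 𝒮} {g h k : W ⟶ G} (H : D.IsMul g h k)
    {b c d : W ⟶ X} {φ : x.fam b ⟶ x.fam c} {ψ : x.fam c ⟶ x.fam d} (hg : D.Rep g φ)
    (hh : D.Rep h ψ) : D.Rep k (φ ≫ ψ) := by
  obtain ⟨b', c', d', φ', ψ', hg', hh', hk⟩ := H
  obtain rfl := hg.src_eq.symm.trans hg'.src_eq
  obtain rfl := hg.tgt_eq.symm.trans hg'.tgt_eq
  obtain rfl := hh.tgt_eq.symm.trans hh'.tgt_eq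
  rwa [hg.hom_unique h𝒳 hg', hh.hom_unique h𝒳 hh']

/-- Compose the represented isomorphisms and represent the result. The product is thereby an arrow
of the base category, so for manifolds it is smooth without a manifold of composable pairs being
formed. -/
theorem exists_isMul (h𝒳 : IsGroupoidFibration 𝒳) {W : 𝒮} {g h : W ⟶ G}
    (H : g ≫ tgt = h ≫ src) : ∃ k, D.IsMul g h k := by
  obtain ⟨φ, hφ⟩ := D.exists_rep_of_arrow h𝒳 g rfl H
  obtain ⟨ψ, hψ⟩ := D.exists_rep_of_arrow h𝒳 h rfl rfl
  have := hφ.1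
  have := hψ.1
  obtain ⟨k, hk⟩ := exists_rep (D := D) (φ := φ ≫ ψ) inferInstance
  exact ⟨k, _, _, _, φ, ψ, hφ, hψ, hk⟩

theorem IsMul.unique (h𝒳 : IsGroupoidFibration 𝒳) {W : 𝒮} {g h k k' : W ⟶ G} (H : D.IsMul g h k)
    (H' : D.IsMul g h k') : k = k' := by
  obtain ⟨b, c, d, φ, ψ, hg, hh, hk⟩ := H
  exact hk.unique (H'.rep h𝒳 hg hh)

theorem IsMul.restrict (h𝒳 : IsGroupoidFibration 𝒳) {W W' : 𝒮} {g h k : W ⟶ G}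
    (H : D.IsMul g h k) (f : W' ⟶ W) : D.IsMul (f ≫ g) (f ≫ h) (f ≫ k) := by
  obtain ⟨b, c, d, φ, ψ, hg, hh, hk⟩ := H
  obtain ⟨φ', h1, h2⟩ := h𝒳.exists_restrict hg.1 f rfl rfl
  obtain ⟨ψ', h3, h4⟩ := h𝒳.exists_restrict hh.1 f rfl rfl
  refine ⟨_, _, _, φ', ψ', hg.restrict h1 h2, hh.restrict h3 h4, hk.restrict (hb := rfl)
    (hc := rfl) inferInstance ?_⟩
  rw [Category.assoc, h4, ← Category.assoc, h2, Category.assoc]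

theorem IsMul.src_eq {W : 𝒮} {g h k : W ⟶ G} (H : D.IsMul g h k) : k ≫ src = g ≫ src := by
  obtain ⟨b, c, d, φ, ψ, hg, hh, hk⟩ := H
  rw [hk.src_eq, hg.src_eq]

theorem IsMul.tgt_eq {W : 𝒮} {g h k : W ⟶ G} (H : D.IsMul g h k) : k ≫ tgt = h ≫ tgt := by
  obtain ⟨b, c, d, φ, ψ, hg, hh, hk⟩ := H
  rw [hk.tgt_eq, hh.tgt_eq]

theorem IsMul.assoc (h𝒳 : IsGroupoidFibration 𝒳) {W : 𝒮} {g h k l m n : W ⟶ G}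
    (H₁ : D.IsMul g h k) (H₂ : D.IsMul k l m) (H₃ : D.IsMul h l n) : D.IsMul g n m := by
  obtain ⟨b, c, d, φ, ψ, hg, hh, hk⟩ := H₁
  have hl : l ≫ src = d := by
    obtain ⟨_, _, _, _, _, h1, h2, _⟩ := H₂
    rw [h2.src_eq, ← h1.tgt_eq, hk.tgt_eq]
  obtain ⟨χ, hχ⟩ := D.exists_rep_of_arrow h𝒳 l hl rfl
  have hm := H₂.rep h𝒳 hk hχ
  rw [Category.assoc] at hm
  exact ⟨_, _, _, φ, ψ ≫ χ, hg, H₃.rep h𝒳 hh hχ, hm⟩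

/-- The unit of `Isom(x, x)`. -/
theorem exists_one : ∃ one : X ⟶ G, ∀ {W : 𝒮} (b : W ⟶ X),
    D.Rep (b ≫ one) (𝟙 (x.fam b)) := by
  obtain ⟨one, h⟩ := exists_rep (D := D) (φ := 𝟙 (x.fam (𝟙 X))) (IsHomLift.id (x.p_obj_fam _))
  refine ⟨one, fun b => h.restrict (hb := Category.comp_id b) (hc := Category.comp_id b)
    (IsHomLift.id (x.p_obj_fam _)) ?_⟩
  rw [Category.id_comp, Category.comp_id]

/-- The inversion of `Isom(x, x)`. -/
theorem exists_inv (h𝒳 : IsGroupoidFibration 𝒳) : ∃ i : G ⟶ G, ∀ {W : 𝒮} {g : W ⟶ G}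
    {b c : W ⟶ X} {φ : x.fam b ⟶ x.fam c} {ψ : x.fam c ⟶ x.fam b}, D.Rep g φ → φ ≫ ψ = 𝟙 _ →
      D.Rep (g ≫ i) ψ := by
  have := D.isHomLift
  have := h𝒳.isIso_of_isHomLift_id D.isHomLift
  obtain ⟨i, hi⟩ := exists_rep (D := D) (φ := inv D.hom) inferInstance
  refine ⟨i, fun {W g b c φ ψ} h hψ => ?_⟩
  obtain ⟨h1, h2, h3, h4⟩ := h
  have := h𝒳.isIso_of_isHomLift_id h1
  obtain rfl : ψ = inv φ := by rw [← cancel_epi φ, hψ, IsIso.hom_inv_id]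
  refine hi.restrict (hb := h3) (hc := h2) inferInstance ?_
  rw [IsIso.inv_comp_eq, ← Category.assoc, ← h4, Category.assoc, IsIso.hom_inv_id,
    Category.comp_id]

end UniversalIsom

/-- An isomorphism from an object of `𝒮` to `Isom(x, x)` defines a universal isomorphism. -/
theorem exists_universalIsom {V : 𝒮} {x : BasedFunctor (ofObj X) 𝒳} (h𝒳 : IsGroupoidFibration 𝒳)
    {e : BasedFunctor (ofObj V) (fiberProduct x x)} (he : IsIsomorphism e) :
    ∃ D : UniversalIsom x (inducedHom (e.comp (fiberProduct.fst x x)))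
      (inducedHom (e.comp (fiberProduct.snd x x))),
      ∀ {W : 𝒮} (g : W ⟶ V), ∃ (b c : W ⟶ X) (φ : x.fam b ≅ x.fam c)
        (hφ : 𝒳.p.IsHomLift (𝟙 W) φ.hom),
        e.obj (ofObj.mk g) = FiberProductObj.ofArrows b c φ hφ ∧ D.Rep g φ.hom := by
  obtain ⟨Φ, hΦ, hA, h⟩ := exists_universal_of_isIsomorphism he
  let D : UniversalIsom x (inducedHom (e.comp (fiberProduct.fst x x)))
      (inducedHom (e.comp (fiberProduct.snd x x))) :=
    { hom := Φ.hom
      isHomLift := hΦ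
      existsUnique := fun b c φ hφ => by
        have := h𝒳.isIso_of_isHomLift_id hφ
        exact h b c (asIso φ) hφ }
  refine ⟨D, fun {W} g => ?_⟩
  obtain ⟨b, c, φ, hφ, hB⟩ := FiberProductObj.exists_eq_ofArrows
    (A := e.obj (ofObj.mk g)) (W := W) (e.w_obj (ofObj.mk g))
  refine ⟨b, c, φ, hφ, hB, hφ, ?_⟩
  -- The functor e sends the arrow from g to `𝟙 V` to a morphism of the fiber product, and its
  -- compatibility says that g represents φ. The objects are variables so that `hB` and `hA` can be
  -- substituted.
  have key : ∀ (A B : FiberProductObj x x) (m : A ⟶ B), (fiberProductProj x x).IsHomLift g m →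
      A = FiberProductObj.ofArrows b c φ hφ → B = FiberProductObj.ofArrows _ _ Φ hΦ →
      ∃ (h : g ≫ _ = b) (h' : g ≫ _ = c), x.restr g h ≫ Φ.hom = φ.hom ≫ x.restr g h' := by
    rintro _ _ m hm rfl rfl
    exact FiberProductHom.compat m (eq_of_isHomLift (𝒳 := fiberProduct x x) (φ := m)
      (IsHomLift.map _ _) hm)
  refine key _ _ (e.map (ofObj.homMk g (Category.comp_id g))) ?_ hB hA
  exact BasedFunctor.preserves_isHomLift e g (ofObj.homMk g (Category.comp_id g))

end CategoryTheory.BasedCategory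

/-! ### From the represented groupoid to a Lie groupoid -/

section

namespace Mfd

/-- The manifold with one point. -/
noncomputable abbrev pt : Mfd.{u} := ofVec PUnit.{u + 1}

/-- The map from the one-point manifold with the given value. -/
noncomputable def point {W : Mfd.{u}} (w : W) : pt.{u} ⟶ W :=
  SmoothMap.mk (fun _ => w) (isSmooth_iff.2 fun _ => smoothAt_const _ _)

@[simp]
theorem point_comp {W W' : Mfd.{u}} (w : W) (f : W ⟶ W') : point w ≫ f = point (f w) := rfl

theorem eq_point {W : Mfd.{u}} (f : pt.{u} ⟶ W) : f = point (f PUnit.unit) :=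
  hom_ext fun _ => rfl

theorem point_injective {W : Mfd.{u}} {w w' : W} (h : point w = point w') : w = w' :=
  congrArg (fun f : pt.{u} ⟶ W => f PUnit.unit) h

end Mfd

open CategoryTheory.BasedCategory

variable {𝔛 : BasedCategory.{v₁, u₁} Mfd.{u}} {X : Mfd.{u}} {x : BasedFunctor (ofObj X) 𝔛}

/-- The product of `Γ` corresponds to the composition of isomorphisms. -/
def LieGroupoid.IsCompatible (Γ : LieGroupoid X) (D : UniversalIsom x Γ.src Γ.tgt) : Prop :=
  ∀ {W : Mfd.{u}} (g h : W ⟶ Γ.arr) (hgh : ∀ w : W, Γ.tgt (g w) = Γ.src (h w)) {b c d : W ⟶ X}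
    {φ : x.fam b ⟶ x.fam c} {ψ : x.fam c ⟶ x.fam d}, D.Rep g φ → D.Rep h ψ →
    D.Rep (Γ.mulHom g h hgh) (φ ≫ ψ)

theorem ofObj_eq_of_isHomLift_id {W : Mfd.{u}} {b c : W ⟶ X} {r : ofObj.mk b ⟶ ofObj.mk c}
    (h : (ofObj X).p.IsHomLift (𝟙 W) r) : b = c := by
  obtain ⟨f, hf, rfl⟩ := ofObj.exists_eq_homMk r
  have hf' : f = 𝟙 W := eq_of_isHomLift (φ := ofObj.homMk f hf) inferInstance h
  rw [← hf, hf', Category.id_comp]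

theorem map_eq_id_of_isHomLift_id {W : Mfd.{u}} {b : W ⟶ X} {r : ofObj.mk b ⟶ ofObj.mk b}
    (h : (ofObj X).p.IsHomLift (𝟙 W) r) : x.map r = 𝟙 _ := by
  rw [ofObj.hom_ext_of_isHomLift h (g := 𝟙 _) (IsHomLift.id rfl), x.map_id]

/-- The compatibility of the product with the composition of isomorphisms, in terms of a
representation `e` of `Isom(x, x)`. -/
theorem LieGroupoid.isCompatible_iff (h𝔛 : IsGroupoidFibration 𝔛) {Γ : LieGroupoid X}
    {D : UniversalIsom x Γ.src Γ.tgt} {e : BasedFunctor (ofObj Γ.arr) (fiberProduct x x)}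
    (he : ∀ {W : Mfd.{u}} (g : W ⟶ Γ.arr), ∃ (b c : W ⟶ X) (φ : x.fam b ≅ x.fam c)
        (hφ : 𝔛.p.IsHomLift (𝟙 W) φ.hom),
        e.obj (ofObj.mk g) = FiberProductObj.ofArrows b c φ hφ ∧ D.Rep g φ.hom) :
    Γ.IsCompatible D ↔
    ∀ (W : Mfd.{u}) (g h : W ⟶ Γ.arr) (hgh : ∀ w : W, Γ.tgt (g w) = Γ.src (h w))
      (A B C : FiberProductObj x x), A = e.obj (ofObj.mk g) → B = e.obj (ofObj.mk h) →
      C = e.obj (ofObj.mk (Γ.mulHom g h hgh)) →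
      ∀ (r₁ : C.left ⟶ A.left) (r₂ : A.right ⟶ B.left) (r₃ : B.right ⟶ C.right),
        (ofObj X).p.IsHomLift (𝟙 W) r₁ → (ofObj X).p.IsHomLift (𝟙 W) r₂ →
        (ofObj X).p.IsHomLift (𝟙 W) r₃ →
        C.iso.hom = x.map r₁ ≫ A.iso.hom ≫ x.map r₂ ≫ B.iso.hom ≫ x.map r₃ := by
  constructor
  · intro H W g h hgh A B C hA hB hC r₁ r₂ r₃ hr₁ hr₂ hr₃
    obtain ⟨b, c, φ, hφ, hg, hg'⟩ := he g
    obtain ⟨b', c', φ', hφ', hh, hh'⟩ := he h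
    obtain ⟨b'', c'', φ'', hφ'', hk, hk'⟩ := he (Γ.mulHom g h hgh)
    obtain rfl := hA.trans hg
    obtain rfl := hB.trans hh
    obtain rfl := hC.trans hk
    obtain rfl := ofObj_eq_of_isHomLift_id hr₁
    obtain rfl := ofObj_eq_of_isHomLift_id hr₂
    obtain rfl := ofObj_eq_of_isHomLift_id hr₃
    have h1 := (H g h hgh hg' hh').hom_unique h𝔛 hk'
    have e1 := map_eq_id_of_isHomLift_id (x := x) hr₁
    have e2 := map_eq_id_of_isHomLift_id (x := x) hr₂
    have e3 := map_eq_id_of_isHomLift_id (x := x) hr₃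
    have h2 : φ''.hom = 𝟙 (x.fam b'') ≫ φ.hom ≫ 𝟙 (x.fam c) ≫ φ'.hom ≫ 𝟙 (x.fam c') := by
      rw [Category.id_comp, Category.id_comp, Category.comp_id, h1]
    rw [← e1, ← e2, ← e3] at h2
    exact h2
  · intro H W g h hgh b c d φ ψ hg hh
    obtain ⟨b₁, c₁, φ₁, hφ₁, hg₁, hg₁'⟩ := he g
    obtain ⟨b₂, c₂, φ₂, hφ₂, hh₂, hh₂'⟩ := he h
    obtain ⟨b₃, c₃, φ₃, hφ₃, hk₃, hk₃'⟩ := he (Γ.mulHom g h hgh)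
    obtain rfl := hg.src_eq.symm.trans hg₁'.src_eq
    obtain rfl := hg.tgt_eq.symm.trans hg₁'.tgt_eq
    obtain rfl := hh.src_eq.symm.trans hh₂'.src_eq
    obtain rfl := hh.tgt_eq.symm.trans hh₂'.tgt_eq
    have hb : b = b₃ := by
      rw [← hk₃'.src_eq, ← hg.src_eq]
      exact Mfd.hom_ext fun w => (Γ.src_mul _ _ _).symm
    have hd : d = c₃ := by
      rw [← hk₃'.tgt_eq, ← hh.tgt_eq]
      exact Mfd.hom_ext fun w => (Γ.tgt_mul _ _ _).symm
    subst hb hd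
    have h1 := H W g h hgh _ _ _ hg₁.symm hh₂.symm hk₃.symm (𝟙 _) (𝟙 _) (𝟙 _)
      (IsHomLift.id rfl) (IsHomLift.id rfl) (IsHomLift.id rfl)
    have h2 : φ₃.hom = x.map (𝟙 (ofObj.mk b)) ≫ φ₁.hom ≫ x.map (𝟙 (ofObj.mk c)) ≫ φ₂.hom ≫
      x.map (𝟙 (ofObj.mk d)) := h1
    rw [x.map_id, x.map_id, x.map_id, Category.id_comp, Category.id_comp, Category.comp_id] at h2
    rw [hg.hom_unique h𝔛 hg₁', hh.hom_unique h𝔛 hh₂', ← h2]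
    exact hk₃'

/-- If `Isom(x, x)` is represented by a manifold with submersive second projection, then it is
represented by a Lie groupoid. -/
theorem exists_isSymmetryGroupoid (h𝔛 : IsGroupoidFibration 𝔛) {G : Mfd.{u}}
    {e : BasedFunctor (ofObj G) (fiberProduct x x)} (he : IsIsomorphism e)
    (htgt : Mfd.IsSubmersion (inducedHom (e.comp (fiberProduct.snd x x)))) :
    ∃ Γ : LieGroupoid X, IsSymmetryGroupoid x Γ := by
  obtain ⟨D, hD⟩ := exists_universalIsom h𝔛 he
  let src := inducedHom (e.comp (fiberProduct.fst x x))
  let tgt := inducedHom (e.comp (fiberProduct.snd x x))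
  obtain ⟨one, hone⟩ := UniversalIsom.exists_one (D := D)
  obtain ⟨i, hi⟩ := UniversalIsom.exists_inv (D := D) h𝔛
  have happ : ∀ {A B : Mfd.{u}} {f g : A ⟶ B}, f = g → ∀ a, f a = g a := by
    rintro A B f g rfl a; rfl
  have hone_src : one ≫ src = 𝟙 X := by
    have := (hone (𝟙 X)).src_eq; rwa [Category.id_comp] at this
  have hone_tgt : one ≫ tgt = 𝟙 X := by
    have := (hone (𝟙 X)).tgt_eq; rwa [Category.id_comp] at this
  have := h𝔛.isIso_of_isHomLift_id D.isHomLift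
  have hirep : D.Rep i (inv D.hom) := by
    have := hi UniversalIsom.rep_id (ψ := inv D.hom) (IsIso.hom_inv_id _)
    rwa [Category.id_comp] at this
  -- Inverting twice gives back the universal isomorphism. So i is a diffeomorphism, and the source,
  -- being i followed by the target, inherits the submersion property assumed for the target.
  have hii : i ≫ i = 𝟙 G := (hi hirep (IsIso.inv_hom_id _)).unique UniversalIsom.rep_id
  have hsrc : Mfd.IsSubmersion src := by
    have : IsIso i := ⟨i, hii, hii⟩
    have h := (Mfd.isEtale_of_isIso i).isSubmersion.comp htgt
    rwa [hirep.tgt_eq] at h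
  -- Products of single arrows are taken over the one-point manifold. `hmulW` identifies them with
  -- the values of products of W-valued points, which yields smoothness and the unit and inverse
  -- laws.
  have hmul : ∀ γ δ : G, tgt γ = src δ → ∃ ε : G,
      D.IsMul (Mfd.point γ) (Mfd.point δ) (Mfd.point ε) := by
    intro γ δ h
    obtain ⟨k, hk⟩ := UniversalIsom.exists_isMul (D := D) h𝔛 (g := Mfd.point γ)
      (h := Mfd.point δ) (by rw [Mfd.point_comp, Mfd.point_comp, h])
    exact ⟨k PUnit.unit, by rwa [← Mfd.eq_point]⟩
  choose mul hmul using hmul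
  have hmulW : ∀ {W : Mfd.{u}} {g h k : W ⟶ G}, D.IsMul g h k →
      ∀ (w : W) (H : tgt (g w) = src (h w)), mul (g w) (h w) H = k w := by
    intro W g h k hk w H
    have := hk.restrict h𝔛 (Mfd.point w)
    simp only [Mfd.point_comp] at this
    exact Mfd.point_injective ((hmul _ _ H).unique h𝔛 this)
  have hmul_src : ∀ (γ δ : G) (h : tgt γ = src δ), src (mul γ δ h) = src γ := fun γ δ h =>
    Mfd.point_injective (hmul γ δ h).src_eq
  have hmul_tgt : ∀ (γ δ : G) (h : tgt γ = src δ), tgt (mul γ δ h) = tgt δ := fun γ δ h =>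
    Mfd.point_injective (hmul γ δ h).tgt_eq
  let Γ : LieGroupoid X :=
    { arr := G
      src := src
      tgt := tgt
      src_submersion := hsrc
      tgt_submersion := htgt
      mul := mul
      src_mul := hmul_src
      tgt_mul := hmul_tgt
      mul_assoc := fun γ δ ε h₁ h₂ => Mfd.point_injective
        (((hmul γ δ h₁).assoc h𝔛 (hmul _ _ _) (hmul δ ε h₂)).unique h𝔛 (hmul _ _ _))
      smooth_mul := fun W a b h => by
        obtain ⟨k, hk⟩ := UniversalIsom.exists_isMul (D := D) h𝔛 (g := a) (h := b)
          (Mfd.hom_ext h)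
        have : (fun w : W => mul (a w) (b w) (h w)) = k := funext fun w => hmulW hk w (h w)
        rw [this]
        exact k.smooth
      one := one
      src_one := happ hone_src
      tgt_one := happ hone_tgt
      -- This law and the next ones are checked at the universal point `𝟙 G`, which represents
      -- `D.hom`, and then evaluated at γ.
      one_mul := fun γ => hmulW (g := src ≫ one) (h := 𝟙 G) (k := 𝟙 G) ⟨_, _, _, 𝟙 _, D.hom,
        hone _, UniversalIsom.rep_id, by rw [Category.id_comp]; exact UniversalIsom.rep_id⟩ γ _
      mul_one := fun γ => hmulW (g := 𝟙 G) (h := tgt ≫ one) (k := 𝟙 G) ⟨_, _, _, D.hom, 𝟙 _,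
        UniversalIsom.rep_id, hone _, by rw [Category.comp_id]; exact UniversalIsom.rep_id⟩ γ _
      inv := i
      src_inv := happ hirep.src_eq
      tgt_inv := happ hirep.tgt_eq
      mul_inv := fun γ => by
        refine hmulW (g := 𝟙 G) (h := i) (k := src ≫ one) ⟨_, _, _, D.hom, inv D.hom,
          UniversalIsom.rep_id, hirep, ?_⟩ γ _
        rw [IsIso.hom_inv_id]
        exact hone _
      inv_mul := fun γ => by
        refine hmulW (g := i) (h := 𝟙 G) (k := tgt ≫ one) ⟨_, _, _, inv D.hom, D.hom, hirep,
          UniversalIsom.rep_id, ?_⟩ γ _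
        rw [IsIso.inv_hom_id]
        exact hone _ }
  refine ⟨Γ, e, he, rfl, rfl, (LieGroupoid.isCompatible_iff (Γ := Γ) (D := D) h𝔛 hD).1 ?_⟩
  intro W g h hgh b c d φ ψ hg hh
  obtain ⟨k, hk⟩ := UniversalIsom.exists_isMul (D := D) h𝔛 (g := g) (h := h) (Mfd.hom_ext hgh)
  have : Γ.mulHom g h hgh = k := Mfd.hom_ext fun w => hmulW hk w (hgh w)
  rw [this]
  exact hk.rep h𝔛 hg hh

/-- A symmetry groupoid carries a universal isomorphism compatible with its product. -/
theorem IsSymmetryGroupoid.exists_universalIsom (h𝔛 : IsGroupoidFibration 𝔛) {Γ : LieGroupoid X}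
    (h : IsSymmetryGroupoid x Γ) : ∃ D : UniversalIsom x Γ.src Γ.tgt, Γ.IsCompatible D := by
  obtain ⟨e, he, hs, ht, hmul⟩ := h
  obtain ⟨D, hD⟩ := BasedCategory.exists_universalIsom h𝔛 he
  have key : ∀ {s t : Γ.arr ⟶ X} (D : UniversalIsom x s t), s = Γ.src → t = Γ.tgt →
      (∀ {W : Mfd.{u}} (g : W ⟶ Γ.arr), ∃ (b c : W ⟶ X) (φ : x.fam b ≅ x.fam c)
        (hφ : 𝔛.p.IsHomLift (𝟙 W) φ.hom),
        e.obj (ofObj.mk g) = FiberProductObj.ofArrows b c φ hφ ∧ D.Rep g φ.hom) →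
      ∃ D : UniversalIsom x Γ.src Γ.tgt, Γ.IsCompatible D := by
    rintro s t D rfl rfl hD
    exact ⟨D, (LieGroupoid.isCompatible_iff h𝔛 hD).2 hmul⟩
  exact key D hs ht hD

end

/-! ### The manifold Isom(x, ξ) -/

section

open CategoryTheory.BasedCategory

variable {𝔛 : BasedCategory.{v₁, u₁} Mfd.{u}} {X : Mfd.{u}} {x : BasedFunctor (ofObj X) 𝔛}

/-- The manifold representing `Isom(x, ξ)`, with its universal arrow. -/
structure IsomSpace (x : BasedFunctor (ofObj X) 𝔛) (ξ : 𝔛.obj) where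
  total : Mfd.{u}
  anchor : total ⟶ X
  proj : total ⟶ 𝔛.p.obj ξ
  hom : x.fam anchor ⟶ ξ
  isHomLift : 𝔛.p.IsHomLift proj hom
  submersion : Mfd.IsSubmersion proj
  surjective : Function.Surjective proj
  existsUnique : ∀ {W : Mfd.{u}} (b : W ⟶ X) (η : x.fam b ⟶ ξ),
    ∃! f : W ⟶ total, ∃ h : f ≫ anchor = b, x.restr f h ≫ hom = η

theorem exists_isHomLift_of_fam {W : Mfd.{u}} {b : W ⟶ X} {ξ : 𝔛.obj} (η : x.fam b ⟶ ξ) :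
    ∃ c : W ⟶ 𝔛.p.obj ξ, 𝔛.p.IsHomLift c η :=
  ⟨eqToHom (x.p_obj_fam b).symm ≫ 𝔛.p.map η, inferInstance⟩

/-- A choice of pullbacks turns ξ into a morphism y from its base to 𝔛, and the manifold is the
fiber product of x and y. An arrow to ξ over c is the same as an isomorphism over the identity to
the chosen pullback along c, so the universal property of the fiber product becomes the one required
here. -/
theorem IsVersalFamily.nonempty_isomSpace (hx : IsVersalFamily x) (h𝔛 : IsGroupoidFibration 𝔛)
    (ξ : 𝔛.obj) : Nonempty (IsomSpace x ξ) := by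
  obtain ⟨y, κ, hκ, hκn⟩ := h𝔛.exists_functor ξ
  obtain ⟨V, e, he, hsub⟩ := hx.isRepresentableSubmersion _ y
  obtain ⟨Φ, hΦ, -, huniv⟩ := exists_universal_of_isIsomorphism he
  have hlift : 𝔛.p.IsHomLift (inducedHom (e.comp (fiberProduct.snd x y)))
      (Φ.hom ≫ κ (inducedHom (e.comp (fiberProduct.snd x y)))) :=
    isHomLift_comp hΦ (hκ _) (Category.id_comp _)
  have hex : ∀ {W : Mfd.{u}} (b : W ⟶ X) (η : x.fam b ⟶ ξ),
      ∃! f : W ⟶ V, ∃ h : f ≫ inducedHom (e.comp (fiberProduct.fst x y)) = b,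
        x.restr f h ≫ Φ.hom ≫ κ (inducedHom (e.comp (fiberProduct.snd x y))) = η := by
    intro W b η
    obtain ⟨c, hc⟩ := exists_isHomLift_of_fam η
    obtain ⟨φ, hφ, hφη⟩ := h𝔛.exists_lift (hκ c) hc (Category.id_comp c)
    have := h𝔛.isIso_of_isHomLift_id hφ
    obtain ⟨f, ⟨h, h', hf⟩, huniq⟩ := huniv b c (asIso φ) hφ
    refine ⟨f, ⟨h, ?_⟩, ?_⟩
    · rw [← Category.assoc, hf, Category.assoc, hκn]
      exact hφη
    · rintro g ⟨k, hg⟩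
      have hg1 : 𝔛.p.IsHomLift (g ≫ inducedHom (e.comp (fiberProduct.snd x y))) η := by
        rw [← hg]
        exact isHomLift_comp (x.isHomLift_restr g k) hlift rfl
      have k' := eq_of_isHomLift hg1 hc
      refine huniq g ⟨k, k', ?_⟩
      refine h𝔛.lift_ext_of_isHomLift (φ := κ (inducedHom (e.comp (fiberProduct.snd x y))))
        (f := g) ?_ ?_ ?_
      · rw [Category.assoc, hg, Category.assoc, hκn]
        exact hφη.symm
      · exact isHomLift_comp (x.isHomLift_restr g k) hΦ (Category.comp_id _)
      · exact isHomLift_comp hφ (y.isHomLift_restr g k') (Category.id_comp _)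
  refine ⟨⟨V, _, inducedHom (e.comp (fiberProduct.snd x y)), _, hlift, hsub, ?_, hex⟩⟩
  -- After the surjective map q the object ξ receives an arrow from a pullback of x. This arrow is a
  -- V'-valued point of V with projection q, so the projection of V is onto.
  obtain ⟨V', q, z, -, hq, ⟨i⟩⟩ := hx.isEpimorphism _ y
  obtain ⟨b, hb⟩ := ofObj.exists_eq_mk (z.w_obj (ofObj.mk (𝟙 V')))
  let η₀ : x.obj (z.obj (ofObj.mk (𝟙 V'))) ⟶ ξ :=
    i.hom.toNatTrans.app (ofObj.mk (𝟙 V')) ≫ κ (𝟙 V' ≫ q)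
  have hη₀ : 𝔛.p.IsHomLift q η₀ :=
    isHomLift_comp (f := 𝟙 V') (BasedNatTrans.isHomLift i.hom rfl) (hκ (𝟙 V' ≫ q))
      (by rw [Category.id_comp, Category.id_comp])
  have key : ∀ (A : (ofObj X).obj) (η : x.obj A ⟶ ξ), A = ofObj.mk b → 𝔛.p.IsHomLift q η →
      ∃ f : V' ⟶ V, f ≫ inducedHom (e.comp (fiberProduct.snd x y)) = q := by
    rintro A η rfl hη
    obtain ⟨f, ⟨h, hf⟩, -⟩ := hex b η
    refine ⟨f, eq_of_isHomLift (φ := η) ?_ hη⟩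
    rw [← hf]
    exact isHomLift_comp (x.isHomLift_restr f h) hlift rfl
  obtain ⟨f, hf⟩ := key _ η₀ hb hη₀
  intro t
  obtain ⟨v, rfl⟩ := hq t
  exact ⟨f v, by rw [← hf]; rfl⟩

end

/-! ### Isom(x, ξ) as a torsor -/

section

open CategoryTheory.BasedCategory

variable {𝔛 : BasedCategory.{v₁, u₁} Mfd.{u}} {X : Mfd.{u}} {x : BasedFunctor (ofObj X) 𝔛}

/-- A unit of Γ is idempotent, so it represents an idempotent isomorphism, which is an identity. -/
theorem LieGroupoid.IsCompatible.rep_one (h𝔛 : IsGroupoidFibration 𝔛) {Γ : LieGroupoid X}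
    {D : UniversalIsom x Γ.src Γ.tgt} (hD : Γ.IsCompatible D) {W : Mfd.{u}} (b : W ⟶ X) :
    D.Rep (b ≫ Γ.one) (𝟙 (x.fam b)) := by
  have h1 : (b ≫ Γ.one) ≫ Γ.src = b := Mfd.hom_ext fun w => Γ.src_one (b w)
  have h2 : (b ≫ Γ.one) ≫ Γ.tgt = b := Mfd.hom_ext fun w => Γ.tgt_one (b w)
  obtain ⟨φ, hφ⟩ := UniversalIsom.exists_rep_of_arrow (D := D) h𝔛 (b ≫ Γ.one) h1 h2
  have h3 := hD (b ≫ Γ.one) (b ≫ Γ.one)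
    (fun w => (Γ.tgt_one (b w)).trans (Γ.src_one (b w)).symm) hφ hφ
  have h4 : Γ.mulHom (b ≫ Γ.one) (b ≫ Γ.one)
      (fun w => (Γ.tgt_one (b w)).trans (Γ.src_one (b w)).symm) = b ≫ Γ.one := by
    refine Mfd.hom_ext fun w => ?_
    have := Γ.one_mul (Γ.one (b w))
    simp only [Γ.src_one] at this
    exact this
  rw [h4] at h3
  have := h𝔛.isIso_of_isHomLift_id hφ.1
  have h5 : φ = 𝟙 _ := by
    rw [← cancel_epi φ, h3.hom_unique h𝔛 hφ, Category.comp_id]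
  rwa [h5] at hφ

namespace IsomSpace

variable {ξ η ζ : 𝔛.obj} (P : IsomSpace x ξ)

/-- The `W`-valued point `f` of `Isom(x, ξ)` represents the arrow `θ`. -/
def Rep {W : Mfd.{u}} (f : W ⟶ P.total) {b : W ⟶ X} (θ : x.fam b ⟶ ξ) : Prop :=
  ∃ h : f ≫ P.anchor = b, x.restr f h ≫ P.hom = θ

variable {P}

theorem rep_id : P.Rep (𝟙 P.total) P.hom :=
  ⟨Category.id_comp _, by rw [x.restr_id, Category.id_comp]⟩

theorem rep_of_arrow {W : Mfd.{u}} (f : W ⟶ P.total) {b : W ⟶ X} (h : f ≫ P.anchor = b) :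
    P.Rep f (x.restr f h ≫ P.hom) := ⟨h, rfl⟩

theorem exists_rep {W : Mfd.{u}} {b : W ⟶ X} (θ : x.fam b ⟶ ξ) : ∃ f, P.Rep f θ :=
  (P.existsUnique b θ).exists

theorem Rep.unique {W : Mfd.{u}} {f f' : W ⟶ P.total} {b : W ⟶ X} {θ : x.fam b ⟶ ξ}
    (h : P.Rep f θ) (h' : P.Rep f' θ) : f = f' :=
  (P.existsUnique b θ).unique h h'

theorem Rep.anchor_eq {W : Mfd.{u}} {f : W ⟶ P.total} {b : W ⟶ X} {θ : x.fam b ⟶ ξ}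
    (h : P.Rep f θ) : f ≫ P.anchor = b := h.1

theorem Rep.hom_unique {W : Mfd.{u}} {f : W ⟶ P.total} {b : W ⟶ X} {θ θ' : x.fam b ⟶ ξ}
    (h : P.Rep f θ) (h' : P.Rep f θ') : θ = θ' := h.2.symm.trans h'.2

theorem Rep.isHomLift {W : Mfd.{u}} {f : W ⟶ P.total} {b : W ⟶ X} {θ : x.fam b ⟶ ξ}
    (h : P.Rep f θ) : 𝔛.p.IsHomLift (f ≫ P.proj) θ := by
  obtain ⟨h, rfl⟩ := h
  exact isHomLift_comp (x.isHomLift_restr f h) P.isHomLift rfl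

theorem Rep.restrict {W W' : Mfd.{u}} {f : W ⟶ P.total} {b : W ⟶ X} {θ : x.fam b ⟶ ξ}
    (h : P.Rep f θ) (k : W' ⟶ W) {b' : W' ⟶ X} (hb : k ≫ b = b') :
    P.Rep (k ≫ f) (x.restr k hb ≫ θ) := by
  obtain ⟨h, rfl⟩ := h
  exact ⟨by rw [Category.assoc, h, hb], by rw [← x.restr_comp k hb f h, Category.assoc]⟩

theorem Rep.comp {P' : IsomSpace x η} {f : P.total ⟶ P'.total} {φ : ξ ⟶ η}
    (hf : P'.Rep f (P.hom ≫ φ)) {W : Mfd.{u}} {g : W ⟶ P.total} {b : W ⟶ X} {θ : x.fam b ⟶ ξ}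
    (hg : P.Rep g θ) : P'.Rep (g ≫ f) (θ ≫ φ) := by
  obtain ⟨hg, rfl⟩ := hg
  have := hf.restrict g hg
  rwa [← Category.assoc] at this

variable {Γ : LieGroupoid X} {D : UniversalIsom x Γ.src Γ.tgt}

variable (P D) in
/-- The `W`-valued point `f'` is the result of the action of `g` on `f`. -/
def IsAct {W : Mfd.{u}} (f : W ⟶ P.total) (g : W ⟶ Γ.arr) (f' : W ⟶ P.total) : Prop :=
  ∃ (b c : W ⟶ X) (φ : x.fam b ⟶ x.fam c) (θ : x.fam b ⟶ ξ) (θ' : x.fam c ⟶ ξ),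
    P.Rep f θ ∧ D.Rep g φ ∧ P.Rep f' θ' ∧ φ ≫ θ' = θ

theorem IsAct.comp_eq (h𝔛 : IsGroupoidFibration 𝔛) {W : Mfd.{u}} {f f' : W ⟶ P.total}
    {g : W ⟶ Γ.arr} (H : P.IsAct D f g f') {b c : W ⟶ X} {φ : x.fam b ⟶ x.fam c}
    {θ : x.fam b ⟶ ξ} {θ' : x.fam c ⟶ ξ} (hf : P.Rep f θ) (hg : D.Rep g φ) (hf' : P.Rep f' θ') :
    φ ≫ θ' = θ := by
  obtain ⟨b₁, c₁, φ₁, θ₁, θ₁', h1, h2, h3, h4⟩ := H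
  obtain rfl := hf.anchor_eq.symm.trans h1.anchor_eq
  obtain rfl := hf'.anchor_eq.symm.trans h3.anchor_eq
  rwa [hf.hom_unique h1, hg.hom_unique h𝔛 h2, hf'.hom_unique h3]

/-- If f represents θ and g represents φ, the result represents φ⁻¹ followed by θ. The inverse makes
this a right action for products that correspond to `φ ≫ ψ`. -/
theorem exists_isAct (h𝔛 : IsGroupoidFibration 𝔛) {W : Mfd.{u}} {f : W ⟶ P.total}
    {g : W ⟶ Γ.arr} (h : f ≫ P.anchor = g ≫ Γ.src) : ∃ f', P.IsAct D f g f' := by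
  obtain ⟨φ, hφ⟩ := UniversalIsom.exists_rep_of_arrow (D := D) h𝔛 g rfl rfl
  have := h𝔛.isIso_of_isHomLift_id hφ.1
  obtain ⟨f', hf'⟩ := exists_rep (P := P) (inv φ ≫ x.restr f h ≫ P.hom)
  exact ⟨f', _, _, φ, _, _, rep_of_arrow f h, hφ, hf', by rw [IsIso.hom_inv_id_assoc]⟩

theorem IsAct.unique (h𝔛 : IsGroupoidFibration 𝔛) {W : Mfd.{u}} {f f' f'' : W ⟶ P.total}
    {g : W ⟶ Γ.arr} (H : P.IsAct D f g f') (H' : P.IsAct D f g f'') : f' = f'' := by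
  obtain ⟨b, c, φ, θ, θ', h1, h2, h3, h4⟩ := H
  obtain ⟨b₁, c₁, φ₁, θ₁, θ₁', h1', h2', h3', h4'⟩ := H'
  obtain rfl := h2.src_eq.symm.trans h2'.src_eq
  obtain rfl := h2.tgt_eq.symm.trans h2'.tgt_eq
  obtain rfl := h1.hom_unique h1'
  obtain rfl := h2.hom_unique h𝔛 h2'
  have := h𝔛.isIso_of_isHomLift_id h2.1
  obtain rfl : θ' = θ₁' := by rw [← cancel_epi φ, h4, h4']
  exact h3.unique h3'

theorem IsAct.restrict (h𝔛 : IsGroupoidFibration 𝔛) {W W' : Mfd.{u}} {f f' : W ⟶ P.total}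
    {g : W ⟶ Γ.arr} (H : P.IsAct D f g f') (k : W' ⟶ W) :
    P.IsAct D (k ≫ f) (k ≫ g) (k ≫ f') := by
  obtain ⟨b, c, φ, θ, θ', h1, h2, h3, h4⟩ := H
  obtain ⟨φ', h5, h6⟩ := h𝔛.exists_restrict h2.1 k rfl rfl
  refine ⟨_, _, φ', _, _, h1.restrict k rfl, h2.restrict h5 h6, h3.restrict k rfl, ?_⟩
  rw [← Category.assoc, h6, Category.assoc, h4]

theorem IsAct.anchor_eq {W : Mfd.{u}} {f f' : W ⟶ P.total} {g : W ⟶ Γ.arr}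
    (H : P.IsAct D f g f') : f' ≫ P.anchor = g ≫ Γ.tgt := by
  obtain ⟨b, c, φ, θ, θ', h1, h2, h3, h4⟩ := H
  rw [h3.anchor_eq, h2.tgt_eq]

theorem IsAct.anchor_eq_src {W : Mfd.{u}} {f f' : W ⟶ P.total} {g : W ⟶ Γ.arr}
    (H : P.IsAct D f g f') : f ≫ P.anchor = g ≫ Γ.src := by
  obtain ⟨b, c, φ, θ, θ', h1, h2, h3, h4⟩ := H
  rw [h1.anchor_eq, h2.src_eq]

theorem IsAct.proj_eq {W : Mfd.{u}} {f f' : W ⟶ P.total} {g : W ⟶ Γ.arr}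
    (H : P.IsAct D f g f') : f' ≫ P.proj = f ≫ P.proj := by
  obtain ⟨b, c, φ, θ, θ', h1, h2, h3, h4⟩ := H
  refine eq_of_isHomLift (φ := θ) ?_ h1.isHomLift
  rw [← h4]
  exact isHomLift_comp h2.1 h3.isHomLift (Category.id_comp _)

theorem IsAct.mul (hD : Γ.IsCompatible D) {W : Mfd.{u}}
    {f f' f'' : W ⟶ P.total} {g h : W ⟶ Γ.arr} (H : P.IsAct D f g f') (H' : P.IsAct D f' h f'')
    (hgh : ∀ w : W, Γ.tgt (g w) = Γ.src (h w)) : P.IsAct D f (Γ.mulHom g h hgh) f'' := by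
  obtain ⟨b, c, φ, θ, θ', h1, h2, h3, h4⟩ := H
  obtain ⟨b₁, c₁, φ₁, θ₁, θ₁', h1', h2', h3', h4'⟩ := H'
  obtain rfl := h3.anchor_eq.symm.trans h1'.anchor_eq
  obtain rfl := h3.hom_unique h1'
  exact ⟨b, c₁, φ ≫ φ₁, θ, θ₁', h1, hD g h hgh h2 h2', h3', by rw [Category.assoc, h4', h4]⟩

theorem isAct_one (h𝔛 : IsGroupoidFibration 𝔛) (hD : Γ.IsCompatible D) {W : Mfd.{u}}
    (f : W ⟶ P.total) : P.IsAct D f ((f ≫ P.anchor) ≫ Γ.one) f :=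
  ⟨_, _, 𝟙 _, _, _, rep_of_arrow f rfl, hD.rep_one h𝔛 _, rep_of_arrow f rfl,
    Category.id_comp _⟩

/-- Transitivity on fibers: the two represented arrows to ξ lie over the same map, so one factors
through the other, which is cartesian, over the identity. -/
theorem exists_isAct_of_proj_eq (h𝔛 : IsGroupoidFibration 𝔛) {W : Mfd.{u}} {f f' : W ⟶ P.total}
    (h : f ≫ P.proj = f' ≫ P.proj) : ∃ g, P.IsAct D f g f' := by
  have h1 := rep_of_arrow f rfl
  have h2 := rep_of_arrow f' rfl
  obtain ⟨φ, h3, h4⟩ := h𝔛.exists_lift (g := 𝟙 W) h2.isHomLift h1.isHomLift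
    (by rw [Category.id_comp, h])
  obtain ⟨g, hg⟩ := UniversalIsom.exists_rep (D := D) h3
  exact ⟨g, _, _, φ, _, _, h1, hg, h2, h4⟩

/-- Freeness: both isomorphisms factor θ through the cartesian arrow θ'. -/
theorem IsAct.arrow_unique (h𝔛 : IsGroupoidFibration 𝔛) {W : Mfd.{u}} {f f' : W ⟶ P.total}
    {g g' : W ⟶ Γ.arr} (H : P.IsAct D f g f') (H' : P.IsAct D f g' f') : g = g' := by
  obtain ⟨b, c, φ, θ, θ', h1, h2, h3, h4⟩ := H
  obtain ⟨φ₁, h2'⟩ := UniversalIsom.exists_rep_of_arrow (D := D) h𝔛 g'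
    (H'.anchor_eq_src.symm.trans h1.anchor_eq) (H'.anchor_eq.symm.trans h3.anchor_eq)
  obtain rfl : φ = φ₁ :=
    h𝔛.lift_ext_of_isHomLift (h4.trans (H'.comp_eq h𝔛 h1 h2' h3).symm) h2.1 h2'.1
  exact h2.unique h2'

variable (P D) in
theorem exists_act (h𝔛 : IsGroupoidFibration 𝔛) (p : P.total) (γ : Γ.arr)
    (h : P.anchor p = Γ.src γ) :
    ∃ q : P.total, P.IsAct D (Mfd.point p) (Mfd.point γ) (Mfd.point q) := by
  obtain ⟨f', hf'⟩ := exists_isAct (P := P) (D := D) h𝔛 (f := Mfd.point p) (g := Mfd.point γ)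
    (congrArg Mfd.point h)
  exact ⟨f' PUnit.unit, by rwa [← Mfd.eq_point]⟩

variable (P D) in
/-- The action of `Γ` on `Isom(x, ξ)`. -/
noncomputable def act (h𝔛 : IsGroupoidFibration 𝔛) (p : P.total) (γ : Γ.arr)
    (h : P.anchor p = Γ.src γ) : P.total :=
  (P.exists_act D h𝔛 p γ h).choose

theorem isAct_act (h𝔛 : IsGroupoidFibration 𝔛) (p : P.total) (γ : Γ.arr)
    (h : P.anchor p = Γ.src γ) :
    P.IsAct D (Mfd.point p) (Mfd.point γ) (Mfd.point (P.act D h𝔛 p γ h)) :=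
  (P.exists_act D h𝔛 p γ h).choose_spec

theorem IsAct.act_eq (h𝔛 : IsGroupoidFibration 𝔛) {W : Mfd.{u}} {f f' : W ⟶ P.total}
    {g : W ⟶ Γ.arr} (H : P.IsAct D f g f') (w : W) (h : P.anchor (f w) = Γ.src (g w)) :
    P.act D h𝔛 (f w) (g w) h = f' w := by
  have := H.restrict h𝔛 (Mfd.point w)
  simp only [Mfd.point_comp] at this
  exact Mfd.point_injective ((isAct_act h𝔛 _ _ h).unique h𝔛 this)

theorem isAct_of_act_eq (h𝔛 : IsGroupoidFibration 𝔛) {W : Mfd.{u}} {f f' : W ⟶ P.total}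
    {g : W ⟶ Γ.arr} (h : ∀ w : W, P.anchor (f w) = Γ.src (g w))
    (H : ∀ w, P.act D h𝔛 (f w) (g w) (h w) = f' w) : P.IsAct D f g f' := by
  obtain ⟨f'', hf''⟩ := exists_isAct (P := P) (D := D) h𝔛 (f := f) (g := g) (Mfd.hom_ext h)
  obtain rfl : f'' = f' := Mfd.hom_ext fun w => (hf''.act_eq h𝔛 w (h w)).symm.trans (H w)
  exact hf''

variable (P) in
/-- The `Γ`-torsor `Isom(x, ξ)`. -/
noncomputable def torsor (h𝔛 : IsGroupoidFibration 𝔛) (hD : Γ.IsCompatible D) : Γ.Torsor where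
  base := 𝔛.p.obj ξ
  total := P.total
  proj := P.proj
  proj_submersion := P.submersion
  proj_surjective := P.surjective
  anchor := P.anchor
  act := P.act D h𝔛
  anchor_act p γ h := Mfd.point_injective (isAct_act h𝔛 p γ h).anchor_eq
  act_one p := (isAct_one h𝔛 hD (Mfd.point p)).act_eq h𝔛 PUnit.unit _
  act_mul p γ δ h₁ h₂ := by
    have h3 : P.anchor (P.act D h𝔛 p γ h₁) = Γ.src δ :=
      (Mfd.point_injective (isAct_act h𝔛 p γ h₁).anchor_eq).trans h₂
    exact ((isAct_act h𝔛 p γ h₁).mul hD (isAct_act h𝔛 _ δ h3) fun _ => h₂).act_eq h𝔛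
      PUnit.unit _
  smooth_act W a b h := by
    obtain ⟨f', hf'⟩ := exists_isAct (P := P) (D := D) h𝔛 (f := a) (g := b) (Mfd.hom_ext h)
    have : (fun w : W => P.act D h𝔛 (a w) (b w) (h w)) = f' :=
      funext fun w => hf'.act_eq h𝔛 w (h w)
    rw [this]
    exact f'.smooth
  proj_act p γ h := Mfd.point_injective (isAct_act h𝔛 p γ h).proj_eq
  existsUnique_act p p' h := by
    obtain ⟨g, hg⟩ := exists_isAct_of_proj_eq (P := P) (D := D) h𝔛 (f := Mfd.point p)
      (f' := Mfd.point p') (congrArg Mfd.point h)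
    have hs := hg.anchor_eq_src
    refine ⟨g PUnit.unit, ⟨congrArg (fun k : Mfd.pt ⟶ X => k PUnit.unit) hs,
      hg.act_eq h𝔛 PUnit.unit _⟩, ?_⟩
    rintro γ ⟨hγ, hγ'⟩
    have h1 := isAct_act (D := D) h𝔛 p γ hγ
    rw [hγ'] at h1
    rw [hg.arrow_unique h𝔛 h1]
    rfl

/-- The map of torsors induced by an arrow of `𝔛`. -/
theorem exists_torsorMap (h𝔛 : IsGroupoidFibration 𝔛) (hD : Γ.IsCompatible D)
    (P' : IsomSpace x η) (φ : ξ ⟶ η) :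
    ∃ m : P.torsor h𝔛 hD ⟶ P'.torsor h𝔛 hD,
      LieGroupoid.Torsor.Hom.base m = 𝔛.p.map φ ∧
        P'.Rep (LieGroupoid.Torsor.Hom.total m) (P.hom ≫ φ) := by
  obtain ⟨f, hf⟩ := exists_rep (P := P') (P.hom ≫ φ)
  refine ⟨LieGroupoid.Torsor.Hom.mk (Q := P.torsor h𝔛 hD) (P := P'.torsor h𝔛 hD) (𝔛.p.map φ) f
    ?_ ?_ ?_, rfl, hf⟩
  · have : f ≫ P'.proj = P.proj ≫ 𝔛.p.map φ :=
      eq_of_isHomLift hf.isHomLift (isHomLift_comp P.isHomLift (IsHomLift.map _ _) rfl)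
    exact fun q => congrArg (fun k : P.total ⟶ 𝔛.p.obj η => k q) this
  · exact fun q => congrArg (fun k : P.total ⟶ X => k q) hf.anchor_eq
  · intro q γ h
    obtain ⟨b, c, ψ, θ, θ', h1, h2, h3, h4⟩ := isAct_act (D := D) h𝔛 q γ h
    have h5 : P'.IsAct D (Mfd.point q ≫ f) (Mfd.point γ)
        (Mfd.point (P.act D h𝔛 q γ h) ≫ f) :=
      ⟨b, c, ψ, θ ≫ φ, θ' ≫ φ, hf.comp h1, h2, hf.comp h3, by rw [← Category.assoc, h4]⟩
    exact (h5.act_eq h𝔛 PUnit.unit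
      (congrArg (fun k : Mfd.pt ⟶ X => k PUnit.unit) h5.anchor_eq_src)).symm

end IsomSpace

end

/-! ### Descent of arrows along submersions -/

section

open CategoryTheory.BasedCategory

theorem Mfd.isCoveringFamily_incl {S : Mfd.{u}} {ι : Type u} {U : ι → TopologicalSpace.Opens S}
    (hU : ∀ s, ∃ i, s ∈ U i) : IsCoveringFamily fun i => S.incl (U i) :=
  ⟨fun i => isEtale_incl (U i), fun s => (hU s).imp fun _ h => ⟨⟨s, h⟩, rfl⟩⟩

/-- A surjective submersion has sections over the members of an open covering. -/
theorem Mfd.IsSubmersion.exists_sections {P S : Mfd.{u}} {π : P ⟶ S} (hπ : IsSubmersion π)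
    (hs : Function.Surjective π) : ∃ (U : S → TopologicalSpace.Opens S)
      (σ : ∀ s, S.restrict (U s) ⟶ P), (∀ s, s ∈ U s) ∧ ∀ s, σ s ≫ π = S.incl (U s) := by
  have : ∀ s, ∃ (U : TopologicalSpace.Opens S) (σ : S.restrict U ⟶ P), s ∈ U ∧
      σ ≫ π = S.incl U := by
    intro s
    obtain ⟨p, rfl⟩ := hs s
    obtain ⟨U, σ, h1, -, h2, h3⟩ := hπ.exists_section p
    exact ⟨U, homOfSmoothOn U σ h2, h1, hom_ext fun y => h3 y.1 y.2⟩
  choose U σ h1 h2 using this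
  exact ⟨U, σ, h1, h2⟩

/-- The preimage of an open subset. -/
def Mfd.preimage {P S : Mfd.{u}} (π : P ⟶ S) (U : TopologicalSpace.Opens S) :
    TopologicalSpace.Opens P :=
  ⟨π ⁻¹' U, U.2.preimage π.smooth.continuous⟩

/-- The restriction of a smooth map to the preimage of an open subset. -/
def Mfd.preimageMap {P S : Mfd.{u}} (π : P ⟶ S) (U : TopologicalSpace.Opens S) :
    P.restrict (preimage π U) ⟶ S.restrict U :=
  liftOpen (P.incl (preimage π U) ≫ π) fun y => y.2

theorem Mfd.preimageMap_incl {P S : Mfd.{u}} (π : P ⟶ S) (U : TopologicalSpace.Opens S) :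
    preimageMap π U ≫ S.incl U = P.incl (preimage π U) ≫ π := rfl

namespace IsStack

variable {𝔛 : BasedCategory.{v₁, u₁} Mfd.{u}}

/-- Arrows over the same map are equal if they agree on a covering family. -/
theorem arrow_ext (h𝔛 : IsStack 𝔛) {S T : Mfd.{u}} {ι : Type u} {U : ι → Mfd.{u}} {f : ∀ i, U i ⟶ S}
    (hf : Mfd.IsCoveringFamily f) {ξ η : 𝔛.obj} {k : S ⟶ T} {φ ψ : ξ ⟶ η}
    (hφ : 𝔛.p.IsHomLift k φ) (hψ : 𝔛.p.IsHomLift k ψ) {z : ι → 𝔛.obj} {κ : ∀ i, z i ⟶ ξ}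
    (hκ : ∀ i, 𝔛.p.IsHomLift (f i) (κ i)) (H : ∀ i, κ i ≫ φ = κ i ≫ ψ) : φ = ψ := by
  have hG := h𝔛.isGroupoidFibration
  have hξ := IsHomLift.domain_eq 𝔛.p k φ
  -- The stack axiom concerns arrows of a single fiber, so both arrows are factored through the
  -- pullback of η along k.
  obtain ⟨y, μ, hμ⟩ := hG.exists_pullback k η (IsHomLift.codomain_eq 𝔛.p k φ)
  have hy := IsHomLift.domain_eq 𝔛.p k μ
  obtain ⟨φ₀, hφ₀, rfl⟩ := hG.exists_lift hμ hφ (Category.id_comp k)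
  obtain ⟨ψ₀, hψ₀, rfl⟩ := hG.exists_lift hμ hψ (Category.id_comp k)
  have H' : ∀ i, κ i ≫ φ₀ = κ i ≫ ψ₀ := fun i =>
    hG.lift_ext_of_isHomLift (φ := μ) (f := f i) (by simpa only [Category.assoc] using H i)
      (isHomLift_comp (hκ i) hφ₀ (Category.comp_id _))
      (isHomLift_comp (hκ i) hψ₀ (Category.comp_id _))
  choose y' l hl using fun i => hG.exists_pullback (f i) y hy
  choose φ' hφ' hφ'' using fun i => hG.exists_lift (hl i)
    (isHomLift_comp (hκ i) hφ₀ (Category.comp_id (f i))) (Category.id_comp (f i))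
  have := h𝔛.hom_ext f hf (x := ⟨ξ, hξ⟩) (y := ⟨y, hy⟩)
    (fun i => ⟨⟨z i, IsHomLift.domain_eq 𝔛.p (f i) (κ i)⟩, κ i, hκ i⟩)
    (fun i => ⟨⟨y' i, IsHomLift.domain_eq 𝔛.p (f i) (l i)⟩, l i, hl i⟩)
    ⟨φ₀, hφ₀⟩ ⟨ψ₀, hψ₀⟩ (fun i => ⟨φ' i, hφ' i⟩) (fun i => hφ'' i)
    (fun i => (hφ'' i).trans (H' i))
  exact congrArg (fun k => k ≫ μ) (congrArg Subtype.val this)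

/-- Arrows given on the members of an open covering, which agree on the overlaps, glue. -/
theorem exists_arrow (h𝔛 : IsStack 𝔛) {S T : Mfd.{u}} {ι : Type u}
    {U : ι → TopologicalSpace.Opens S}
    (hU : ∀ s, ∃ i, s ∈ U i) {ζ ξ : 𝔛.obj} (b : S ⟶ T) (hζ : 𝔛.p.obj ζ = S) (hξ : 𝔛.p.obj ξ = T)
    {z : ι → 𝔛.obj} {κ : ∀ i, z i ⟶ ζ} (hκ : ∀ i, 𝔛.p.IsHomLift (S.incl (U i)) (κ i))
    {χ : ∀ i, z i ⟶ ξ} (hχ : ∀ i, 𝔛.p.IsHomLift (S.incl (U i) ≫ b) (χ i))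
    (H : ∀ i j {w : 𝔛.obj} (α : w ⟶ z i) (β : w ⟶ z j), α ≫ κ i = β ≫ κ j →
      α ≫ χ i = β ≫ χ j) :
    ∃ φ : ζ ⟶ ξ, 𝔛.p.IsHomLift b φ ∧ ∀ i, κ i ≫ φ = χ i := by
  have hG := h𝔛.isGroupoidFibration
  obtain ⟨y, μ, hμ⟩ := hG.exists_pullback b ξ hξ
  have hy := IsHomLift.domain_eq 𝔛.p b μ
  choose y' l hl using fun i => hG.exists_pullback (S.incl (U i)) y hy
  choose φ' hφ' hφ'' using fun i => hG.exists_lift (isHomLift_comp (hl i) hμ rfl) (hχ i)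
    (Category.id_comp _)
  have H' : ∀ (i j : ι) (w : 𝔛.obj) (α : w ⟶ z i) (β : w ⟶ z j),
      𝔛.p.IsHomLift (Mfd.liftOpen (U := U i) (S.incl (U i ⊓ U j)) fun x => x.2.1) α →
      𝔛.p.IsHomLift (Mfd.liftOpen (U := U j) (S.incl (U i ⊓ U j)) fun x => x.2.2) β →
      α ≫ κ i = β ≫ κ j → α ≫ φ' i ≫ l i = β ≫ φ' j ≫ l j := by
    intro i j w α β hα hβ hαβ
    refine hG.lift_ext_of_isHomLift (φ := μ) (f := S.incl (U i ⊓ U j)) ?_ ?_ ?_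
    · simp only [Category.assoc]
      rw [hφ'' i, hφ'' j]
      exact H i j α β hαβ
    · exact isHomLift_comp hα (isHomLift_comp (hφ' i) (hl i) (Category.id_comp _)) rfl
    · exact isHomLift_comp hβ (isHomLift_comp (hφ' j) (hl j) (Category.id_comp _)) rfl
  obtain ⟨φ, hφ⟩ := h𝔛.exists_hom _ (Mfd.isCoveringFamily_incl hU) (x := ⟨ζ, hζ⟩) (y := ⟨y, hy⟩)
    (fun i => ⟨⟨z i, IsHomLift.domain_eq 𝔛.p (S.incl (U i)) (κ i)⟩, κ i, hκ i⟩)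
    (fun i => ⟨⟨y' i, IsHomLift.domain_eq 𝔛.p (S.incl (U i)) (l i)⟩, l i, hl i⟩)
    (fun i => ⟨φ' i, hφ' i⟩) _ _ _ (fun i j => Mfd.isPullback_restrict_inf (U i) (U j)) H'
  refine ⟨φ.1 ≫ μ, isHomLift_comp φ.2 hμ (Category.id_comp _), fun i => ?_⟩
  have h1 : φ' i ≫ l i = κ i ≫ φ.1 := hφ i
  rw [← Category.assoc, ← h1, Category.assoc, hφ'' i]

/-- Arrows over the same map are equal if they agree after pulling back along a surjective
submersion. -/
theorem arrow_ext_of_submersion (h𝔛 : IsStack 𝔛) {P S T : Mfd.{u}} {π : P ⟶ S}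
    (hπ : Mfd.IsSubmersion π) (hs : Function.Surjective π) {ζ ξ η : 𝔛.obj} {θ : ζ ⟶ ξ}
    (hθ : 𝔛.p.IsHomLift π θ) {b : S ⟶ T}
    {φ ψ : ξ ⟶ η} (hφ : 𝔛.p.IsHomLift b φ) (hψ : 𝔛.p.IsHomLift b ψ) (H : θ ≫ φ = θ ≫ ψ) :
    φ = ψ := by
  -- Pulling back along local sections turns agreement after π into agreement on an open covering of
  -- S.
  obtain ⟨U, σ, hU, hσ⟩ := hπ.exists_sections hs
  choose z μ hμ using fun s =>
    h𝔛.isGroupoidFibration.exists_pullback (σ s) ζ (IsHomLift.domain_eq 𝔛.p π θ)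
  refine h𝔛.arrow_ext (Mfd.isCoveringFamily_incl fun s => ⟨s, hU s⟩) hφ hψ
    (fun s => isHomLift_comp (hμ s) hθ (hσ s)) fun s => ?_
  rw [Category.assoc, H, Category.assoc]

/-- Arrows descend along surjective submersions. -/
theorem exists_arrow_of_submersion (h𝔛 : IsStack 𝔛) {P S T : Mfd.{u}} {π : P ⟶ S}
    (hπ : Mfd.IsSubmersion π) (hs : Function.Surjective π) {ζ ξ η : 𝔛.obj} {θ : ζ ⟶ ξ}
    (hθ : 𝔛.p.IsHomLift π θ) {b : S ⟶ T}
    {χ : ζ ⟶ η} (hχ : 𝔛.p.IsHomLift (π ≫ b) χ)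
    (H : ∀ {w : 𝔛.obj} (α β : w ⟶ ζ), α ≫ θ = β ≫ θ → α ≫ χ = β ≫ χ) :
    ∃ φ : ξ ⟶ η, 𝔛.p.IsHomLift b φ ∧ θ ≫ φ = χ := by
  have hG := h𝔛.isGroupoidFibration
  have hζ := IsHomLift.domain_eq 𝔛.p π θ
  obtain ⟨U, σ, hU, hσ⟩ := hπ.exists_sections hs
  choose z μ hμ using fun s => hG.exists_pullback (σ s) ζ hζ
  have hκ : ∀ s, 𝔛.p.IsHomLift (S.incl (U s)) (μ s ≫ θ) := fun s =>
    isHomLift_comp (hμ s) hθ (hσ s)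
  obtain ⟨φ, hφ, hφ'⟩ := h𝔛.exists_arrow (fun s => ⟨s, hU s⟩) b
    (IsHomLift.codomain_eq 𝔛.p π θ) (IsHomLift.codomain_eq 𝔛.p (π ≫ b) χ) hκ
    (χ := fun s => μ s ≫ χ)
    (fun s => isHomLift_comp (hμ s) hχ (by rw [← Category.assoc, hσ])) (fun i j w α β h => by
      have := H (α ≫ μ i) (β ≫ μ j) (by simpa only [Category.assoc] using h)
      simpa only [Category.assoc] using this)
  refine ⟨φ, hφ, ?_⟩
  -- So far φ is compared with χ along the chosen sections only. Over the preimage of `U s`, the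
  -- inclusion into P and the section composed with π have the same image in S, so `H` compares the
  -- corresponding arrows to ζ.
  choose w l hl using fun s => hG.exists_pullback (P.incl (Mfd.preimage π (U s))) ζ hζ
  refine h𝔛.arrow_ext (Mfd.isCoveringFamily_incl fun p => ⟨π p, hU (π p)⟩)
    (isHomLift_comp hθ hφ rfl) hχ hl fun s => ?_
  obtain ⟨ν, -, hν⟩ := hG.exists_lift (hκ s) (isHomLift_comp (hl s) hθ rfl)
    (Mfd.preimageMap_incl π (U s))
  have h1 := H (ν ≫ μ s) (l s) ((Category.assoc _ _ _).trans hν)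
  rw [← Category.assoc, ← hν, Category.assoc, hφ' s, ← Category.assoc, h1]

end IsStack

end

/-! ### Descent of objects along submersions -/

section

open CategoryTheory.BasedCategory

/-- Descent data on an object `ζ` over `P` along `π : P ⟶ S`, presented by the equivalence relation
on arrows to `ζ` of having the same composite to the descended object. -/
structure DescentRelation (𝔛 : BasedCategory.{v₁, u₁} Mfd.{u}) {P S : Mfd.{u}} (π : P ⟶ S)
    (ζ : 𝔛.obj) where
  rel : ∀ {z : 𝔛.obj}, (z ⟶ ζ) → (z ⟶ ζ) → Prop
  symm : ∀ {z : 𝔛.obj} {α β : z ⟶ ζ}, rel α β → rel β α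
  trans : ∀ {z : 𝔛.obj} {α β γ : z ⟶ ζ}, rel α β → rel β γ → rel α γ
  comp : ∀ {z z' : 𝔛.obj} (k : z' ⟶ z) {α β : z ⟶ ζ}, rel α β → rel (k ≫ α) (k ≫ β)
  base_eq : ∀ {W : Mfd.{u}} {f f' : W ⟶ P} {z : 𝔛.obj} {α β : z ⟶ ζ}, rel α β →
    𝔛.p.IsHomLift f α → 𝔛.p.IsHomLift f' β → f ≫ π = f' ≫ π
  exists_rel : ∀ {W : Mfd.{u}} {f f' : W ⟶ P} {z : 𝔛.obj} (α : z ⟶ ζ), 𝔛.p.IsHomLift f α →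
    f ≫ π = f' ≫ π → ∃ β : z ⟶ ζ, 𝔛.p.IsHomLift f' β ∧ rel α β
  unique : ∀ {W : Mfd.{u}} {f : W ⟶ P} {z : 𝔛.obj} {α β β' : z ⟶ ζ}, rel α β → rel α β' →
    𝔛.p.IsHomLift f β → 𝔛.p.IsHomLift f β' → β = β'

variable {𝔛 : BasedCategory.{v₁, u₁} Mfd.{u}}

/-- Local descent: the pullbacks of `ζ` along local sections of `π` glue. -/
theorem IsStack.exists_local_descent (h𝔛 : IsStack 𝔛) {P S : Mfd.{u}} {π : P ⟶ S} {ζ : 𝔛.obj}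
    (R : DescentRelation 𝔛 π ζ) {ι : Type u} {U : ι → TopologicalSpace.Opens S}
    (hU : ∀ s, ∃ i, s ∈ U i) {σ : ∀ i, S.restrict (U i) ⟶ P} (hσ : ∀ i, σ i ≫ π = S.incl (U i))
    {z : ι → 𝔛.obj} {μ : ∀ i, z i ⟶ ζ} (hμ : ∀ i, 𝔛.p.IsHomLift (σ i) (μ i)) :
    ∃ (ξ : 𝔛.obj) (θ : ∀ i, z i ⟶ ξ), 𝔛.p.obj ξ = S ∧
      (∀ i, 𝔛.p.IsHomLift (S.incl (U i)) (θ i)) ∧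
      ∀ {w : 𝔛.obj} {i j : ι} (α : w ⟶ z i) (β : w ⟶ z j), R.rel (α ≫ μ i) (β ≫ μ j) →
        α ≫ θ i = β ≫ θ j := by
  have hG := h𝔛.isGroupoidFibration
  have hz : ∀ i, 𝔛.p.obj (z i) = S.restrict (U i) := fun i =>
    IsHomLift.domain_eq 𝔛.p (σ i) (μ i)
  let fst : ∀ i j, S.restrict (U i ⊓ U j) ⟶ S.restrict (U i) := fun i j =>
    Mfd.liftOpen (S.incl (U i ⊓ U j)) fun x => x.2.1
  let snd : ∀ i j, S.restrict (U i ⊓ U j) ⟶ S.restrict (U j) := fun i j =>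
    Mfd.liftOpen (S.incl (U i ⊓ U j)) fun x => x.2.2
  have hpb : ∀ i j, IsPullback (fst i j) (snd i j) (S.incl (U i)) (S.incl (U j)) := fun i j =>
    Mfd.isPullback_restrict_inf (U i) (U j)
  choose L l hl using fun i j => hG.exists_pullback (fst i j) (z i) (hz i)
  choose Rt r hr using fun i j => hG.exists_pullback (snd i j) (z j) (hz j)
  -- On the overlap two sections of π have the same image in S; the relation carries the pullback
  -- along the first to the pullback along the second.
  have ht : ∀ i j, ∃ t : L i j ⟶ Rt i j, 𝔛.p.IsHomLift (𝟙 (S.restrict (U i ⊓ U j))) t ∧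
      R.rel (l i j ≫ μ i) (t ≫ r i j ≫ μ j) := by
    intro i j
    obtain ⟨β, hβ, hR⟩ := R.exists_rel (f' := snd i j ≫ σ j) (l i j ≫ μ i)
      (isHomLift_comp (hl i j) (hμ i) rfl) (by
        rw [Category.assoc, Category.assoc, hσ, hσ, (hpb i j).w])
    obtain ⟨t, ht, rfl⟩ := hG.exists_lift (isHomLift_comp (hr i j) (hμ j) rfl) hβ
      (Category.id_comp _)
    exact ⟨t, ht, hR⟩
  choose t ht hR using ht
  obtain ⟨ξ, θ, hθ, hθ'⟩ := h𝔛.exists_obj _ (Mfd.isCoveringFamily_incl hU)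
    { obj := fun i => ⟨z i, hz i⟩
      overlap := fun i j => S.restrict (U i ⊓ U j)
      fst := fst
      snd := snd
      isPullback := hpb
      left := fun i j => ⟨⟨L i j, IsHomLift.domain_eq 𝔛.p (fst i j) (l i j)⟩, l i j, hl i j⟩
      right := fun i j => ⟨⟨Rt i j, IsHomLift.domain_eq 𝔛.p (snd i j) (r i j)⟩, r i j, hr i j⟩
      trans := fun i j => ⟨t i j, ht i j⟩
      cocycle := by
        intro i j k w α β γ h1 h2 h3
        -- After composition with the arrow to ζ, both sides of the cocycle condition are related to
        -- the one arrow that starts with α and lie over the same map. Uniqueness in R identifies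
        -- them.
        refine hG.lift_ext (φ := μ k) ?_ h3
        have e1 := R.comp α (hR i j)
        have e2 := R.comp β (hR j k)
        have e3 := R.comp γ (hR i k)
        have h1' : α ≫ l i j ≫ μ i = γ ≫ l i k ≫ μ i := by
          rw [← Category.assoc, ← Category.assoc]
          exact congrArg (fun m => m ≫ μ i) h1
        have h2' : α ≫ t i j ≫ r i j ≫ μ j = β ≫ l j k ≫ μ j := by
          simp only [← Category.assoc] at h2 ⊢
          exact congrArg (fun m => m ≫ μ j) h2
        rw [h2'] at e1
        rw [← h1'] at e3
        have h4 : 𝔛.p.map (β ≫ t j k ≫ r j k ≫ μ k) = 𝔛.p.map (γ ≫ t i k ≫ r i k ≫ μ k) := by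
          have := congrArg (fun m => m ≫ 𝔛.p.map (μ k)) h3
          simpa only [← Functor.map_comp, Category.assoc] using this
        have h5 : 𝔛.p.IsHomLift (eqToHom rfl ≫ 𝔛.p.map (β ≫ t j k ≫ r j k ≫ μ k) ≫
            eqToHom (IsHomLift.codomain_eq 𝔛.p (σ k) (μ k))) (β ≫ t j k ≫ r j k ≫ μ k) :=
          inferInstance
        simpa only [Category.assoc] using
          R.unique (R.trans e1 e2) e3 h5 (isHomLift_of_map_eq h5 h4.symm) }
  refine ⟨ξ.1, θ, ξ.2, hθ, ?_⟩
  intro w i j α β hαβ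
  have hα : 𝔛.p.IsHomLift (𝔛.p.map α ≫ eqToHom (hz i)) α := inferInstance
  have hβ : 𝔛.p.IsHomLift (𝔛.p.map β ≫ eqToHom (hz j)) β := inferInstance
  generalize 𝔛.p.map α ≫ eqToHom (hz i) = f at hα
  generalize 𝔛.p.map β ≫ eqToHom (hz j) = f' at hβ
  have hb := R.base_eq hαβ (isHomLift_comp hα (hμ i) rfl) (isHomLift_comp hβ (hμ j) rfl)
  rw [Category.assoc, Category.assoc, hσ, hσ] at hb
  -- Related arrows have the same image in S, so α factors through the overlap, and uniqueness in R
  -- makes β the transition of that factor.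
  obtain ⟨α', hα', rfl⟩ := hG.exists_lift (hl i j) hα ((hpb i j).lift_fst _ _ hb)
  have h1 : α' ≫ t i j ≫ r i j = β := by
    have hk : 𝔛.p.IsHomLift f' (α' ≫ t i j ≫ r i j) :=
      isHomLift_comp hα' (isHomLift_comp (ht i j) (hr i j) (Category.id_comp _))
        ((hpb i j).lift_snd _ _ hb)
    refine hG.lift_ext_of_isHomLift (φ := μ j) ?_ hk hβ
    have e1 := R.comp α' (hR i j)
    simp only [← Category.assoc] at e1 hαβ
    have := R.unique e1 hαβ (by
      simp only [Category.assoc]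
      simpa only [Category.assoc] using isHomLift_comp hk (hμ j) rfl) (isHomLift_comp hβ (hμ j) rfl)
    simpa only [Category.assoc] using this
  rw [← h1, Category.assoc, Category.assoc, Category.assoc]
  exact congrArg (fun m => α' ≫ m) (hθ' i j)

/-- Objects descend along surjective submersions. -/
theorem IsStack.exists_descent (h𝔛 : IsStack 𝔛) {P S : Mfd.{u}} {π : P ⟶ S}
    (hπ : Mfd.IsSubmersion π) (hs : Function.Surjective π) {ζ : 𝔛.obj} (hζ : 𝔛.p.obj ζ = P)
    (R : DescentRelation 𝔛 π ζ) :
    ∃ (ξ : 𝔛.obj) (θ : ζ ⟶ ξ), 𝔛.p.IsHomLift π θ ∧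
      ∀ {w : 𝔛.obj} {α β : w ⟶ ζ}, R.rel α β → α ≫ θ = β ≫ θ := by
  have hG := h𝔛.isGroupoidFibration
  obtain ⟨U, σ, hU, hσ⟩ := hπ.exists_sections hs
  choose z μ hμ using fun s => hG.exists_pullback (σ s) ζ hζ
  obtain ⟨ξ, θ, hξ, hθ, key⟩ := h𝔛.exists_local_descent R (fun s => ⟨s, hU s⟩) hσ hμ
  choose w l hl using fun s => hG.exists_pullback (P.incl (Mfd.preimage π (U s))) ζ hζ
  -- Over the preimage of `U s` the identity of P is related to the section composed with π. This
  -- yields local arrows from ζ to ξ, which agree on overlaps by `key`.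
  have hν : ∀ s, ∃ ν : w s ⟶ z s, 𝔛.p.IsHomLift (Mfd.preimageMap π (U s)) ν ∧
      R.rel (l s) (ν ≫ μ s) := by
    intro s
    obtain ⟨β, hβ, hR⟩ := R.exists_rel (f' := Mfd.preimageMap π (U s) ≫ σ s) (l s) (hl s)
      (by rw [Category.assoc, hσ, Mfd.preimageMap_incl])
    obtain ⟨ν, hν, rfl⟩ := hG.exists_lift (hμ s) hβ rfl
    exact ⟨ν, hν, hR⟩
  choose ν hν hR using hν
  obtain ⟨Θ, hΘ, hΘ'⟩ := h𝔛.exists_arrow (fun p => ⟨π p, hU (π p)⟩) π hζ hξ hl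
    (χ := fun s => ν s ≫ θ s)
    (fun s => isHomLift_comp (hν s) (hθ s) (Mfd.preimageMap_incl π (U s)))
    (fun i j w α β h => by
      rw [← Category.assoc, ← Category.assoc]
      refine key _ _ ?_
      rw [Category.assoc, Category.assoc]
      have h1 := R.comp α (hR i)
      rw [h] at h1
      exact R.trans (R.symm h1) (R.comp β (hR j)))
  refine ⟨ξ, Θ, hΘ, ?_⟩
  intro y α β hαβ
  have hα : 𝔛.p.IsHomLift (𝔛.p.map α ≫ eqToHom hζ) α := inferInstance
  have hβ : 𝔛.p.IsHomLift (𝔛.p.map β ≫ eqToHom hζ) β := inferInstance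
  generalize 𝔛.p.map α ≫ eqToHom hζ = f at hα
  generalize 𝔛.p.map β ≫ eqToHom hζ = f' at hβ
  have hb := R.base_eq hαβ hα hβ
  -- The equality is local on y: over the part that π carries into `U s`, both α and β factor
  -- through `l s`, where Θ is known.
  choose y' ρ hρ using fun s =>
    hG.exists_pullback ((𝔛.p.obj y).incl (Mfd.preimage (f ≫ π) (U s))) y rfl
  refine h𝔛.arrow_ext (Mfd.isCoveringFamily_incl fun p => ⟨π (f p), hU (π (f p))⟩)
    (isHomLift_comp hα hΘ rfl) (isHomLift_comp hβ hΘ hb.symm) hρ fun s => ?_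
  obtain ⟨α', -, hα'⟩ := hG.exists_lift (hl s) (isHomLift_comp (hρ s) hα rfl)
    (Mfd.liftOpen_incl (U := Mfd.preimage π (U s))
      ((𝔛.p.obj y).incl (Mfd.preimage (f ≫ π) (U s)) ≫ f) fun p => p.2)
  obtain ⟨β', -, hβ'⟩ := hG.exists_lift (hl s) (isHomLift_comp (hρ s) hβ rfl)
    (Mfd.liftOpen_incl (U := Mfd.preimage π (U s))
      ((𝔛.p.obj y).incl (Mfd.preimage (f ≫ π) (U s)) ≫ f') fun p => by
        have h1 : (f' ≫ π) p.1 ∈ U s := hb ▸ p.2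
        exact h1)
  have h1 : α' ≫ ν s ≫ θ s = β' ≫ ν s ≫ θ s := by
    rw [← Category.assoc, ← Category.assoc]
    refine key _ _ ?_
    rw [Category.assoc, Category.assoc]
    refine R.trans (R.symm (R.comp α' (hR s))) (R.trans ?_ (R.comp β' (hR s)))
    rw [hα', hβ']
    exact R.comp _ hαβ
  rw [← Category.assoc, ← Category.assoc, ← hα', ← hβ', Category.assoc, Category.assoc, hΘ', h1]

end

/-! ### The functor to torsors is fully faithful -/

section

open CategoryTheory.BasedCategory

variable {𝔛 : BasedCategory.{v₁, u₁} Mfd.{u}} {X : Mfd.{u}} {x : BasedFunctor (ofObj X) 𝔛}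

namespace IsomSpace

variable {ξ η : 𝔛.obj} {P : IsomSpace x ξ} {P' : IsomSpace x η} {Γ : LieGroupoid X}
  {D : UniversalIsom x Γ.src Γ.tgt}

theorem torsorMap_ext {h𝔛 : IsGroupoidFibration 𝔛} {hD : Γ.IsCompatible D}
    {m m' : P.torsor h𝔛 hD ⟶ P'.torsor h𝔛 hD}
    (hb : LieGroupoid.Torsor.Hom.base m = LieGroupoid.Torsor.Hom.base m')
    {b : P.total ⟶ X} {θ : x.fam b ⟶ η} (h : P'.Rep (LieGroupoid.Torsor.Hom.total m) θ)
    (h' : P'.Rep (LieGroupoid.Torsor.Hom.total m') θ) : m = m' :=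
  LieGroupoid.Torsor.Hom.ext hb (h.unique h')

/-- Every map of torsors `Isom(x, ξ) ⟶ Isom(x, η)` comes from an arrow `ξ ⟶ η`. -/
theorem exists_arrow_of_torsorMap (h𝔛 : IsStack 𝔛) (hD : Γ.IsCompatible D)
    (m : P.torsor h𝔛.isGroupoidFibration hD ⟶ P'.torsor h𝔛.isGroupoidFibration hD) :
    ∃ φ : ξ ⟶ η, LieGroupoid.Torsor.Hom.base m = 𝔛.p.map φ ∧
      P'.Rep (LieGroupoid.Torsor.Hom.total m) (P.hom ≫ φ) := by
  have hG := h𝔛.isGroupoidFibration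
  obtain ⟨c, f, hproj, hanchor, hact⟩ := m
  change 𝔛.p.obj ξ ⟶ 𝔛.p.obj η at c
  change P.total ⟶ P'.total at f
  have hf := rep_of_arrow f (Mfd.hom_ext hanchor : f ≫ P'.anchor = P.anchor)
  set χ := x.restr f (Mfd.hom_ext hanchor : f ≫ P'.anchor = P.anchor) ≫ P'.hom with hχ_def
  have hχ : 𝔛.p.IsHomLift (P.proj ≫ c) χ := by
    have : f ≫ P'.proj = P.proj ≫ c := Mfd.hom_ext hproj
    rw [← this]
    exact hf.isHomLift
  -- Arrows with the same composite to ξ differ by an isomorphism represented by some g in Γ.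
  -- Equivariance of f says that χ absorbs the same isomorphism, which is the descent condition.
  have H : ∀ {w : 𝔛.obj} (α β : w ⟶ x.fam P.anchor), α ≫ P.hom = β ≫ P.hom →
      α ≫ χ = β ≫ χ := by
    intro w α β hαβ
    have hα : 𝔛.p.IsHomLift (𝔛.p.map α ≫ eqToHom (x.p_obj_fam _)) α := inferInstance
    have hβ : 𝔛.p.IsHomLift (𝔛.p.map β ≫ eqToHom (x.p_obj_fam _)) β := inferInstance
    generalize 𝔛.p.map α ≫ eqToHom (x.p_obj_fam P.anchor) = a at hα
    generalize 𝔛.p.map β ≫ eqToHom (x.p_obj_fam P.anchor) = a' at hβ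
    have hb : a ≫ P.proj = a' ≫ P.proj :=
      eq_of_isHomLift (φ := β ≫ P.hom) (hαβ ▸ isHomLift_comp hα P.isHomLift rfl)
        (isHomLift_comp hβ P.isHomLift rfl)
    obtain ⟨α₀, hα₀, rfl⟩ := hG.exists_lift (x.isHomLift_restr a rfl) hα (Category.id_comp _)
    obtain ⟨β₀, hβ₀, rfl⟩ := hG.exists_lift (x.isHomLift_restr a' rfl) hβ (Category.id_comp _)
    obtain ⟨g, hg⟩ := exists_isAct_of_proj_eq (D := D) hG hb
    obtain ⟨φ, hφ⟩ := UniversalIsom.exists_rep_of_arrow (D := D) hG g hg.anchor_eq_src.symm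
      hg.anchor_eq.symm
    have e1 := hg.comp_eq hG (rep_of_arrow a rfl) hφ (rep_of_arrow a' rfl)
    have hg' : P'.IsAct D (a ≫ f) g (a' ≫ f) := by
      have hs : ∀ w, P.anchor (a w) = Γ.src (g w) := fun w =>
        congrArg (fun k : 𝔛.p.obj _ ⟶ X => k w) hg.anchor_eq_src
      refine isAct_of_act_eq hG (fun w => (hanchor (a w)).trans (hs w)) fun w => ?_
      refine (hact (a w) (g w) (hs w)).symm.trans ?_
      exact congrArg f (hg.act_eq hG w (hs w))
    have e2 := hg'.comp_eq hG (hf.restrict a rfl) hφ (hf.restrict a' rfl)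
    have e3 : α₀ ≫ φ = β₀ := by
      refine hG.lift_ext_of_isHomLift (φ := x.restr a' rfl ≫ P.hom) (f := 𝟙 _) ?_
        (isHomLift_comp hα₀ hφ.1 (Category.id_comp _)) hβ₀
      rw [Category.assoc, e1]
      simpa only [Category.assoc] using hαβ
    rw [Category.assoc, Category.assoc, ← e3, Category.assoc, e2]
  obtain ⟨φ, h1, h2⟩ := h𝔛.exists_arrow_of_submersion P.submersion P.surjective P.isHomLift hχ H
  exact ⟨φ, IsHomLift.eq_of_isHomLift 𝔛.p c φ, h2 ▸ hf⟩

/-- The functor `ξ ↦ Isom(x, ξ)` to the stack of torsors. -/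
noncomputable def torsorFunctor (h𝔛 : IsGroupoidFibration 𝔛) (hD : Γ.IsCompatible D)
    (P : ∀ ξ, IsomSpace x ξ) : BasedFunctor 𝔛 Γ.classifyingStack where
  obj ξ := (P ξ).torsor h𝔛 hD
  map {ξ η} φ := ((P ξ).exists_torsorMap h𝔛 hD (P η) φ).choose
  map_id ξ := by
    obtain ⟨h1, h2⟩ := ((P ξ).exists_torsorMap h𝔛 hD (P ξ) (𝟙 ξ)).choose_spec
    have h3 : (P ξ).Rep (𝟙 (P ξ).total) ((P ξ).hom ≫ 𝟙 ξ) := by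
      rw [Category.comp_id]
      exact rep_id
    exact torsorMap_ext (h1.trans (𝔛.p.map_id ξ)) h2 h3
  map_comp {ξ η ζ} φ ψ := by
    obtain ⟨h1, h2⟩ := ((P ξ).exists_torsorMap h𝔛 hD (P ζ) (φ ≫ ψ)).choose_spec
    obtain ⟨h3, h4⟩ := ((P ξ).exists_torsorMap h𝔛 hD (P η) φ).choose_spec
    obtain ⟨h5, h6⟩ := ((P η).exists_torsorMap h𝔛 hD (P ζ) ψ).choose_spec
    have h7 := Category.assoc (P ξ).hom φ ψ ▸ h6.comp h4
    exact torsorMap_ext (h1.trans ((𝔛.p.map_comp φ ψ).trans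
      (congrArg₂ (fun a b => a ≫ b) h3 h5).symm)) h2 h7
  w := CategoryTheory.Functor.ext (fun _ => rfl) fun ξ η φ => by
    refine (((P ξ).exists_torsorMap h𝔛 hD (P η) φ).choose_spec.1).trans ?_
    exact show 𝔛.p.map φ = 𝟙 _ ≫ 𝔛.p.map φ ≫ 𝟙 _ by simp

theorem torsorFunctor_map_rep (h𝔛 : IsGroupoidFibration 𝔛) (hD : Γ.IsCompatible D)
    (P : ∀ ξ, IsomSpace x ξ) (φ : ξ ⟶ η) :
    LieGroupoid.Torsor.Hom.base ((torsorFunctor h𝔛 hD P).map φ) = 𝔛.p.map φ ∧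
      (P η).Rep (LieGroupoid.Torsor.Hom.total ((torsorFunctor h𝔛 hD P).map φ)) ((P ξ).hom ≫ φ) :=
  ((P ξ).exists_torsorMap h𝔛 hD (P η) φ).choose_spec

/-- The torsor map determines the composite of φ with the universal arrow to ξ. That arrow lies over
a surjective submersion, along which arrows of a stack are determined. -/
theorem torsorFunctor_faithful (h𝔛 : IsStack 𝔛) (hD : Γ.IsCompatible D)
    (P : ∀ ξ, IsomSpace x ξ) :
    (torsorFunctor h𝔛.isGroupoidFibration hD P).toFunctor.Faithful where
  map_injective {ξ η φ ψ} h := by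
    obtain ⟨h1, h2⟩ := torsorFunctor_map_rep h𝔛.isGroupoidFibration hD P φ
    obtain ⟨h3, h4⟩ := torsorFunctor_map_rep h𝔛.isGroupoidFibration hD P ψ
    rw [h] at h1 h2
    have h5 := h1.symm.trans h3
    exact h𝔛.arrow_ext_of_submersion (P ξ).submersion (P ξ).surjective (P ξ).isHomLift
      (IsHomLift.map _ φ) (h5 ▸ IsHomLift.map _ ψ) (h2.hom_unique h4)

theorem torsorFunctor_full (h𝔛 : IsStack 𝔛) (hD : Γ.IsCompatible D) (P : ∀ ξ, IsomSpace x ξ) :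
    (torsorFunctor h𝔛.isGroupoidFibration hD P).toFunctor.Full where
  map_surjective {ξ η} m := by
    obtain ⟨φ, h1, h2⟩ := exists_arrow_of_torsorMap h𝔛 hD m
    obtain ⟨h3, h4⟩ := torsorFunctor_map_rep h𝔛.isGroupoidFibration hD P φ
    exact ⟨φ, torsorMap_ext (h3.trans h1.symm) h4 h2⟩

end IsomSpace

end

/-! ### Torsor maps over isomorphisms -/

section

open CategoryTheory.BasedCategory

namespace LieGroupoid.Torsor

open Topology Mfd

variable {M : Mfd.{u}} {Γ : LieGroupoid M} {Q P : Torsor Γ}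

theorem Hom.total_actT (m : Hom Q P) {q : Q.total} {γ : Γ.arr} (h : Q.anchor q = Γ.src γ) :
    m.total (Q.actT q γ) = P.actT (m.total q) γ := by
  rw [actT_eq h, actT_eq ((m.anchor_total q).trans h), m.total_act]

theorem Hom.divT_total (m : Hom Q P) {q q' : Q.total} (h : Q.proj q = Q.proj q') :
    P.divT (m.total q) (m.total q') = Q.divT q q' := by
  refine divT_eq ((m.anchor_total q).trans (anchor_eq_src_divT h)) ?_
  rw [← m.total_actT (anchor_eq_src_divT h), actT_divT h]

/-- A morphism of torsors over an isomorphism is an isomorphism. -/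
theorem isIso_of_base (m : Q ⟶ P) (c : P.base ⟶ Q.base) (h₁ : Hom.base m ≫ c = 𝟙 Q.base)
    (h₂ : c ≫ Hom.base m = 𝟙 P.base) : IsIso m := by
  let m' : Hom Q P := m
  have e₁ : ∀ s, c (m'.base s) = s := fun s => congrArg (fun k : Q.base ⟶ Q.base => k s) h₁
  have e₂ : ∀ s, m'.base (c s) = s := fun s => congrArg (fun k : P.base ⟶ P.base => k s) h₂
  have hinj : Function.Injective m'.total := by
    intro q q' h
    have hq : Q.proj q = Q.proj q' := by
      rw [← e₁ (Q.proj q), ← e₁ (Q.proj q'), ← m'.proj_total, ← m'.proj_total, h]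
    have h3 := m'.divT_total hq
    rw [← h, m'.divT_total rfl] at h3
    rw [← actT_divT (rfl : Q.proj q = Q.proj q), h3, actT_divT hq]
  -- The local inverse starts from a section of Q over the image of y in the base and translates it
  -- by the quotient, taken in P, of its image and y. It is smooth because division is.
  have hloc : ∀ p : P.total, ∃ g : P.total → Q.total, SmoothNear g p ∧
      ∀ᶠ y in 𝓝 p, m'.total (g y) = y := by
    intro p
    obtain ⟨q, hq⟩ := Q.proj_surjective (c (P.proj p))
    obtain ⟨σ, -, hσ, hσ'⟩ := Q.proj_submersion.exists_smoothNear_section q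
    rw [hq] at hσ hσ'
    have hc : SmoothNear (fun y => c (P.proj y)) p := smoothNear_hom (P.proj ≫ c) p
    have hs : SmoothNear (fun y => σ (c (P.proj y))) p :=
      SmoothNear.comp (g := σ) (f := fun y => c (P.proj y)) hσ hc
    have hms : SmoothNear (fun y => m'.total (σ (c (P.proj y)))) p :=
      SmoothNear.comp (g := m'.total) (smoothNear_hom m'.total _) hs
    have h1 : ∀ᶠ y in 𝓝 p, P.proj (m'.total (σ (c (P.proj y)))) = P.proj y := by
      filter_upwards [hc.continuousAt.eventually hσ'] with y hy
      rw [m'.proj_total, hy, e₂]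
    have h2 : ∀ y, P.proj (m'.total (σ (c (P.proj y)))) = P.proj y →
        Q.anchor (σ (c (P.proj y))) = Γ.src (P.divT (m'.total (σ (c (P.proj y)))) y) :=
      fun y hy => (m'.anchor_total _).symm.trans (anchor_eq_src_divT hy)
    refine ⟨fun y => Q.actT (σ (c (P.proj y))) (P.divT (m'.total (σ (c (P.proj y)))) y),
      smoothNear_actT hs (smoothNear_divT hms (smoothNear_id p) h1) (h1.mono h2), ?_⟩
    filter_upwards [h1] with y hy
    rw [m'.total_actT (h2 y hy), actT_divT hy]
  choose G hG hG' using hloc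
  have hright : ∀ p, m'.total (G p p) = p := fun p => (hG' p).self_of_nhds
  -- By injectivity any two local inverses agree where both are defined, so the diagonal choice
  -- coincides near p with the single smooth function `G p`.
  have hsmooth : IsSmooth fun p => G p p := isSmooth_of_smoothNear fun p =>
    (hG p).congr (by
      filter_upwards [hG' p] with y hy
      exact hinj ((hright y).trans hy.symm))
  let g : P.total ⟶ Q.total := SmoothMap.mk _ hsmooth
  have hg : ∀ p, m'.total (g p) = p := hright
  have hga : ∀ p, Q.anchor (g p) = P.anchor p := fun p => by
    rw [← m'.anchor_total, hg]
  let n : Hom P Q :=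
    { base := c
      total := g
      proj_total := fun p => by rw [← e₁ (Q.proj (g p)), ← m'.proj_total, hg]
      anchor_total := hga
      total_act := fun p γ h => hinj (by
        rw [hg, m'.total_act _ _ ((hga p).trans h)]
        congr 1
        exact (hg p).symm) }
  exact ⟨n, Hom.ext h₁ (hom_ext fun q => hinj (hg (m'.total q))), Hom.ext h₂ (hom_ext hg)⟩

end LieGroupoid.Torsor

end

/-! ### Descent data of a torsor and essential surjectivity -/

section

open CategoryTheory.BasedCategory

namespace LieGroupoid.Torsor

open Mfd

variable {X : Mfd.{u}} {Γ : LieGroupoid X} (Q : Torsor Γ)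

/-- The quotient of two `W`-valued points of a torsor with the same projection. -/
noncomputable def divHom {W : Mfd.{u}} (f f' : W ⟶ Q.total) (h : f ≫ Q.proj = f' ≫ Q.proj) :
    W ⟶ Γ.arr :=
  SmoothMap.mk (fun w => Q.divT (f w) (f' w)) (isSmooth_of_smoothNear fun w =>
    smoothNear_divT (smoothNear_hom f w) (smoothNear_hom f' w)
      (Filter.Eventually.of_forall fun y => congrArg (fun k : W ⟶ Q.base => k y) h))

variable {Q}

theorem divHom_src {W : Mfd.{u}} {f f' : W ⟶ Q.total} (h : f ≫ Q.proj = f' ≫ Q.proj) :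
    Q.divHom f f' h ≫ Γ.src = f ≫ Q.anchor :=
  hom_ext fun w => (anchor_eq_src_divT (congrArg (fun k : W ⟶ Q.base => k w) h)).symm

theorem divHom_tgt {W : Mfd.{u}} {f f' : W ⟶ Q.total} (h : f ≫ Q.proj = f' ≫ Q.proj) :
    Q.divHom f f' h ≫ Γ.tgt = f' ≫ Q.anchor :=
  hom_ext fun w => tgt_divT (congrArg (fun k : W ⟶ Q.base => k w) h)

variable {𝔛 : BasedCategory.{v₁, u₁} Mfd.{u}} {x : BasedFunctor (ofObj X) 𝔛}
  {D : UniversalIsom x Γ.src Γ.tgt}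

/-- The cocycle condition for the pullback of x to Q: quotients multiply, and compatibility turns
products into composites. -/
theorem rep_divHom_comp (hD : Γ.IsCompatible D) {W : Mfd.{u}} {f f' f'' : W ⟶ Q.total}
    (h : f ≫ Q.proj = f' ≫ Q.proj) (h' : f' ≫ Q.proj = f'' ≫ Q.proj) {b c d : W ⟶ X}
    {φ : x.fam b ⟶ x.fam c} {ψ : x.fam c ⟶ x.fam d} (hφ : D.Rep (Q.divHom f f' h) φ)
    (hψ : D.Rep (Q.divHom f' f'' h') ψ) : D.Rep (Q.divHom f f'' (h.trans h')) (φ ≫ ψ) := by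
  have h1 : ∀ w, Γ.tgt (Q.divHom f f' h w) = Γ.src (Q.divHom f' f'' h' w) := fun w =>
    congrArg (fun k : W ⟶ X => k w) ((divHom_tgt h).trans (divHom_src h').symm)
  have h2 := hD _ _ h1 hφ hψ
  have h3 : Γ.mulHom _ _ h1 = Q.divHom f f'' (h.trans h') := hom_ext fun w => by
    refine (mulT_eq (h1 w)).symm.trans ?_
    exact mulT_divT (congrArg (fun k : W ⟶ Q.base => k w) h)
      (congrArg (fun k : W ⟶ Q.base => k w) h')
  rwa [h3] at h2

/-- The cocycle condition for f, f, f makes this isomorphism idempotent. -/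
theorem eq_id_of_rep_divHom (h𝔛 : IsGroupoidFibration 𝔛) (hD : Γ.IsCompatible D) {W : Mfd.{u}}
    {f : W ⟶ Q.total} {b : W ⟶ X} {φ : x.fam b ⟶ x.fam b} (hφ : D.Rep (Q.divHom f f rfl) φ) :
    φ = 𝟙 _ := by
  have := h𝔛.isIso_of_isHomLift_id hφ.1
  rw [← cancel_epi φ, (rep_divHom_comp hD rfl rfl hφ hφ).hom_unique h𝔛 hφ, Category.comp_id]

variable (Q D) in
/-- `β` is the transport of `α` along the isomorphism given by the division of `Q`. -/
def IsTransport {W : Mfd.{u}} (f f' : W ⟶ Q.total) {z : 𝔛.obj} (α β : z ⟶ x.fam Q.anchor) : Prop :=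
  ∃ (h : f ≫ Q.proj = f' ≫ Q.proj) (φ : x.fam (f ≫ Q.anchor) ⟶ x.fam (f' ≫ Q.anchor))
    (α₀ : z ⟶ x.fam (f ≫ Q.anchor)), D.Rep (Q.divHom f f' h) φ ∧ 𝔛.p.IsHomLift (𝟙 W) α₀ ∧
      α₀ ≫ x.restr f rfl = α ∧ α₀ ≫ φ ≫ x.restr f' rfl = β

namespace IsTransport

variable {W : Mfd.{u}} {f f' f'' : W ⟶ Q.total} {z : 𝔛.obj} {α β γ : z ⟶ x.fam Q.anchor}

theorem isHomLift_left (H : Q.IsTransport D f f' α β) : 𝔛.p.IsHomLift f α := by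
  obtain ⟨h, φ, α₀, h1, h2, rfl, rfl⟩ := H
  exact isHomLift_comp h2 (x.isHomLift_restr f rfl) (Category.id_comp _)

theorem isHomLift_right (H : Q.IsTransport D f f' α β) : 𝔛.p.IsHomLift f' β := by
  obtain ⟨h, φ, α₀, h1, h2, rfl, rfl⟩ := H
  exact isHomLift_comp h2 (isHomLift_comp h1.1 (x.isHomLift_restr f' rfl) (Category.id_comp _))
    (Category.id_comp _)

theorem symm (h𝔛 : IsGroupoidFibration 𝔛) (hD : Γ.IsCompatible D)
    (H : Q.IsTransport D f f' α β) : Q.IsTransport D f' f β α := by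
  obtain ⟨h, φ, α₀, h1, h2, rfl, rfl⟩ := H
  obtain ⟨ψ, hψ⟩ := UniversalIsom.exists_rep_of_arrow (D := D) h𝔛 _ (divHom_src h.symm)
    (divHom_tgt h.symm)
  have h3 := eq_id_of_rep_divHom h𝔛 hD (rep_divHom_comp hD h h.symm h1 hψ)
  refine ⟨h.symm, ψ, α₀ ≫ φ, hψ, isHomLift_comp h2 h1.1 (Category.id_comp _),
    Category.assoc _ _ _, ?_⟩
  rw [Category.assoc, ← Category.assoc φ, h3, Category.id_comp]

theorem trans (h𝔛 : IsGroupoidFibration 𝔛) (hD : Γ.IsCompatible D)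
    (H : Q.IsTransport D f f' α β) (H' : Q.IsTransport D f' f'' β γ) :
    Q.IsTransport D f f'' α γ := by
  obtain ⟨h, φ, α₀, h1, h2, rfl, rfl⟩ := H
  obtain ⟨h', ψ, β₀, h1', h2', h3', rfl⟩ := H'
  have h4 : β₀ = α₀ ≫ φ := h𝔛.lift_ext_of_isHomLift (φ := x.restr f' rfl)
    (by rw [h3', Category.assoc]) h2' (isHomLift_comp h2 h1.1 (Category.id_comp _))
  refine ⟨h.trans h', φ ≫ ψ, α₀, rep_divHom_comp hD h h' h1 h1', h2, rfl, ?_⟩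
  rw [h4, Category.assoc, Category.assoc]

theorem unique (h𝔛 : IsGroupoidFibration 𝔛) (H : Q.IsTransport D f f' α β)
    (H' : Q.IsTransport D f f' α γ) : β = γ := by
  obtain ⟨h, φ, α₀, h1, h2, h3, rfl⟩ := H
  obtain ⟨h', ψ, β₀, h1', h2', h3', rfl⟩ := H'
  rw [h1.hom_unique h𝔛 h1',
    h𝔛.lift_ext_of_isHomLift (φ := x.restr f rfl) (h3.trans h3'.symm) h2 h2']

theorem comp (h𝔛 : IsGroupoidFibration 𝔛) (H : Q.IsTransport D f f' α β) {W' : Mfd.{u}}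
    {κ : W' ⟶ W} {z' : 𝔛.obj} {k : z' ⟶ z} (hk : 𝔛.p.IsHomLift κ k) :
    Q.IsTransport D (κ ≫ f) (κ ≫ f') (k ≫ α) (k ≫ β) := by
  obtain ⟨h, φ, α₀, h1, h2, rfl, rfl⟩ := H
  obtain ⟨φ', h3, h4⟩ := h𝔛.exists_restrict h1.1 κ (Category.assoc κ f Q.anchor).symm
    (Category.assoc κ f' Q.anchor).symm
  obtain ⟨k', h5, h6⟩ := h𝔛.exists_lift
    (x.isHomLift_restr κ (Category.assoc κ f Q.anchor).symm)
    (isHomLift_comp hk h2 (Category.comp_id _)) (Category.id_comp _)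
  refine ⟨by rw [Category.assoc, h, Category.assoc], φ', k', h1.restrict h3 h4, h5, ?_, ?_⟩
  · rw [← Category.assoc k, ← h6, Category.assoc k', x.restr_comp]
  · rw [← Category.assoc k, ← h6, Category.assoc k', ← Category.assoc (x.restr κ _) φ, ← h4,
      Category.assoc φ', x.restr_comp]

theorem exists_of_isHomLift (h𝔛 : IsGroupoidFibration 𝔛) (hα : 𝔛.p.IsHomLift f α)
    (h : f ≫ Q.proj = f' ≫ Q.proj) : ∃ β, Q.IsTransport D f f' α β := by
  obtain ⟨φ, hφ⟩ := UniversalIsom.exists_rep_of_arrow (D := D) h𝔛 _ (divHom_src h)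
    (divHom_tgt h)
  obtain ⟨α₀, h1, h2⟩ := h𝔛.exists_lift (x.isHomLift_restr f rfl) hα (Category.id_comp _)
  exact ⟨_, h, φ, α₀, hφ, h1, h2, rfl⟩

/-- The maps under α and β are determined by them; this lets the existentially quantified W of
`descentRelation` be replaced by any given one. -/
theorem congr {W' : Mfd.{u}} {a a' : W' ⟶ Q.total} (H : Q.IsTransport D f f' α β)
    (hα : 𝔛.p.IsHomLift a α) (hβ : 𝔛.p.IsHomLift a' β) : Q.IsTransport D a a' α β := by
  have h1 := H.isHomLift_left
  have h2 := H.isHomLift_right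
  obtain rfl : W = W' := (IsHomLift.domain_eq 𝔛.p f α).symm.trans (IsHomLift.domain_eq 𝔛.p a α)
  rwa [eq_of_isHomLift hα h1, eq_of_isHomLift hβ h2]

end IsTransport

variable (Q D) in
/-- The descent data on the pullback of the family `x` to a torsor. -/
def descentRelation (h𝔛 : IsGroupoidFibration 𝔛) (hD : Γ.IsCompatible D) :
    DescentRelation 𝔛 Q.proj (x.fam Q.anchor) where
  rel {z} α β := ∃ (W : Mfd.{u}) (f f' : W ⟶ Q.total), Q.IsTransport D f f' α β
  symm := fun ⟨W, f, f', H⟩ => ⟨W, f', f, H.symm h𝔛 hD⟩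
  trans {z α β γ} := fun ⟨W, f, f', H⟩ ⟨W', a, a', H'⟩ => by
    have h1 := H.isHomLift_right
    have h2 := H'.isHomLift_left
    have h3 := H'.isHomLift_right
    obtain rfl := (IsHomLift.domain_eq 𝔛.p f' β).symm.trans (IsHomLift.domain_eq 𝔛.p a β)
    exact ⟨W, f, a', H.trans h𝔛 hD (H'.congr h1 h3)⟩
  comp {z z'} k {α β} := fun ⟨W, f, f', H⟩ => by
    have h1 := H.isHomLift_left
    have hz := IsHomLift.domain_eq 𝔛.p f α
    exact ⟨_, _, _, H.comp h𝔛 (inferInstance : 𝔛.p.IsHomLift (𝔛.p.map k ≫ eqToHom hz) k)⟩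
  base_eq := fun ⟨W, f, f', H⟩ hα hβ => (H.congr hα hβ).1
  exists_rel α hα h := by
    obtain ⟨β, hβ⟩ := IsTransport.exists_of_isHomLift (D := D) h𝔛 hα h
    exact ⟨β, hβ.isHomLift_right, _, _, _, hβ⟩
  unique {V b z α β β'} := fun ⟨W, f, f', H⟩ ⟨W', a, a', H'⟩ hβ hβ' => by
    have h1 := H.isHomLift_left
    have h2 := H.isHomLift_right
    obtain rfl := (IsHomLift.domain_eq 𝔛.p b β).symm.trans (IsHomLift.domain_eq 𝔛.p f' β)
    exact (H.congr h1 hβ).unique h𝔛 (H'.congr h1 hβ')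

/-- Every torsor is isomorphic to `Isom(x, ξ)` for some `ξ`. -/
theorem exists_iso_isomSpace (h𝔛 : IsStack 𝔛) (hD : Γ.IsCompatible D)
    (P : ∀ ξ, IsomSpace x ξ) (Q : Torsor Γ) :
    ∃ (ξ : 𝔛.obj) (m : Q ⟶ (P ξ).torsor h𝔛.isGroupoidFibration hD) (hξ : Q.base = 𝔛.p.obj ξ),
      IsIso m ∧ Hom.base m = eqToHom hξ := by
  have hG := h𝔛.isGroupoidFibration
  obtain ⟨ξ, θ, hθ, hrel⟩ := h𝔛.exists_descent Q.proj_submersion Q.proj_surjective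
    (x.p_obj_fam Q.anchor) (Q.descentRelation D hG hD)
  have hξ : Q.base = 𝔛.p.obj ξ := (IsHomLift.codomain_eq 𝔛.p Q.proj θ).symm
  obtain ⟨f, hf⟩ := IsomSpace.exists_rep (P := P ξ) θ
  have hproj : f ≫ (P ξ).proj = Q.proj ≫ eqToHom hξ :=
    eq_of_isHomLift hf.isHomLift (inferInstance : 𝔛.p.IsHomLift (Q.proj ≫ eqToHom hξ) θ)
  -- The quotient of q and q · γ is γ, so the arrows at these two points are related through the
  -- isomorphism that γ represents, and θ identifies them. Read in Isom(x, ξ), this is equivariance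
  -- of f.
  have hact : ∀ (q : Q.total) (γ : Γ.arr) (h : Q.anchor q = Γ.src γ)
      (h' : (P ξ).anchor (f q) = Γ.src γ),
      f (Q.act q γ h) = (P ξ).act D hG (f q) γ h' := by
    intro q γ h h'
    have hq : point q ≫ Q.proj = point (Q.act q γ h) ≫ Q.proj :=
      congrArg point (Q.proj_act q γ h).symm
    have hdiv : Q.divHom _ _ hq = point γ := hom_ext fun _ => divT_eq h (actT_eq h)
    obtain ⟨φ, hφ⟩ := UniversalIsom.exists_rep_of_arrow (D := D) hG _ (divHom_src hq)
      (divHom_tgt hq)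
    have h1 := hrel (α := x.restr (point q) rfl) (β := φ ≫ x.restr (point (Q.act q γ h)) rfl)
      ⟨_, _, _, hq, φ, 𝟙 _, hφ, IsHomLift.id (x.p_obj_fam _), Category.id_comp _,
        Category.id_comp _⟩
    rw [hdiv] at hφ
    have h2 : (P ξ).IsAct D (point q ≫ f) (point γ) (point (Q.act q γ h) ≫ f) :=
      ⟨_, _, φ, _, _, hf.restrict _ rfl, hφ, hf.restrict _ rfl,
        by rw [← Category.assoc, ← h1]⟩
    exact (h2.act_eq hG PUnit.unit h').symm
  have hanchor : ∀ q, (P ξ).anchor (f q) = Q.anchor q := fun q =>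
    congrArg (fun k : Q.total ⟶ X => k q) hf.anchor_eq
  let m : Hom Q ((P ξ).torsor hG hD) :=
    { base := eqToHom hξ
      total := f
      proj_total := fun q => congrArg (fun k : Q.total ⟶ 𝔛.p.obj ξ => k q) hproj
      anchor_total := hanchor
      total_act := fun q γ h => hact q γ h ((hanchor q).trans h) }
  exact ⟨ξ, m, hξ, isIso_of_base m (eqToHom hξ.symm) (eqToHom_trans hξ hξ.symm)
    (eqToHom_trans hξ.symm hξ), rfl⟩

end LieGroupoid.Torsor

end

/-! ### Isomorphisms of fibrations and the conclusion -/

namespace CategoryTheory.BasedCategory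

variable {𝒮 : Type u₀} [Category.{v₀} 𝒮] {𝒳 : BasedCategory.{v₁, u₁} 𝒮}
  {𝒴 : BasedCategory.{v₂, u₂} 𝒮}

/-- A fully faithful functor over `𝒮` that is essentially surjective on the fibers is an
isomorphism of fibrations. -/
theorem isIsomorphism_of_full_of_faithful (F : BasedFunctor 𝒳 𝒴) [F.toFunctor.Full]
    [F.toFunctor.Faithful]
    (h : ∀ y : 𝒴.obj, ∃ (a : 𝒳.obj) (e : F.obj a ≅ y), 𝒴.p.IsHomLift (𝟙 (𝒴.p.obj y)) e.hom) :
    IsIsomorphism F := by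
  choose G e he using h
  let G' : 𝒴.obj ⥤ 𝒳.obj :=
    { obj := G
      map := fun {y y'} m => F.toFunctor.preimage ((e y).hom ≫ m ≫ (e y').inv)
      map_id := fun y => F.toFunctor.map_injective (by simp)
      map_comp := fun f g => F.toFunctor.map_injective (by simp) }
  have hG : ∀ {y y' : 𝒴.obj} (m : y ⟶ y'), F.map (G'.map m) = (e y).hom ≫ m ≫ (e y').inv :=
    fun m => F.toFunctor.map_preimage _
  have hbase : ∀ y, 𝒳.p.obj (G y) = 𝒴.p.obj y := fun y =>
    (F.w_obj (G y)).symm.trans (IsHomLift.domain_eq 𝒴.p (𝟙 (𝒴.p.obj y)) (e y).hom)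
  have hinv : ∀ y, 𝒴.p.IsHomLift (𝟙 (𝒴.p.obj y)) (e y).inv := fun y =>
    IsHomLift.lift_id_inv 𝒴.p _ (e y)
  have hlift : ∀ {y y' : 𝒴.obj} (m : y ⟶ y'), 𝒳.p.IsHomLift (𝒴.p.map m) (G'.map m) := by
    intro y y' m
    have : 𝒴.p.IsHomLift (𝒴.p.map m) (F.map (G'.map m)) := by
      rw [hG]
      exact isHomLift_comp (he y) (isHomLift_comp (IsHomLift.map 𝒴.p m) (hinv y')
        (Category.comp_id _)) (Category.id_comp _)
    exact F.isHomLift_map _ _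
  let g : BasedFunctor 𝒴 𝒳 :=
    { toFunctor := G'
      w := Functor.ext hbase fun y y' m => by
        have := hlift m
        exact IsHomLift.fac' 𝒳.p (𝒴.p.map m) (G'.map m) }
  have nat₁ : ∀ {y y' : 𝒴.obj} (m : y ⟶ y'), F.map (G'.map m) ≫ (e y').hom = (e y).hom ≫ m := by
    intro y y' m
    rw [hG]
    simp
  have nat₂ : ∀ {a a' : 𝒳.obj} (m : a ⟶ a'), G'.map (F.map m) ≫
      (F.toFunctor.preimageIso (e (F.obj a'))).hom =
        (F.toFunctor.preimageIso (e (F.obj a))).hom ≫ m := by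
    intro a a' m
    refine F.toFunctor.map_injective ?_
    rw [Functor.map_comp, Functor.map_comp, hG]
    simp
  refine ⟨g, ⟨BasedNatIso.mkNatIso (NatIso.ofComponents e nat₁) fun y => he y⟩,
    ⟨BasedNatIso.mkNatIso (NatIso.ofComponents
      (fun a => F.toFunctor.preimageIso (e (F.obj a))) nat₂) fun a => ?_⟩⟩
  have : 𝒴.p.IsHomLift (𝟙 (𝒳.p.obj a))
      (F.map (F.toFunctor.preimageIso (e (F.obj a))).hom) := by
    have h1 := he (F.obj a)
    rw [F.w_obj] at h1
    simpa using h1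
  exact F.isHomLift_map (𝟙 (𝒳.p.obj a)) (F.toFunctor.preimageIso (e (F.obj a))).hom

end CategoryTheory.BasedCategory

open CategoryTheory.BasedCategory

theorem mainTheorem5 (𝔛 : CategoryTheory.BasedCategory.{v₁, u₁} Mfd.{u})
    (h𝔛 : IsDifferentiableStack 𝔛) (X : Mfd.{u})
    (x : CategoryTheory.BasedFunctor (CategoryTheory.BasedCategory.ofObj X) 𝔛)
    (hx : IsVersalFamily x) :
    (∃ Γ : LieGroupoid X, IsSymmetryGroupoid x Γ) ∧
      ∀ Γ : LieGroupoid X, IsSymmetryGroupoid x Γ →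
        CategoryTheory.BasedCategory.IsIsomorphic 𝔛 Γ.classifyingStack := by
  have hS := h𝔛.isStack
  have hG := hS.isGroupoidFibration
  refine ⟨?_, fun Γ hΓ => ?_⟩
  · obtain ⟨V, e, he, hs⟩ := hx.isRepresentableSubmersion X x
    exact exists_isSymmetryGroupoid hG he hs
  · obtain ⟨D, hD⟩ := hΓ.exists_universalIsom hG
    let P : ∀ ξ, IsomSpace x ξ := fun ξ => (hx.nonempty_isomSpace hG ξ).some
    have := IsomSpace.torsorFunctor_full hS hD P
    have := IsomSpace.torsorFunctor_faithful hS hD P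
    -- Essential surjectivity on the fibers. The map from Q lies over an `eqToHom`, which counts as
    -- a lift of the identity of `Q.base`; its inverse is the isomorphism wanted.
    have key : ∀ Q : Γ.Torsor, ∃ (ξ : 𝔛.obj) (e : (P ξ).torsor hG hD ≅ Q),
        Γ.classifyingStack.p.IsHomLift (𝟙 Q.base) e.hom := by
      intro Q
      obtain ⟨ξ, m, hξ, hm, hb⟩ := LieGroupoid.Torsor.exists_iso_isomSpace hS hD P Q
      let e : Q ≅ (P ξ).torsor hG hD := asIso m
      have h1 : Γ.classifyingStack.p.IsHomLift (𝟙 Q.base) e.hom :=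
        IsHomLift.of_fac' Γ.classifyingStack.p (𝟙 Q.base) m rfl hξ.symm (by
          refine Eq.trans hb ?_
          rw [Category.id_comp]
          exact (Category.id_comp _).symm)
      exact ⟨ξ, e.symm, IsHomLift.lift_id_inv Γ.classifyingStack.p Q.base e⟩
    exact ⟨IsomSpace.torsorFunctor hG hD P, isIsomorphism_of_full_of_faithful _ key⟩
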